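/- Let $N$ be a complex manifold (finite-dimensional, Hausdorff, second countable) with almost complex structure $I_0$, and let $(g_0,I_0,\omega_0)$ be a real-analytic Kähler structure on $N$: $g_0$ is a real-analytic Riemannian metric, $\omega_0=g_0(I_0\cdot,\cdot)$ is skew-symmetric, and $I_0$ is parallel for the Levi-Civita connection of $g_0$. Let $N^c=N\times\overline N$ be the manifold $N\times N$ with the complex structure $I_0\oplus(-I_0)$; $N$ is embedded in $N^c$ as the diagonal. Let $\mathcal F_1$ and $\mathcal F_2$ be the foliations of $N^c$ by the submanifolds $\{x\}\times N$ and $N\times\{y\}$ respectively, and let $F$ be the endomorphism of $TN^c$ equal to $+1$ on $T\mathcal F_1$ and $-1$ on $T\mathcal F_2$. For an open neighborhood $U$ of $N$ in $N^c$, call a quadruple $(g,I,J,K)$ of smooth tensor fields on $U$ *canonical* if $\omega_0$ extends to a holomorphic $2$-form $\omega=\omega_0^c$ on $U$ (that is, $\omega$ pulls back to $\omega_0$ under the diagonal embedding) such that $\omega$ is a complex symplectic form (closed and nondegenerate) for which $\mathcal F_1$ and $\mathcal F_2$ are Lagrangian, and: * $(g,I,J,K)$ is an almost hyper-Hermitian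 structure on $U$: $g$ is a Riemannian metric, $I,J,K$ are $g$-orthogonal, $I^2=J^2=K^2=-1$ and $IJ=-JI=K$; * (i) $(g,I,J,K)$ is an admissible extension of the Kähler structure: $J$ is the almost complex structure $I_0\oplus(-I_0)$ of $N^c$; along the diagonal, $g$, $I$ and $\omega_I=g(I\cdot,\cdot)$ restrict on $TN$ to $g_0$, $I_0$ and $\omega_0$; and $\omega_I-i\,\omega_K=\omega$ on $U$, where $\omega_K=g(K\cdot,\cdot)$; * (ii) $g,I,J,K$ are parallel along $\mathcal F_1$ (in all directions tangent to $\mathcal F_1$) for the complex bi-Lagrangian connection, i.e. the Levi-Civita connection of the holomorphic metric $\omega(F\cdot,\cdot)$ on $U$. **Theorem.** 1. In a sufficiently small neighborhood of $N$ in $N^c$ there is a unique canonical quadruple. Precisely: every open neighborhood of $N$ in $N^c$ contains an open neighborhood $U$ of $N$ on which there is exactly one canonical quadruple; and any two canonical quadruples, on open neighborhoods $U_1$ and $U_2$ of $N$, agree on some open neighborhood $V\subseteq U_1\cap U_2$ of $N$. 2. If $N$ is simply connected and $\omega_0$ extends to a nondegenerate holomorphic $2$-form on all of $N^c$, then there is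 exactly one canonical quadruple on all of $N^c$. -/

import Mathlib

open Set Bundle VectorField
open scoped Manifold ContDiff

noncomputable section

/-! ### Connections and parallel tensor fields on a real manifold -/

section General

variable {E : Type*} [NormedAddCommGroup E] [NormedSpace ℝ E]
  {H : Type*} [TopologicalSpace H] (I : ModelWithCorners ℝ E H)
  {M : Type*} [TopologicalSpace M] [ChartedSpace H M] [IsManifold I 1 M]
  {V : Type*} [NormedAddCommGroup V] [NormedSpace ℝ V]

/-- The vector field `X` is differentiable at the point `p`. -/
def FieldDiffAt (X : Π q : M, TangentSpace I q) (p : M) : Prop :=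
  MDifferentiableAt I I.tangent (fun q ↦ (TotalSpace.mk' E q (X q) : TangentBundle I M)) p

/-- An affine connection `cov` is written with Mathlib's order of arguments: `cov Y p u` is
`(∇_u Y)(p)`. The (vector valued) bilinear form field `b` is parallel on `U` along the
distribution `D`: `u (b(Y, Z)) = b(∇_u Y, Z) + b(Y, ∇_u Z)` for `u` tangent to `D`. -/
def IsParallelFormAlong
    (cov : (Π q : M, TangentSpace I q) → (Π q : M, TangentSpace I q →L[ℝ] TangentSpace I q))
    (D : Π q : M, Set (TangentSpace I q)) (U : Set M)
    (b : Π q : M, TangentSpace I q →L[ℝ] TangentSpace I q →L[ℝ] V) : Prop :=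
  ∀ p ∈ U, ∀ u ∈ D p, ∀ Y Z : Π q : M, TangentSpace I q,
    FieldDiffAt I Y p → FieldDiffAt I Z p →
    mvfderiv I (fun q ↦ b q (Y q) (Z q)) p u = b p (cov Y p u) (Z p) + b p (Y p) (cov Z p u)

/-- The endomorphism field `A` is parallel on `U` along the distribution `D`:
`∇_u (A Y) = A (∇_u Y)` for `u` tangent to `D`. -/
def IsParallelEndAlong
    (cov : (Π q : M, TangentSpace I q) → (Π q : M, TangentSpace I q →L[ℝ] TangentSpace I q))
    (D : Π q : M, Set (TangentSpace I q)) (U : Set M)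
    (A : Π q : M, TangentSpace I q →L[ℝ] TangentSpace I q) : Prop :=
  ∀ p ∈ U, ∀ u ∈ D p, ∀ Y : Π q : M, TangentSpace I q, FieldDiffAt I Y p →
    cov (fun q ↦ A q (Y q)) p u = A p (cov Y p u)

/-- `cov` is a Levi-Civita connection on the open set `U` of the (real or complex valued)
metric `b`: a torsion-free affine connection which parallelizes `b`. -/
structure IsLeviCivitaOn (b : Π q : M, TangentSpace I q →L[ℝ] TangentSpace I q →L[ℝ] V)
    (U : Set M)
    (cov : (Π q : M, TangentSpace I q) → (Π q : M, TangentSpace I q →L[ℝ] TangentSpace I q)) :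
    Prop where
  isCovariantDerivativeOn : IsCovariantDerivativeOn E cov U
  torsionFree : ∀ p ∈ U, ∀ X Y : Π q : M, TangentSpace I q,
    FieldDiffAt I X p → FieldDiffAt I Y p →
    cov Y p (X p) - cov X p (Y p) = mlieBracket I X Y p
  metric : IsParallelFormAlong I cov (fun _ ↦ univ) U b

/-- The 2-form `α` is closed on `U`, i.e. `dα(X, Y, Z) = 0` (Cartan's formula). -/
def IsClosedFormOn (U : Set M)
    (α : Π q : M, TangentSpace I q →L[ℝ] TangentSpace I q →L[ℝ] V) : Prop :=
  ∀ p ∈ U, ∀ X Y Z : Π q : M, TangentSpace I q,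
    FieldDiffAt I X p → FieldDiffAt I Y p → FieldDiffAt I Z p →
    mvfderiv I (fun q ↦ α q (Y q) (Z q)) p (X p)
      + mvfderiv I (fun q ↦ α q (Z q) (X q)) p (Y p)
      + mvfderiv I (fun q ↦ α q (X q) (Y q)) p (Z p)
      - α p (mlieBracket I X Y p) (Z p)
      - α p (mlieBracket I Y Z p) (X p)
      - α p (mlieBracket I Z X p) (Y p) = 0

end General

/-! ### Complex manifolds and real-analytic Kähler structures -/

variable {E : Type*} [NormedAddCommGroup E] [NormedSpace ℂ E]
  {N : Type*} [TopologicalSpace N] [ChartedSpace E N]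

/-- The real-analytic manifold underlying a complex manifold. -/
instance realAnalyticOfComplex [IsManifold 𝓘(ℂ, E) ω N] : IsManifold 𝓘(ℝ, E) ω N := by
  refine isManifold_of_contDiffOn _ _ _ fun e e' he he' ↦ ?_
  have h := (contDiffGroupoid ω 𝓘(ℂ, E)).compatible he he'
  rw [contDiffGroupoid, mem_groupoid_of_pregroupoid] at h
  have h1 : ContDiffOn ℂ ω (𝓘(ℂ, E) ∘ (e.symm ≫ₕ e') ∘ 𝓘(ℂ, E).symm)
      (𝓘(ℂ, E).symm ⁻¹' (e.symm ≫ₕ e').source ∩ range 𝓘(ℂ, E)) := h.1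
  exact h1.restrict_scalars ℝ

/-- The almost complex structure `I₀` of the complex manifold `N` (multiplication by `i` in
holomorphic charts). -/
def I₀ (x : N) : TangentSpace 𝓘(ℝ, E) x →L[ℝ] TangentSpace 𝓘(ℝ, E) x :=
  (Complex.I • ContinuousLinearMap.id ℝ E : E →L[ℝ] E)

variable [IsManifold 𝓘(ℂ, E) ω N]

variable (E N) in
/-- A real-analytic Kähler structure on the complex manifold `(N, I₀)`: a real-analytic Riemannian
metric `g₀` such that `ω₀ = g₀(I₀ ·, ·)` is skew-symmetric and `I₀` is parallel for the
Levi-Civita connection of `g₀`. -/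
structure AnalyticKahlerStructure where
  metric : ContMDiffRiemannianMetric 𝓘(ℝ, E) ω E (fun x : N ↦ TangentSpace 𝓘(ℝ, E) x)
  skew : ∀ (x : N) (u v : TangentSpace 𝓘(ℝ, E) x),
    metric.inner x (I₀ x u) v = - metric.inner x (I₀ x v) u
  integrable : ∃ cov, IsLeviCivitaOn 𝓘(ℝ, E) metric.inner univ cov ∧
    IsParallelEndAlong 𝓘(ℝ, E) cov (fun _ ↦ univ) univ (I₀ (E := E) (N := N))

/-- The Kähler form `ω₀ = g₀(I₀ ·, ·)`. -/
def AnalyticKahlerStructure.form (k : AnalyticKahlerStructure E N) (x : N) :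
    TangentSpace 𝓘(ℝ, E) x →L[ℝ] TangentSpace 𝓘(ℝ, E) x →L[ℝ] ℝ :=
  (k.metric.inner x).comp (I₀ x)

/-! ### The canonical complexification `N × N̄` -/

variable (E) in
/-- The tangent space of `N × N` at `p = (x, y)`; it is `T_x N × T_y N`. -/
abbrev TC (p : N × N) := TangentSpace (𝓘(ℝ, E).prod 𝓘(ℝ, E)) p

/-- The vector `(u, v)` tangent to `N × N`. -/
def pairT {x y : N} (u : TangentSpace 𝓘(ℝ, E) x) (v : TangentSpace 𝓘(ℝ, E) y) : TC E (x, y) :=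
  ((u, v) : TangentSpace 𝓘(ℝ, E) x × TangentSpace 𝓘(ℝ, E) y)

variable (E) in
/-- The almost complex structure `I₀ ⊕ -I₀` of `N × N̄`. -/
def Jc (p : N × N) : TC E p →L[ℝ] TC E p :=
  ((I₀ (E := E) p.1).prodMap (-(I₀ (E := E) p.2)) :
    TangentSpace 𝓘(ℝ, E) p.1 × TangentSpace 𝓘(ℝ, E) p.2 →L[ℝ]
    TangentSpace 𝓘(ℝ, E) p.1 × TangentSpace 𝓘(ℝ, E) p.2)

variable (E) in
/-- The tangent distribution of the vertical foliation `F₁`, with leaves `{x} × N`. -/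
def verticalDist (p : N × N) : Set (TC E p) :=
  {w | ∃ v : TangentSpace 𝓘(ℝ, E) p.2, w = pairT (0 : TangentSpace 𝓘(ℝ, E) p.1) v}

variable (E) in
/-- The tangent distribution of the horizontal foliation `F₂`, with leaves `N × {y}`. -/
def horizontalDist (p : N × N) : Set (TC E p) :=
  {w | ∃ u : TangentSpace 𝓘(ℝ, E) p.1, w = pairT u (0 : TangentSpace 𝓘(ℝ, E) p.2)}

variable (E) in
/-- The para-complex structure `F` of `(F₁, F₂)`: `+1` on vertical, `-1` on horizontal vectors. -/
def paraF (p : N × N) : TC E p →L[ℝ] TC E p :=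
  ((-(ContinuousLinearMap.id ℝ (TangentSpace 𝓘(ℝ, E) p.1))).prodMap
      (ContinuousLinearMap.id ℝ (TangentSpace 𝓘(ℝ, E) p.2)) :
    TangentSpace 𝓘(ℝ, E) p.1 × TangentSpace 𝓘(ℝ, E) p.2 →L[ℝ]
    TangentSpace 𝓘(ℝ, E) p.1 × TangentSpace 𝓘(ℝ, E) p.2)

variable (E) in
/-- `f` is complex differentiable at `p` as a function on the complex manifold `N × N̄`. -/
def IsComplexDiffAt (f : N × N → ℂ) (p : N × N) : Prop :=
  MDifferentiableAt (𝓘(ℝ, E).prod 𝓘(ℝ, E)) 𝓘(ℝ, ℂ) f p ∧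
    ∀ u : TC E p, mvfderiv (𝓘(ℝ, E).prod 𝓘(ℝ, E)) f p (Jc E p u)
      = Complex.I * mvfderiv (𝓘(ℝ, E).prod 𝓘(ℝ, E)) f p u

/-- The vector field, defined on the domain of the product chart at `p₀`, which has the constant
components `u` in that chart. -/
def coordField (p₀ : N × N) (u : E × E) (p : N × N) : TC E p :=
  (trivializationAt (E × E) (TangentSpace (𝓘(ℝ, E).prod 𝓘(ℝ, E)) : N × N → Type _) p₀).symm p u

/-- Complex valued fields of real bilinear forms on `N × N`. -/
abbrev CForm (E N : Type*) [NormedAddCommGroup E] [NormedSpace ℂ E] [TopologicalSpace N]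
    [ChartedSpace E N] := Π p : N × N, TC E p →L[ℝ] TC E p →L[ℝ] ℂ

/-- `Ω` is a holomorphic 2-form on the open subset `U` of `N × N̄`: alternating, complex bilinear
for `Jc`, and with holomorphic components in the product charts. -/
structure IsHolomorphicTwoFormOn (U : Set (N × N)) (Ω : CForm E N) : Prop where
  alternating : ∀ p ∈ U, ∀ u : TC E p, Ω p u u = 0
  complexLinear : ∀ p ∈ U, ∀ u v : TC E p, Ω p (Jc E p u) v = Complex.I * Ω p u v
  holomorphic : ∀ (p₀ : N × N) (u v : E × E),
    ∀ p ∈ U ∩ (chartAt (ModelProd E E) p₀).source,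
      IsComplexDiffAt E (fun q ↦ Ω q (coordField p₀ u q) (coordField p₀ v q)) p

/-- The form `Ω` restricts to the Kähler form `ω₀` on the diagonal, i.e. `f^* Ω = ω₀` for the
diagonal embedding `f`. -/
def ExtendsKahlerForm (k : AnalyticKahlerStructure E N) (Ω : CForm E N) : Prop :=
  ∀ (x : N) (u v : TangentSpace 𝓘(ℝ, E) x),
    Ω (x, x) (pairT u u) (pairT v v) = (k.form x u v : ℂ)

/-- `Ω` is nondegenerate at the points of `U`. -/
def IsNondegenerateOn (U : Set (N × N)) (Ω : CForm E N) : Prop :=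
  ∀ p ∈ U, ∀ u : TC E p, (∀ v : TC E p, Ω p u v = 0) → u = 0

/-- `(Ω, F₁, F₂)` is a complex bi-Lagrangian structure on `U`: `Ω` is a complex symplectic form
(holomorphic, closed and nondegenerate) and both foliations are Lagrangian for it. -/
structure IsComplexBiLagrangianOn (U : Set (N × N)) (Ω : CForm E N) : Prop where
  holomorphic : IsHolomorphicTwoFormOn U Ω
  nondegenerate : IsNondegenerateOn U Ω
  closed : IsClosedFormOn (𝓘(ℝ, E).prod 𝓘(ℝ, E)) U Ω
  vertical : ∀ p ∈ U, ∀ u ∈ verticalDist E p, ∀ v ∈ verticalDist E p, Ω p u v = 0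
  horizontal : ∀ p ∈ U, ∀ u ∈ horizontalDist E p, ∀ v ∈ horizontalDist E p, Ω p u v = 0

/-- The complex bi-Lagrangian metric `Ω(F ·, ·)`. -/
def biLagrangianMetric (Ω : CForm E N) : CForm E N := fun p ↦ (Ω p).comp (paraF E p)

/-- The complex bi-Lagrangian connection: the Levi-Civita connection of the complex bi-Lagrangian
metric. -/
def IsComplexBiLagrangianConnectionOn (U : Set (N × N)) (Ω : CForm E N)
    (cov : (Π q : N × N, TC E q) → (Π q : N × N, TC E q →L[ℝ] TC E q)) : Prop :=
  IsLeviCivitaOn (𝓘(ℝ, E).prod 𝓘(ℝ, E)) (biLagrangianMetric Ω) U cov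

/-! ### Almost hyper-Hermitian structures -/

/-- Quadruples `(g, I, J, K)` of a field of bilinear forms and three fields of endomorphisms. Only
their values on an open set `U` will matter. -/
structure TensorQuadruple (E N : Type*) [NormedAddCommGroup E] [NormedSpace ℂ E]
    [TopologicalSpace N] [ChartedSpace E N] where
  g : Π p : N × N, TC E p →L[ℝ] TC E p →L[ℝ] ℝ
  I : Π p : N × N, TC E p →L[ℝ] TC E p
  J : Π p : N × N, TC E p →L[ℝ] TC E p
  K : Π p : N × N, TC E p →L[ℝ] TC E p

namespace TensorQuadruple

/-- The two quadruples agree at all points of `U`. -/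
def AgreeOn (S S' : TensorQuadruple E N) (U : Set (N × N)) : Prop :=
  ∀ p ∈ U, S.g p = S'.g p ∧ S.I p = S'.I p ∧ S.J p = S'.J p ∧ S.K p = S'.K p

/-- The endomorphism field `A` is smooth on `U`. -/
def SmoothEndOn (U : Set (N × N)) (A : Π p : N × N, TC E p →L[ℝ] TC E p) : Prop :=
  ContMDiffOn (𝓘(ℝ, E).prod 𝓘(ℝ, E))
    ((𝓘(ℝ, E).prod 𝓘(ℝ, E)).prod 𝓘(ℝ, (E × E) →L[ℝ] (E × E))) ∞
    (fun p ↦ TotalSpace.mk' ((E × E) →L[ℝ] (E × E))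
      (E := fun p : N × N ↦ TC E p →L[ℝ] TC E p) p (A p)) U

/-- The field of bilinear forms `b` is smooth on `U`. -/
def SmoothFormOn (U : Set (N × N)) (b : Π p : N × N, TC E p →L[ℝ] TC E p →L[ℝ] ℝ) : Prop :=
  ContMDiffOn (𝓘(ℝ, E).prod 𝓘(ℝ, E))
    ((𝓘(ℝ, E).prod 𝓘(ℝ, E)).prod 𝓘(ℝ, (E × E) →L[ℝ] (E × E) →L[ℝ] ℝ)) ∞
    (fun p ↦ TotalSpace.mk' ((E × E) →L[ℝ] (E × E) →L[ℝ] ℝ)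
      (E := fun p : N × N ↦ TC E p →L[ℝ] TC E p →L[ℝ] ℝ) p (b p)) U

/-- `(g, I, J, K)` is an almost hyper-Hermitian structure on `U`. -/
structure IsAlmostHyperHermitianOn (U : Set (N × N)) (S : TensorQuadruple E N) : Prop where
  smooth_g : SmoothFormOn U S.g
  smooth_I : SmoothEndOn U S.I
  smooth_J : SmoothEndOn U S.J
  smooth_K : SmoothEndOn U S.K
  symm : ∀ p ∈ U, ∀ u v : TC E p, S.g p u v = S.g p v u
  pos : ∀ p ∈ U, ∀ u : TC E p, u ≠ 0 → 0 < S.g p u u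
  sq_I : ∀ p ∈ U, ∀ u : TC E p, S.I p (S.I p u) = -u
  sq_J : ∀ p ∈ U, ∀ u : TC E p, S.J p (S.J p u) = -u
  sq_K : ∀ p ∈ U, ∀ u : TC E p, S.K p (S.K p u) = -u
  mul_IJ : ∀ p ∈ U, ∀ u : TC E p, S.I p (S.J p u) = S.K p u
  mul_JI : ∀ p ∈ U, ∀ u : TC E p, S.J p (S.I p u) = -S.K p u
  orth_I : ∀ p ∈ U, ∀ u v : TC E p, S.g p (S.I p u) (S.I p v) = S.g p u v
  orth_J : ∀ p ∈ U, ∀ u v : TC E p, S.g p (S.J p u) (S.J p v) = S.g p u v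
  orth_K : ∀ p ∈ U, ∀ u v : TC E p, S.g p (S.K p u) (S.K p v) = S.g p u v

/-- `(g, I, J, K)` is an admissible extension on `U` of the Kähler structure, where `Ω` is the
holomorphic extension of `ω₀`; here `ω_I = g(I ·, ·)` and `ω_K = g(K ·, ·)`. -/
structure IsAdmissibleOn (k : AnalyticKahlerStructure E N) (U : Set (N × N)) (Ω : CForm E N)
    (S : TensorQuadruple E N) : Prop where
  almostComplex : ∀ p ∈ U, S.J p = Jc E p
  extends_g : ∀ (x : N) (u v : TangentSpace 𝓘(ℝ, E) x),
    S.g (x, x) (pairT u u) (pairT v v) = k.metric.inner x u v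
  extends_I : ∀ (x : N) (u : TangentSpace 𝓘(ℝ, E) x),
    S.I (x, x) (pairT u u) = pairT (I₀ x u) (I₀ x u)
  extends_form : ∀ (x : N) (u v : TangentSpace 𝓘(ℝ, E) x),
    S.g (x, x) (S.I (x, x) (pairT u u)) (pairT v v) = k.form x u v
  complexForm : ∀ p ∈ U, ∀ u v : TC E p,
    (S.g p (S.I p u) v : ℂ) - Complex.I * (S.g p (S.K p u) v : ℂ) = Ω p u v

/-- All four tensor fields are parallel on `U` along `F₁` for the connection `cov`. -/
structure IsParallelAlongVerticalOn (U : Set (N × N))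
    (cov : (Π q : N × N, TC E q) → (Π q : N × N, TC E q →L[ℝ] TC E q))
    (S : TensorQuadruple E N) : Prop where
  g : IsParallelFormAlong (𝓘(ℝ, E).prod 𝓘(ℝ, E)) cov (verticalDist E) U S.g
  I : IsParallelEndAlong (𝓘(ℝ, E).prod 𝓘(ℝ, E)) cov (verticalDist E) U S.I
  J : IsParallelEndAlong (𝓘(ℝ, E).prod 𝓘(ℝ, E)) cov (verticalDist E) U S.J
  K : IsParallelEndAlong (𝓘(ℝ, E).prod 𝓘(ℝ, E)) cov (verticalDist E) U S.K

/-- On the neighbourhood `U` of the diagonal, `ω₀` has a holomorphic extension `Ω` for which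
`(Ω, F₁, F₂)` is complex bi-Lagrangian, with complex bi-Lagrangian connection `cov`, and
`(g, I, J, K)` is an almost hyper-Hermitian structure which is an admissible extension of the
Kähler structure and is parallel for `cov` along `F₁`. -/
def IsCanonicalOn (k : AnalyticKahlerStructure E N) (U : Set (N × N))
    (S : TensorQuadruple E N) : Prop :=
  ∃ (Ω : CForm E N)
    (cov : (Π q : N × N, TC E q) → (Π q : N × N, TC E q →L[ℝ] TC E q)),
    IsComplexBiLagrangianOn U Ω ∧ ExtendsKahlerForm k Ω ∧
    IsComplexBiLagrangianConnectionOn U Ω cov ∧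
    IsAlmostHyperHermitianOn U S ∧ IsAdmissibleOn k U Ω S ∧ IsParallelAlongVerticalOn U cov S

end TensorQuadruple

end

/-! At `p = (x, y)` the tangent space is `T_x N ⊕ T_y N` with both summands Lagrangian, so `ω` is
determined by its mixed part `ω((u,0),(0,v))`, complex linear in `u` and antilinear in `v` for `I₀`.
There is therefore a unique complex linear isomorphism `B : T_y N → T_x N` with `2 ω((u,0),(0,v)) =
g₀(iu, Bv) + i g₀(u, Bv)`, where `g₀` is taken at `x` (`transfer`, `mixed_eq`). On the diagonal `B`
is the identity. The canonical quadruple is `g(a,b) = ½ (g₀(a₁,b₁) + g₀(Ba₂,Bb₂))`, `I a = (iBa₂,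
iB⁻¹a₁)`, `J = I₀ ⊕ -I₀` and `K a = (Ba₂, -B⁻¹a₁)`; the hyper-Hermitian identities and `ω_I - iω_K =
ω` are linear algebra at each point.

Along a vertical leaf the bi-Lagrangian connection is simple: horizontal coordinate fields are
parallel and derivatives of vertical fields stay vertical
(`IsKahlerExtensionOn.christoffel_vertical`). Since `ω` is parallel and `g₀` depends only on `x`,
the field `B` is parallel along the leaf (`IsKahlerExtensionOn.hasFDerivAt_transferSlice`), hence so
is `g`. The tensors `I`, `J`, `K` are quotients of parallel forms, so they are parallel too.

Conversely, the components of any vertically parallel metric in the frame `(c₁, B⁻¹c₂)` are constant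
on a connected vertical slice (`IsKahlerExtensionOn.hasFDerivAt_transported`), so the metric is
determined by its values on the diagonal. There admissibility forces `½ (g₀ ⊕ g₀)`
(`TensorQuadruple.flatG_diagonal`), because the diagonal and its image under `J` are orthogonal. The
equation `ω_I - iω_K = ω` then determines `I` and `K`.

What remains concerns `ω`. The diagonal is totally real of maximal dimension, so holomorphic
identities valid on it hold near it, and then on every neighbourhood with connected vertical slices
(`IsConnectedTube.induction`). This gives the uniqueness of `ω`, its closedness (from `dω₀ = 0`) and
the Lagrangian property (from the `I₀`-invariance of `ω₀`). Existence near the diagonal comes from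
complexifying the power series of `ω₀` in charts and gluing over products of small coordinate balls
(`AnalyticKahlerStructure.exists_extension`). For the global statement, connectedness of `N` makes
all of `N × N` such a neighbourhood. -/

noncomputable section

/-! ### Fields, forms and connections in a chart. -/

section LocalRepresentatives

open Filter Topology

variable {E : Type*} [NormedAddCommGroup E] [NormedSpace ℝ E]
  {H : Type*} [TopologicalSpace H] (I : ModelWithCorners ℝ E H)
  {M : Type*} [TopologicalSpace M] [ChartedSpace H M] [IsManifold I ω M]
  {V : Type*} [NormedAddCommGroup V] [NormedSpace ℝ V]

/-- The coordinate frame of the preferred chart at `p`, as a map from the model space to the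
tangent space at `q`. -/
def chartFrame (p q : M) : E →L[ℝ] TangentSpace I q :=
  (trivializationAt E (TangentSpace I : M → Type _) p).symmL ℝ q

/-- The coordinates of tangent vectors at `q` in the preferred chart at `p`. -/
def chartCoframe (p q : M) : TangentSpace I q →L[ℝ] E :=
  (trivializationAt E (TangentSpace I : M → Type _) p).continuousLinearMapAt ℝ q

/-- The local representative of the vector field `Y` in the preferred chart at `p`. -/
def fieldRep (Y : Π q : M, TangentSpace I q) (p : M) (z : E) : E :=
  chartCoframe I p ((extChartAt I p).symm z) (Y ((extChartAt I p).symm z))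

/-- The local representative of the bilinear form field `b` in the preferred chart at `p`. -/
def formRep (b : Π q : M, TangentSpace I q →L[ℝ] TangentSpace I q →L[ℝ] V) (p : M) (z : E) :
    E →L[ℝ] E →L[ℝ] V :=
  ContinuousLinearMap.bilinearComp (E := E) (F := E) (b ((extChartAt I p).symm z))
    (chartFrame I p ((extChartAt I p).symm z)) (chartFrame I p ((extChartAt I p).symm z))

/-- The vector field with constant components `v` in the preferred chart at `p`. -/
def constField (p : M) (v : E) (q : M) : TangentSpace I q := chartFrame I p q v

variable {I} {p q : M}

theorem formRep_apply (b : Π q : M, TangentSpace I q →L[ℝ] TangentSpace I q →L[ℝ] V) (p : M)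
    (z u v : E) : formRep I b p z u v =
      b ((extChartAt I p).symm z) (chartFrame I p ((extChartAt I p).symm z) u)
        (chartFrame I p ((extChartAt I p).symm z) v) := rfl

theorem chartCoframe_chartFrame (hq : q ∈ (chartAt H p).source) (u : E) :
    chartCoframe I p q (chartFrame I p q u) = u :=
  Trivialization.continuousLinearMapAt_symmL (R := ℝ)
    (trivializationAt E (TangentSpace I : M → Type _) p) hq u

theorem chartFrame_chartCoframe (hq : q ∈ (chartAt H p).source) (u : TangentSpace I q) :
    chartFrame I p q (chartCoframe I p q u) = u :=
  Trivialization.symmL_continuousLinearMapAt (R := ℝ)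
    (trivializationAt E (TangentSpace I : M → Type _) p) hq u

theorem chartFrame_eq (hq : q ∈ (chartAt H p).source) (u : E) :
    chartFrame I p q u = tangentCoordChange I p q q u := by
  rw [chartFrame, TangentBundle.symmL_trivializationAt_eq_core hq]
  rfl

theorem chartCoframe_eq (hq : q ∈ (chartAt H p).source) (u : TangentSpace I q) :
    chartCoframe I p q u = tangentCoordChange I q p q u := by
  rw [chartCoframe, TangentBundle.continuousLinearMapAt_trivializationAt_eq_core hq]
  rfl

theorem chartFrame_self (p : M) (u : E) : chartFrame I p p u = u := by
  have h := tangentCoordChange_self (I := I) (v := u) (mem_extChartAt_source p)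
  exact (chartFrame_eq (mem_chart_source H p) u).trans h

theorem chartCoframe_self (p : M) (u : TangentSpace I p) : chartCoframe I p p u = u := by
  let v : E := u
  have h := tangentCoordChange_self (I := I) (v := v) (mem_extChartAt_source p)
  exact (chartCoframe_eq (mem_chart_source H p) u).trans h

theorem fieldRep_center (Y : Π q : M, TangentSpace I q) (p : M) :
    fieldRep I Y p (extChartAt I p p) = Y p := by
  have : ∀ q, q = p → chartCoframe I p q (Y q) = (Y p : E) := by
    rintro q rfl; exact chartCoframe_self q (Y q)
  exact this _ (extChartAt_to_inv p)

theorem formRep_center (b : Π q : M, TangentSpace I q →L[ℝ] TangentSpace I q →L[ℝ] V) (p : M)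
    (u v : E) : formRep I b p (extChartAt I p p) u v = b p u v := by
  have : ∀ q, q = p → b q (chartFrame I p q u) (chartFrame I p q v) = b p u v := by
    rintro q rfl; rw [chartFrame_self, chartFrame_self]
  exact this _ (extChartAt_to_inv p)

omit [IsManifold I ω M] in
theorem extChartAt_symm_mem_source {z : E} (hz : z ∈ (extChartAt I p).target) :
    (extChartAt I p).symm z ∈ (chartAt H p).source := by
  rw [← extChartAt_source I]; exact (extChartAt I p).map_target hz

omit [IsManifold I ω M] in
theorem eventually_mem_extChartAt_target [I.Boundaryless] (hq : q ∈ (chartAt H p).source) :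
    ∀ᶠ z in 𝓝 (extChartAt I p q), z ∈ (extChartAt I p).target :=
  (isOpen_extChartAt_target p).mem_nhds <| (extChartAt I p).map_source (by
    rwa [extChartAt_source])

variable [I.Boundaryless]

theorem mdifferentiableAt_iff_comp_extChartAt_symm {f : M → V} (hq : q ∈ (chartAt H p).source) :
    MDifferentiableAt I 𝓘(ℝ, V) f q ↔
      DifferentiableAt ℝ (f ∘ (extChartAt I p).symm) (extChartAt I p q) := by
  rw [mdifferentiableAt_iff_source_of_mem_source hq, I.range_eq_univ,
    mdifferentiableWithinAt_univ, mdifferentiableAt_iff_differentiableAt]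

omit [IsManifold I ω M] in
theorem mvfderiv_apply_eq {f : M → V} (hf : MDifferentiableAt I 𝓘(ℝ, V) f p)
    (u : TangentSpace I p) :
    mvfderiv I f p u = fderiv ℝ (f ∘ (extChartAt I p).symm) (extChartAt I p p) u := by
  rw [hf.mvfderiv, I.range_eq_univ, fderivWithin_univ]
  rfl

theorem fieldDiffAt_iff (Y : Π q : M, TangentSpace I q) (p : M) :
    FieldDiffAt I Y p ↔ DifferentiableAt ℝ (fieldRep I Y p) (extChartAt I p p) := by
  have h : FieldDiffAt I Y p ↔
      MDifferentiableAt I 𝓘(ℝ, E) (fun q ↦ chartCoframe I p q (Y q)) p := by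
    unfold FieldDiffAt
    rw [mdifferentiableAt_section]
    refine Filter.EventuallyEq.mdifferentiableAt_iff ?_
    filter_upwards [(chartAt H p).open_source.mem_nhds (mem_chart_source H p)] with q hq
    rw [chartCoframe, Trivialization.continuousLinearMapAt_apply,
      Trivialization.coe_linearMapAt_of_mem _ hq]
  rw [h, mdifferentiableAt_iff_comp_extChartAt_symm (mem_chart_source H p)]
  rfl

-- The frame of the trivialization is the derivative of the inverse chart, so pulling back by the
-- inverse chart means applying the inverse of the frame, which is the coframe.
omit [I.Boundaryless] in
theorem mpullbackWithin_extChartAt_symm_eq (X : Π q : M, TangentSpace I q) {z : E}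
    (hz : z ∈ (extChartAt I p).target) :
    mpullbackWithin 𝓘(ℝ, E) I (extChartAt I p).symm X (range I) z = fieldRep I X p z := by
  have hq := extChartAt_symm_mem_source hz
  rw [mpullbackWithin_apply, fieldRep]
  have h := TangentBundle.symmL_trivializationAt (I := I) hq
  rw [(extChartAt I p).right_inv hz] at h
  rw [← h]
  have h' : (chartFrame I p ((extChartAt I p).symm z)).inverse =
      chartCoframe I p ((extChartAt I p).symm z) :=
    ContinuousLinearMap.inverse_eq
      (ContinuousLinearMap.ext fun u ↦ chartFrame_chartCoframe hq u)
      (ContinuousLinearMap.ext fun u ↦ chartCoframe_chartFrame hq u)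
  exact congrArg (fun A ↦ A (X ((extChartAt I p).symm z))) h'

/-- The preferred chart at `p` has identity derivative at `p` under the identification of `T_p M`
with the model space, so the bracket computed in the chart needs no correction. -/
theorem mlieBracket_eq (X Y : Π q : M, TangentSpace I q) (p : M) :
    mlieBracket I X Y p =
      lieBracket ℝ (fieldRep I X p) (fieldRep I Y p) (extChartAt I p p) := by
  have h := eventually_mem_extChartAt_target (I := I) (mem_chart_source H p)
  have h' : ∀ X : Π q : M, TangentSpace I q, (mpullbackWithin 𝓘(ℝ, E) I (extChartAt I p).symm X univ :
      E → E) =ᶠ[𝓝 (extChartAt I p p)] fieldRep I X p := fun X ↦ by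
    filter_upwards [h] with z hz
    rw [← mpullbackWithin_extChartAt_symm_eq X hz, I.range_eq_univ]
  have h1 : (mfderiv I 𝓘(ℝ, E) (extChartAt I p) p).inverse = ContinuousLinearMap.id ℝ E := by
    rw [mfderiv_extChartAt_self]; exact ContinuousLinearMap.inverse_id
  rw [← mlieBracketWithin_univ, mlieBracketWithin_apply, I.range_eq_univ, preimage_univ, univ_inter]
  have h2 := (h' X).lieBracketWithin_vectorField_eq_nhds (𝕜 := ℝ) (s := univ) (h' Y)
  rw [lieBracketWithin_univ (V := fieldRep I X p)] at h2
  exact (congrArg (fun A : E →L[ℝ] E ↦ A _) h1).trans h2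

section ConstField

/-- Chart-constant fields serve as test fields: they turn conditions quantified over all
differentiable fields into identities between Christoffel symbols and derivatives of components. -/
theorem fieldRep_constField (p : M) (v : E) :
    fieldRep I (constField I p v) p =ᶠ[𝓝 (extChartAt I p p)] fun _ ↦ v := by
  filter_upwards [eventually_mem_extChartAt_target (I := I) (mem_chart_source H p)] with z hz
  exact chartCoframe_chartFrame (extChartAt_symm_mem_source hz) v

omit [I.Boundaryless] in
theorem constField_self (p : M) (v : E) : constField I p v p = v := chartFrame_self p v

theorem fieldDiffAt_constField (p : M) (v : E) : FieldDiffAt I (constField I p v) p := by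
  rw [fieldDiffAt_iff]
  exact (fieldRep_constField p v).differentiableAt_iff.2 (differentiableAt_const v)

theorem fderiv_fieldRep_constField (p : M) (v : E) :
    fderiv ℝ (fieldRep I (constField I p v) p) (extChartAt I p p) = 0 := by
  rw [(fieldRep_constField p v).fderiv_eq, fderiv_fun_const]; rfl

theorem mlieBracket_constField (p : M) (u v : E) :
    mlieBracket I (constField I p u) (constField I p v) p = 0 := by
  rw [mlieBracket_eq, lieBracket_eq]
  simp only [fderiv_fieldRep_constField]
  exact sub_zero (0 : E)

end ConstField

section Derivatives

variable {b : Π q : M, TangentSpace I q →L[ℝ] TangentSpace I q →L[ℝ] V}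
  {Y Z : Π q : M, TangentSpace I q}

theorem form_apply_comp_extChartAt_symm (b : Π q : M, TangentSpace I q →L[ℝ] TangentSpace I q →L[ℝ] V)
    (Y Z : Π q : M, TangentSpace I q) (p : M) :
    (fun q ↦ b q (Y q) (Z q)) ∘ (extChartAt I p).symm =ᶠ[𝓝 (extChartAt I p p)]
      fun z ↦ formRep I b p z (fieldRep I Y p z) (fieldRep I Z p z) := by
  filter_upwards [eventually_mem_extChartAt_target (I := I) (mem_chart_source H p)] with z hz
  have hq := extChartAt_symm_mem_source hz
  rw [formRep_apply, fieldRep, fieldRep, chartFrame_chartCoframe hq, chartFrame_chartCoframe hq]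
  rfl

omit [I.Boundaryless] in
theorem form_apply_eq_formRep (b : Π q : M, TangentSpace I q →L[ℝ] TangentSpace I q →L[ℝ] V)
    (p : M) (u v : TangentSpace I p) : b p u v = formRep I b p (extChartAt I p p) u v :=
  (formRep_center b p u v).symm

theorem hasFDerivAt_form_apply (hb : DifferentiableAt ℝ (formRep I b p) (extChartAt I p p))
    (hY : FieldDiffAt I Y p) (hZ : FieldDiffAt I Z p) :
    ∃ D : E →L[ℝ] V, HasFDerivAt
      ((fun q ↦ b q (Y q) (Z q)) ∘ (extChartAt I p).symm) D (extChartAt I p p) ∧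
      ∀ u : E, D u = fderiv ℝ (formRep I b p) (extChartAt I p p) u
          (fieldRep I Y p (extChartAt I p p)) (fieldRep I Z p (extChartAt I p p))
        + formRep I b p (extChartAt I p p) (fderiv ℝ (fieldRep I Y p) (extChartAt I p p) u)
          (fieldRep I Z p (extChartAt I p p))
        + formRep I b p (extChartAt I p p) (fieldRep I Y p (extChartAt I p p))
          (fderiv ℝ (fieldRep I Z p) (extChartAt I p p) u) := by
  rw [fieldDiffAt_iff] at hY hZ
  refine ⟨_, ((hb.hasFDerivAt.clm_apply hY.hasFDerivAt).clm_apply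
    hZ.hasFDerivAt).congr_of_eventuallyEq (form_apply_comp_extChartAt_symm b Y Z p), fun u ↦ ?_⟩
  simp
  abel

theorem mdifferentiableAt_form_apply
    (hb : DifferentiableAt ℝ (formRep I b p) (extChartAt I p p))
    (hY : FieldDiffAt I Y p) (hZ : FieldDiffAt I Z p) :
    MDifferentiableAt I 𝓘(ℝ, V) (fun q ↦ b q (Y q) (Z q)) p := by
  obtain ⟨D, hD, -⟩ := hasFDerivAt_form_apply hb hY hZ
  rw [mdifferentiableAt_iff_comp_extChartAt_symm (mem_chart_source H p)]
  exact hD.differentiableAt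

theorem mvfderiv_form_apply (hb : DifferentiableAt ℝ (formRep I b p) (extChartAt I p p))
    (hY : FieldDiffAt I Y p) (hZ : FieldDiffAt I Z p) (u : TangentSpace I p) :
    mvfderiv I (fun q ↦ b q (Y q) (Z q)) p u =
      fderiv ℝ (formRep I b p) (extChartAt I p p) u
          (fieldRep I Y p (extChartAt I p p)) (fieldRep I Z p (extChartAt I p p))
        + formRep I b p (extChartAt I p p) (fderiv ℝ (fieldRep I Y p) (extChartAt I p p) u)
          (fieldRep I Z p (extChartAt I p p))
        + formRep I b p (extChartAt I p p) (fieldRep I Y p (extChartAt I p p))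
          (fderiv ℝ (fieldRep I Z p) (extChartAt I p p) u) := by
  obtain ⟨D, hD, h⟩ := hasFDerivAt_form_apply hb hY hZ
  rw [mvfderiv_apply_eq (mdifferentiableAt_form_apply hb hY hZ), hD.fderiv]
  exact h u

theorem mvfderiv_form_constField (hb : DifferentiableAt ℝ (formRep I b p) (extChartAt I p p))
    (u v w : E) :
    mvfderiv I (fun q ↦ b q (constField I p v q) (constField I p w q)) p u =
      fderiv ℝ (formRep I b p) (extChartAt I p p) u v w := by
  refine (mvfderiv_form_apply hb (fieldDiffAt_constField p v) (fieldDiffAt_constField p w) u).trans ?_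
  rw [fderiv_fieldRep_constField, fderiv_fieldRep_constField,
    (fieldRep_constField p v).self_of_nhds, (fieldRep_constField p w).self_of_nhds]
  have h (A : E →L[ℝ] E →L[ℝ] E →L[ℝ] V) (B : E →L[ℝ] E →L[ℝ] V) :
      A u v w + B ((0 : E →L[ℝ] E) u) w + B v ((0 : E →L[ℝ] E) u) = A u v w := by simp
  exact h _ _

/-- The cyclic sum of the derivatives of the components of a form, i.e. the components of its
exterior derivative. -/
def cyclicDeriv (β : E → E →L[ℝ] E →L[ℝ] V) (z u v w : E) : V :=
  fderiv ℝ β z u v w + fderiv ℝ β z v w u + fderiv ℝ β z w u v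

/-- In Cartan's formula the terms differentiating the fields cancel against the bracket terms by
skewness, leaving the cyclic sum of derivatives of components. -/
theorem isClosedFormOn_of_cyclicDeriv {U : Set M}
    (hb : ∀ p ∈ U, DifferentiableAt ℝ (formRep I b p) (extChartAt I p p))
    (halt : ∀ p ∈ U, ∀ u v, b p u v = - b p v u)
    (h : ∀ p ∈ U, ∀ u v w, cyclicDeriv (formRep I b p) (extChartAt I p p) u v w = 0) :
    IsClosedFormOn I U b := by
  intro p hp X Y Z hX hY hZ
  -- Here `x'`, `y'`, `z'` are the derivatives of the fields in the chart, so `y' x - x' y` is the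
  -- bracket of the first two.
  have flat (β : E →L[ℝ] E →L[ℝ] V) (D : E →L[ℝ] E →L[ℝ] E →L[ℝ] V) (x' y' z' : E →L[ℝ] E)
      (x y z : E) (hβ : ∀ u v, β u v = - β v u) (hD : D x y z + D y z x + D z x y = 0) :
      (D x y z + β (y' x) z + β y (z' x)) + (D y z x + β (z' y) x + β z (x' y)) +
        (D z x y + β (x' z) y + β x (y' z)) - β (y' x - x' y) z - β (z' y - y' z) x
        - β (x' z - z' x) y = 0 := by
    rw [map_sub, map_sub, map_sub, hβ y (z' x), hβ z (x' y), hβ x (y' z), ← hD]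
    simp only [sub_apply]
    abel
  rw [form_apply_eq_formRep b p (mlieBracket I X Y p), form_apply_eq_formRep b p (mlieBracket I Y Z p),
    form_apply_eq_formRep b p (mlieBracket I Z X p), mlieBracket_eq, mlieBracket_eq, mlieBracket_eq,
    mvfderiv_form_apply (hb p hp) hY hZ, mvfderiv_form_apply (hb p hp) hZ hX,
    mvfderiv_form_apply (hb p hp) hX hY, ← fieldRep_center X p, ← fieldRep_center Y p,
    ← fieldRep_center Z p]
  refine flat _ _ _ _ _ _ _ _ (fun u v ↦ ?_) (h p hp _ _ _)
  rw [formRep_center, formRep_center]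
  exact halt p hp u v

/-- Chart-constant fields commute, so vanishing torsion is symmetry of the Christoffel symbols. -/
theorem christoffel_symm {b : Π q : M, TangentSpace I q →L[ℝ] TangentSpace I q →L[ℝ] V}
    {cov : (Π q : M, TangentSpace I q) → (Π q : M, TangentSpace I q →L[ℝ] TangentSpace I q)}
    {U : Set M} (hcov : IsLeviCivitaOn I b U cov) (hp : p ∈ U) (v w : E) :
    cov (constField I p v) p w = cov (constField I p w) p v := by
  have h := hcov.torsionFree p hp (constField I p w) (constField I p v)
    (fieldDiffAt_constField p _) (fieldDiffAt_constField p _)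
  rw [mlieBracket_constField, sub_eq_zero, constField_self, constField_self] at h
  exact h

theorem fderiv_formRep_of_isParallelFormAlong
    {cov : (Π q : M, TangentSpace I q) → (Π q : M, TangentSpace I q →L[ℝ] TangentSpace I q)}
    {D : Π q : M, Set (TangentSpace I q)} {U : Set M}
    (hpar : IsParallelFormAlong I cov D U b) (hp : p ∈ U)
    (hb : DifferentiableAt ℝ (formRep I b p) (extChartAt I p p)) {u : E}
    (hu : (u : TangentSpace I p) ∈ D p) (v w : E) :
    fderiv ℝ (formRep I b p) (extChartAt I p p) u v w =
      formRep I b p (extChartAt I p p) (cov (constField I p v) p u) w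
      + formRep I b p (extChartAt I p p) v (cov (constField I p w) p u) := by
  have h := hpar p hp u hu _ _ (fieldDiffAt_constField p v) (fieldDiffAt_constField p w)
  rw [constField_self, constField_self] at h
  exact (mvfderiv_form_constField hb u v w).symm.trans <| h.trans <|
    congrArg₂ _ (form_apply_eq_formRep b p _ _) (form_apply_eq_formRep b p _ _)

/-- A form parallel for a torsion-free connection is closed: each derivative is a sum of two
Christoffel terms, and these cancel in pairs by symmetry of `Γ` and skewness of the form. -/
theorem cyclicDeriv_eq_zero_of_parallel
    {b' : Π q : M, TangentSpace I q →L[ℝ] TangentSpace I q →L[ℝ] V}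
    {cov : (Π q : M, TangentSpace I q) → (Π q : M, TangentSpace I q →L[ℝ] TangentSpace I q)}
    {U : Set M} (hcov : IsLeviCivitaOn I b' U cov)
    (hpar : IsParallelFormAlong I cov (fun _ ↦ univ) U b) (hp : p ∈ U)
    (hb : DifferentiableAt ℝ (formRep I b p) (extChartAt I p p))
    (halt : ∀ u v, b p u v = - b p v u) (u v w : E) :
    cyclicDeriv (formRep I b p) (extChartAt I p p) u v w = 0 := by
  have ha : ∀ u v, formRep I b p (extChartAt I p p) u v =
      - formRep I b p (extChartAt I p p) v u := fun u v ↦ by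
    rw [formRep_center, formRep_center]; exact halt u v
  have hd := fun u v w : E ↦ fderiv_formRep_of_isParallelFormAlong hpar hp hb (u := u)
    (mem_univ _) v w
  let Γ : E → E → E := fun u v ↦ cov (constField I p v) p u
  have hs : ∀ u v, Γ u v = Γ v u := fun u v ↦ christoffel_symm hcov hp v u
  change ∀ u v w, _ = formRep I b p (extChartAt I p p) (Γ u v) w +
    formRep I b p (extChartAt I p p) v (Γ u w) at hd
  rw [cyclicDeriv, hd, hd, hd, hs v u, hs w v, hs w u, ha v, ha w, ha u]
  abel

/-- The connection whose Christoffel symbols at `p`, in the preferred chart at `p`, are `Γ p`. -/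
def chartConnection (Γ : M → E →L[ℝ] E →L[ℝ] E) (Y : Π q : M, TangentSpace I q) (p : M) :
    TangentSpace I p →L[ℝ] TangentSpace I p :=
  (fderiv ℝ (fieldRep I Y p) (extChartAt I p p) +
    (Γ p).flip (fieldRep I Y p (extChartAt I p p)) : E →L[ℝ] E)

omit [I.Boundaryless] in
theorem chartConnection_apply (Γ : M → E →L[ℝ] E →L[ℝ] E) (Y : Π q : M, TangentSpace I q) (p : M)
    (u : TangentSpace I p) : chartConnection Γ Y p u =
      (fderiv ℝ (fieldRep I Y p) (extChartAt I p p) u +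
        Γ p u (fieldRep I Y p (extChartAt I p p)) : E) := rfl

/-- Every requirement is pointwise, so Christoffel symbols may be prescribed point by point, each in
the chart centred there, with no transformation law to check. -/
theorem isCovariantDerivativeOn_chartConnection (Γ : M → E →L[ℝ] E →L[ℝ] E) (U : Set M) :
    IsCovariantDerivativeOn E (I := I) (V := TangentSpace I) (chartConnection Γ) U where
  add {Y Z p} hY hZ _ := by
    have hY' := (fieldDiffAt_iff Y p).1 hY
    have hZ' := (fieldDiffAt_iff Z p).1 hZ
    have h : fieldRep I (Y + Z) p = fieldRep I Y p + fieldRep I Z p := by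
      ext z; exact map_add (chartCoframe I p _) _ _
    have key : fderiv ℝ (fieldRep I (Y + Z) p) (extChartAt I p p) +
        (Γ p).flip (fieldRep I (Y + Z) p (extChartAt I p p)) =
        (fderiv ℝ (fieldRep I Y p) (extChartAt I p p) +
          (Γ p).flip (fieldRep I Y p (extChartAt I p p))) +
        (fderiv ℝ (fieldRep I Z p) (extChartAt I p p) +
          (Γ p).flip (fieldRep I Z p (extChartAt I p p))) := by
      rw [h, fderiv_add hY' hZ', Pi.add_apply, map_add]
      abel
    exact key
  leibniz {Y f p} hY hf _ := by
    have hY' := (fieldDiffAt_iff Y p).1 hY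
    have hf' := (mdifferentiableAt_iff_comp_extChartAt_symm (mem_chart_source H p)).1 hf
    have h : fieldRep I (f • Y) p = (f ∘ (extChartAt I p).symm) • fieldRep I Y p := by
      ext z; exact map_smul (chartCoframe I p _) _ _
    have hd : mvfderiv I f p = fderiv ℝ (f ∘ (extChartAt I p).symm) (extChartAt I p p) :=
      ContinuousLinearMap.ext fun u ↦ mvfderiv_apply_eq hf u
    have key : fderiv ℝ (fieldRep I (f • Y) p) (extChartAt I p p) +
        (Γ p).flip (fieldRep I (f • Y) p (extChartAt I p p)) =
        f p • (fderiv ℝ (fieldRep I Y p) (extChartAt I p p) +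
          (Γ p).flip (fieldRep I Y p (extChartAt I p p))) +
        (fderiv ℝ (f ∘ (extChartAt I p).symm) (extChartAt I p p)).smulRight
          (fieldRep I Y p (extChartAt I p p)) := by
      rw [h, fderiv_smul hf' hY', Pi.smul_apply', map_smul]
      simp only [Function.comp_apply, extChartAt_to_inv, smul_add]
      abel
    rw [hd, ← fieldRep_center Y p]
    exact key

theorem isParallelFormAlong_chartConnection {Γ : M → E →L[ℝ] E →L[ℝ] E} {U : Set M}
    {D : Π q : M, Set (TangentSpace I q)}
    (hb : ∀ p ∈ U, DifferentiableAt ℝ (formRep I b p) (extChartAt I p p))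
    (h : ∀ p ∈ U, ∀ u : E, (u : TangentSpace I p) ∈ D p → ∀ v w : E,
      fderiv ℝ (formRep I b p) (extChartAt I p p) u v w =
      formRep I b p (extChartAt I p p) (Γ p u v) w +
        formRep I b p (extChartAt I p p) v (Γ p u w)) :
    IsParallelFormAlong I (chartConnection Γ) D U b := by
  intro p hp u hu Y Z hY hZ
  rw [mvfderiv_form_apply (hb p hp) hY hZ, form_apply_eq_formRep b p _ (Z p),
    form_apply_eq_formRep b p (Y p) _,
    chartConnection_apply, chartConnection_apply, ← fieldRep_center Y p, ← fieldRep_center Z p]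
  have key := h p hp u hu (fieldRep I Y p (extChartAt I p p)) (fieldRep I Z p (extChartAt I p p))
  have flat (β : E →L[ℝ] E →L[ℝ] V) (y' z' y z g g' : E) (c : V) (hc : c = β g z + β y g') :
      c + β y' z + β y z' = β (y' + g) z + β y (z' + g') := by
    rw [hc, map_add, map_add, add_apply]; abel
  exact flat _ _ _ _ _ _ _ _ key

theorem isLeviCivitaOn_chartConnection {Γ : M → E →L[ℝ] E →L[ℝ] E} {U : Set M}
    (hΓ : ∀ p ∈ U, ∀ u v, Γ p u v = Γ p v u)
    (hb : ∀ p ∈ U, DifferentiableAt ℝ (formRep I b p) (extChartAt I p p))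
    (h : ∀ p ∈ U, ∀ u v w : E,
      fderiv ℝ (formRep I b p) (extChartAt I p p) u v w =
      formRep I b p (extChartAt I p p) (Γ p u v) w +
        formRep I b p (extChartAt I p p) v (Γ p u w)) :
    IsLeviCivitaOn I b U (chartConnection Γ) where
  isCovariantDerivativeOn := isCovariantDerivativeOn_chartConnection Γ U
  torsionFree p hp X Y _ _ := by
    rw [mlieBracket_eq, lieBracket_eq, chartConnection_apply, chartConnection_apply,
      ← fieldRep_center X p, ← fieldRep_center Y p]
    have key : ∀ x y a c : E, (a + Γ p x y) - (c + Γ p y x) = a - c := fun x y a c ↦ by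
      rw [hΓ p hp x y, add_sub_add_right_eq_sub]
    exact key _ _ _ _
  metric := isParallelFormAlong_chartConnection hb fun p hp u _ v w ↦ h p hp u v w

/-- With `β(Y, Z) = b(AY, Z)`, differentiating the two sides by parallelism of `β` and of `b` gives
`b(∇(AY) - A∇Y, Z) = 0`; nondegeneracy of `b` concludes. -/
theorem isParallelEndAlong_of_isParallelFormAlong
    {cov : (Π q : M, TangentSpace I q) → (Π q : M, TangentSpace I q →L[ℝ] TangentSpace I q)}
    {D : Π q : M, Set (TangentSpace I q)} {U : Set M} (hU : IsOpen U)
    {b β : Π q : M, TangentSpace I q →L[ℝ] TangentSpace I q →L[ℝ] V}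
    {A : Π q : M, TangentSpace I q →L[ℝ] TangentSpace I q}
    (hb : IsParallelFormAlong I cov D U b) (hβ : IsParallelFormAlong I cov D U β)
    (hnd : ∀ p ∈ U, ∀ u, (∀ v, b p u v = 0) → u = 0)
    (hA : ∀ p ∈ U, ∀ u v, β p u v = b p (A p u) v)
    (hdiff : ∀ p ∈ U, ∀ Y : Π q : M, TangentSpace I q, FieldDiffAt I Y p →
      FieldDiffAt I (fun q ↦ A q (Y q)) p) :
    IsParallelEndAlong I cov D U A := by
  intro p hp u hu Y hY
  rw [← sub_eq_zero]
  refine hnd p hp _ fun w ↦ ?_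
  obtain ⟨Z, hZ, hw⟩ : ∃ Z : Π q : M, TangentSpace I q, FieldDiffAt I Z p ∧ Z p = w :=
    ⟨constField (E := E) I p w, fieldDiffAt_constField (E := E) p w,
      constField_self (E := E) p w⟩
  have h1 := hb p hp u hu _ _ (hdiff p hp Y hY) hZ
  have h2 := hβ p hp u hu _ _ hY hZ
  have h3 : mvfderiv I (fun q ↦ β q (Y q) (Z q)) p =
      mvfderiv I (fun q ↦ b q (A q (Y q)) (Z q)) p := by
    have : (fun q ↦ β q (Y q) (Z q)) =ᶠ[𝓝 p]
        fun q ↦ b q (A q (Y q)) (Z q) := by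
      filter_upwards [hU.mem_nhds hp] with q hq using hA q hq _ _
    have e := this.mfderiv_eq (I := I) (I' := 𝓘(ℝ, V))
    exact congrArg (fun L : E →L[ℝ] V ↦ L) e
  rw [h3, h1, hA p hp, hA p hp, add_left_inj, hw] at h2
  rw [map_sub]
  exact sub_eq_zero.2 h2

end Derivatives

end LocalRepresentatives

/-! ### Smoothness of tensor fields in a chart. -/

section SmoothTensorFields

open Filter Topology

variable {E : Type*} [NormedAddCommGroup E] [NormedSpace ℝ E]
  {H : Type*} [TopologicalSpace H] {I : ModelWithCorners ℝ E H}
  {M : Type*} [TopologicalSpace M] [ChartedSpace H M] [IsManifold I ω M]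
  {p q r : M}

variable (I) in
/-- The local representative of the endomorphism field `A` in the preferred chart at `p`. -/
def endRep (A : Π q : M, TangentSpace I q →L[ℝ] TangentSpace I q) (p : M) (z : E) : E →L[ℝ] E :=
  (chartCoframe I p ((extChartAt I p).symm z)).comp
    ((A ((extChartAt I p).symm z)).comp (chartFrame I p ((extChartAt I p).symm z)))

/-- A form field is a section of a nested hom bundle; its inner trivialization is precomposition
with the frame, because the trivial line bundle contributes the identity. -/
theorem dual_continuousLinearMapAt (hq : q ∈ (chartAt H p).source) (L : TangentSpace I q →L[ℝ] ℝ)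
    (v : E) :
    (trivializationAt (E →L[ℝ] ℝ) (fun q : M ↦ TangentSpace I q →L[ℝ] ℝ) p).continuousLinearMapAt
      ℝ q L v = L (chartFrame I p q v) := by
  have hq' : q ∈ (trivializationAt (E →L[ℝ] ℝ)
      (fun q : M ↦ TangentSpace I q →L[ℝ] ℝ) p).baseSet := ⟨hq, mem_univ _⟩
  rw [Trivialization.continuousLinearMapAt_apply, Trivialization.coe_linearMapAt_of_mem _ hq']
  have h := hom_trivializationAt_apply (RingHom.id ℝ) (F₁ := E) (E₁ := (TangentSpace I : M → Type _))
    (F₂ := ℝ) (E₂ := Bundle.Trivial M ℝ) p ⟨q, L⟩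
  refine (congrArg (fun x : M × (E →L[ℝ] ℝ) ↦ x.2 v) h).trans ?_
  simp only [ContinuousLinearMap.inCoordinates, ContinuousLinearMap.comp_apply]
  exact congrArg (fun A : ℝ →L[ℝ] ℝ ↦ A (L (chartFrame I p q v)))
    (Bundle.Trivial.continuousLinearMapAt_trivialization ℝ M ℝ q)

theorem inCoordinates_form (b : Π q : M, TangentSpace I q →L[ℝ] TangentSpace I q →L[ℝ] ℝ)
    (hq : q ∈ (chartAt H p).source) :
    ContinuousLinearMap.inCoordinates E (TangentSpace I : M → Type _) (E →L[ℝ] ℝ)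
      (fun q : M ↦ TangentSpace I q →L[ℝ] ℝ) p q p q (b q)
      = formRep I b p (extChartAt I p q) := by
  have hq' : q ∈ (extChartAt I p).source := by rwa [extChartAt_source]
  rw [formRep, (extChartAt I p).left_inv hq']
  ext u v
  rw [ContinuousLinearMap.inCoordinates]
  exact dual_continuousLinearMapAt hq (b q (chartFrame I p q u)) v

omit [IsManifold I ω M] in
theorem contMDiffAt_iff_comp_extChartAt_symm [I.Boundaryless] {n : WithTop ℕ∞} {V : Type*}
    [NormedAddCommGroup V] [NormedSpace ℝ V] {f : M → V} :
    ContMDiffAt I 𝓘(ℝ, V) n f p ↔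
      ContDiffAt ℝ n (f ∘ (extChartAt I p).symm) (extChartAt I p p) := by
  rw [contMDiffAt_iff_source, I.range_eq_univ, contMDiffWithinAt_univ, contMDiffAt_iff_contDiffAt]

variable [I.Boundaryless]

theorem contMDiffAt_form_iff {n : WithTop ℕ∞}
    (b : Π q : M, TangentSpace I q →L[ℝ] TangentSpace I q →L[ℝ] ℝ) :
    ContMDiffAt I (I.prod 𝓘(ℝ, E →L[ℝ] E →L[ℝ] ℝ)) n
      (fun q ↦ TotalSpace.mk' (E →L[ℝ] E →L[ℝ] ℝ)
        (E := fun q : M ↦ TangentSpace I q →L[ℝ] TangentSpace I q →L[ℝ] ℝ) q (b q)) p ↔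
      ContDiffAt ℝ n (formRep I b p) (extChartAt I p p) := by
  refine (contMDiffAt_hom_bundle _).trans ((and_iff_right contMDiffAt_id).trans ?_)
  rw [contMDiffAt_iff_comp_extChartAt_symm]
  suffices h : _ =ᶠ[𝓝 (extChartAt I p p)] formRep I b p from
    ⟨fun H ↦ H.congr_of_eventuallyEq h.symm, fun H ↦ H.congr_of_eventuallyEq h⟩
  filter_upwards [eventually_mem_extChartAt_target (I := I) (mem_chart_source H p)] with z hz
  refine (inCoordinates_form b (extChartAt_symm_mem_source hz)).trans ?_
  rw [(extChartAt I p).right_inv hz]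

theorem contMDiffAt_end_iff {n : WithTop ℕ∞}
    (A : Π q : M, TangentSpace I q →L[ℝ] TangentSpace I q) :
    ContMDiffAt I (I.prod 𝓘(ℝ, E →L[ℝ] E)) n
      (fun q ↦ TotalSpace.mk' (E →L[ℝ] E)
        (E := fun q : M ↦ TangentSpace I q →L[ℝ] TangentSpace I q) q (A q)) p ↔
      ContDiffAt ℝ n (endRep I A p) (extChartAt I p p) := by
  refine (contMDiffAt_hom_bundle _).trans ((and_iff_right contMDiffAt_id).trans ?_)
  rw [contMDiffAt_iff_comp_extChartAt_symm]
  rfl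

theorem fieldDiffAt_end_apply {A : Π q : M, TangentSpace I q →L[ℝ] TangentSpace I q}
    (hA : DifferentiableAt ℝ (endRep I A p) (extChartAt I p p))
    {Y : Π q : M, TangentSpace I q} (hY : FieldDiffAt I Y p) :
    FieldDiffAt I (fun q ↦ A q (Y q)) p := by
  rw [fieldDiffAt_iff] at hY ⊢
  refine (hA.clm_apply hY).congr_of_eventuallyEq ?_
  filter_upwards [eventually_mem_extChartAt_target (I := I) (mem_chart_source H p)] with z hz
  rw [endRep, fieldRep, fieldRep, ContinuousLinearMap.comp_apply, ContinuousLinearMap.comp_apply,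
    chartFrame_chartCoframe (extChartAt_symm_mem_source hz)]

theorem isInvertible_of_nondegenerate [FiniteDimensional ℝ E] {β : E →L[ℝ] E →L[ℝ] ℝ}
    (h : ∀ u, (∀ v, β u v = 0) → u = 0) : β.IsInvertible := by
  have hinj : Function.Injective β.toLinearMap := by
    rw [← LinearMap.ker_eq_bot, LinearMap.ker_eq_bot']
    intro u hu
    exact h u fun v ↦ by rw [show β u = 0 from hu]; rfl
  have hfin : Module.finrank ℝ E = Module.finrank ℝ (E →L[ℝ] ℝ) := by
    rw [← Subspace.dual_finrank_eq (K := ℝ) (V := E)]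
    exact (LinearMap.toContinuousLinearMap (𝕜 := ℝ) (E := E) (F' := ℝ)).finrank_eq
  exact ⟨(LinearEquiv.ofInjectiveOfFinrankEq β.toLinearMap hinj hfin).toContinuousLinearEquiv, by
    ext u v; rfl⟩

/-- In the chart `A = b⁻¹ ∘ β`, and inversion of linear maps is smooth at invertible ones. This
gives the smoothness of `I` and `K` from that of `g` and `ω`. -/
theorem contDiffAt_endRep_of_form [FiniteDimensional ℝ E] {n : WithTop ℕ∞} {U : Set M}
    (hU : IsOpen U)
    {b β : Π q : M, TangentSpace I q →L[ℝ] TangentSpace I q →L[ℝ] ℝ}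
    {A : Π q : M, TangentSpace I q →L[ℝ] TangentSpace I q} (hp : p ∈ U)
    (hb : ContDiffAt ℝ n (formRep I b p) (extChartAt I p p))
    (hβ : ContDiffAt ℝ n (formRep I β p) (extChartAt I p p))
    (hnd : ∀ q ∈ U, ∀ u, (∀ v, b q u v = 0) → u = 0)
    (hA : ∀ q ∈ U, ∀ u v, β q u v = b q (A q u) v) :
    ContDiffAt ℝ n (endRep I A p) (extChartAt I p p) := by
  have hT : ∀ᶠ z in 𝓝 (extChartAt I p p), z ∈ (extChartAt I p).target ∧
      (extChartAt I p).symm z ∈ U :=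
    (eventually_mem_extChartAt_target (I := I) (mem_chart_source H p)).and <|
      (continuousAt_extChartAt_symm p).eventually
        (by rw [extChartAt_to_inv]; exact hU.mem_nhds hp)
  have hinv : ∀ z ∈ (extChartAt I p).target, (extChartAt I p).symm z ∈ U →
      (formRep I b p z).IsInvertible := fun z hz hzU ↦ by
    refine isInvertible_of_nondegenerate fun u hu ↦ ?_
    have hq := extChartAt_symm_mem_source hz
    have h0 : chartFrame I p ((extChartAt I p).symm z) u = 0 := by
      refine hnd _ hzU _ fun v ↦ ?_
      have := hu (chartCoframe I p ((extChartAt I p).symm z) v)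
      rwa [formRep_apply, chartFrame_chartCoframe hq] at this
    rw [← chartCoframe_chartFrame (I := I) hq u, h0, map_zero]
  have h0 := hT.self_of_nhds
  have h : endRep I A p =ᶠ[𝓝 (extChartAt I p p)]
      fun z ↦ (ContinuousLinearMap.inverse (formRep I b p z)).comp (formRep I β p z) := by
    filter_upwards [hT] with z hz
    have hq := extChartAt_symm_mem_source hz.1
    have : formRep I β p z = (formRep I b p z).comp (endRep I A p z) := by
      ext u v
      rw [formRep_apply, hA _ hz.2, ContinuousLinearMap.comp_apply, formRep_apply, endRep,
        ContinuousLinearMap.comp_apply, ContinuousLinearMap.comp_apply, chartFrame_chartCoframe hq]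
    obtain ⟨e, he⟩ := hinv z hz.1 hz.2
    rw [this, ← he, ContinuousLinearMap.inverse_equiv]
    ext u; simp
  refine ContDiffAt.congr_of_eventuallyEq ?_ h
  refine ContDiffAt.clm_comp ?_ hβ
  exact (hinv _ h0.1 h0.2).contDiffAt_map_inverse.comp _ hb

end SmoothTensorFields

/-! ### Change of charts for form components. -/

section ChartChange

open Filter Topology

variable {E : Type*} [NormedAddCommGroup E] [NormedSpace ℝ E]
  {H : Type*} [TopologicalSpace H] {I : ModelWithCorners ℝ E H}
  {M : Type*} [TopologicalSpace M] [ChartedSpace H M] [IsManifold I ω M]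
  {V : Type*} [NormedAddCommGroup V] [NormedSpace ℝ V] {p q r : M}

theorem chartFrame_tangentCoordChange (hp : r ∈ (chartAt H p).source)
    (hq : r ∈ (chartAt H q).source) (u : E) :
    chartFrame I q r u = chartFrame I p r (tangentCoordChange I q p r u) := by
  have h : tangentCoordChange I p r r (tangentCoordChange I q p r u) =
      tangentCoordChange I q r r u := tangentCoordChange_comp (I := I) (by
    simp only [extChartAt_source]; exact ⟨⟨hq, hp⟩, mem_chart_source H r⟩)
  rw [chartFrame_eq hq, chartFrame_eq hp]
  exact h.symm

theorem formRep_chartChange (b : Π q : M, TangentSpace I q →L[ℝ] TangentSpace I q →L[ℝ] V) {z : E}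
    (hz : z ∈ (extChartAt I q).target)
    (hz' : (extChartAt I q).symm z ∈ (chartAt H p).source) (u v : E) :
    formRep I b q z u v = formRep I b p (extChartAt I p ((extChartAt I q).symm z))
      (tangentCoordChange I q p ((extChartAt I q).symm z) u)
      (tangentCoordChange I q p ((extChartAt I q).symm z) v) := by
  have hq := extChartAt_symm_mem_source hz
  rw [formRep_apply, formRep_apply, (extChartAt I p).left_inv (by rwa [extChartAt_source]),
    chartFrame_tangentCoordChange hz' hq, chartFrame_tangentCoordChange hz' hq]

end ChartChange

/-! ### Smoothness of complex differentiable functions of several variables. -/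

section Osgood

open Metric Filter Topology MeasureTheory

variable {W : Type*} [NormedAddCommGroup W] [NormedSpace ℂ W] {f : W → ℂ} {U : Set W}

/-- Cauchy's estimate on the complex line `z + ζ v`; the radius `R / (2‖v‖)` keeps the closed disc
inside the ball and produces the factor `2`. -/
theorem norm_fderiv_le_of_norm_le_on_ball {z : W} {R M : ℝ} (hR : 0 < R)
    (hf : DifferentiableOn ℂ f (ball z R)) (hM : ∀ w ∈ ball z R, ‖f w‖ ≤ M) :
    ‖fderiv ℂ f z‖ ≤ 2 * M / R := by
  have hM0 : 0 ≤ M := (norm_nonneg _).trans (hM z (mem_ball_self hR))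
  refine ContinuousLinearMap.opNorm_le_bound _ (by positivity) fun v ↦ ?_
  rcases eq_or_ne v 0 with rfl | hv
  · simp
  have hv' : 0 < ‖v‖ := norm_pos_iff.2 hv
  have hmem : ∀ ζ ∈ closedBall (0 : ℂ) (R / (2 * ‖v‖)), z + ζ • v ∈ ball z R := fun ζ hζ ↦ by
    rw [mem_closedBall_zero_iff] at hζ
    rw [mem_ball_iff_norm, add_sub_cancel_left, norm_smul]
    calc ‖ζ‖ * ‖v‖ ≤ R / (2 * ‖v‖) * ‖v‖ := by gcongr
      _ = R / 2 := by field_simp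
      _ < R := by linarith
  have hd : ∀ ζ ∈ closedBall (0 : ℂ) (R / (2 * ‖v‖)),
      HasDerivAt (fun ζ : ℂ ↦ f (z + ζ • v)) (fderiv ℂ f (z + ζ • v) v) ζ := fun ζ hζ ↦ by
    have h1 : HasFDerivAt f (fderiv ℂ f (z + ζ • v)) (z + ζ • v) :=
      ((hf _ (hmem ζ hζ)).differentiableAt (isOpen_ball.mem_nhds (hmem ζ hζ))).hasFDerivAt
    have h2 : HasDerivAt (fun ζ : ℂ ↦ z + ζ • v) v ζ := by
      simpa using ((hasDerivAt_id ζ).smul_const v).const_add z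
    exact h1.comp_hasDerivAt ζ h2
  have h0 : (0 : ℂ) ∈ closedBall (0 : ℂ) (R / (2 * ‖v‖)) := mem_closedBall_self (by positivity)
  have key := Complex.norm_deriv_le_of_forall_mem_sphere_norm_le
    (c := 0) (R := R / (2 * ‖v‖)) (C := M) (f := fun ζ : ℂ ↦ f (z + ζ • v)) (by positivity)
    (DifferentiableOn.diffContOnCl_ball (U := closedBall (0 : ℂ) (R / (2 * ‖v‖)))
      (fun ζ hζ ↦ (hd ζ hζ).differentiableAt.differentiableWithinAt) Subset.rfl)
    (fun ζ hζ ↦ hM _ (hmem ζ (sphere_subset_closedBall hζ)))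
  rw [(hd 0 h0).deriv, zero_smul, add_zero] at key
  refine key.trans (le_of_eq ?_)
  field_simp

theorem fderiv_apply_eq_circleIntegral {z w : W} {R r : ℝ} (hr : 0 < r) (hrR : r * ‖w‖ < R)
    (hf : DifferentiableOn ℂ f (ball z R)) :
    fderiv ℂ f z w = (2 * Real.pi * Complex.I : ℂ)⁻¹ •
      ∮ ζ in C(0, r), ((ζ - 0) ^ 2)⁻¹ • f (z + ζ • w) := by
  have hopen : IsOpen ((fun ζ : ℂ ↦ z + ζ • w) ⁻¹' ball z R) :=
    isOpen_ball.preimage (by fun_prop)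
  have hsub : closedBall (0 : ℂ) r ⊆ (fun ζ : ℂ ↦ z + ζ • w) ⁻¹' ball z R := fun ζ hζ ↦ by
    rw [mem_closedBall_zero_iff] at hζ
    rw [mem_preimage, mem_ball_iff_norm, add_sub_cancel_left, norm_smul]
    exact (mul_le_mul_of_nonneg_right hζ (norm_nonneg w)).trans_lt hrR
  have hd : ∀ ζ ∈ (fun ζ : ℂ ↦ z + ζ • w) ⁻¹' ball z R,
      HasDerivAt (fun ζ : ℂ ↦ f (z + ζ • w)) (fderiv ℂ f (z + ζ • w) w) ζ := fun ζ hζ ↦ by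
    have h1 : HasFDerivAt f (fderiv ℂ f (z + ζ • w)) (z + ζ • w) :=
      ((hf _ hζ).differentiableAt (isOpen_ball.mem_nhds hζ)).hasFDerivAt
    have h2 : HasDerivAt (fun ζ : ℂ ↦ z + ζ • w) w ζ := by
      simpa using ((hasDerivAt_id ζ).smul_const w).const_add z
    exact h1.comp_hasDerivAt ζ h2
  rw [Complex.two_pi_I_inv_smul_circleIntegral_sub_sq_inv_smul_of_differentiable hopen hsub
    (fun ζ hζ ↦ (hd ζ hζ).differentiableAt.differentiableWithinAt) (mem_ball_self hr),
    (hd 0 (hsub (mem_closedBall_self hr.le))).deriv, zero_smul, add_zero]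

/-- The directional derivative is a Cauchy integral over a circle of fixed radius, in which `z`
enters only through `f`; it can be differentiated under the integral sign. Cauchy's estimate
supplies the dominating bound, and the derivative of `f` need only be measurable, not continuous. -/
theorem differentiableOn_fderiv_apply [FiniteDimensional ℂ W] (hU : IsOpen U)
    (hf : DifferentiableOn ℂ f U) (w : W) : DifferentiableOn ℂ (fun z ↦ fderiv ℂ f z w) U := by
  intro z₀ hz₀
  refine DifferentiableAt.differentiableWithinAt ?_
  -- Three nested balls are needed: `z` moves in radius `R`, the circles around it lie in radius `2
  -- * R`, and Cauchy's estimate at points of the circles uses balls of radius `2 * R` more, inside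
  -- `4 * R` where `f` is bounded.
  obtain ⟨R, hR, hsub, hM⟩ : ∃ R > 0, ball z₀ (4 * R) ⊆ U ∧
      ∀ z ∈ ball z₀ (4 * R), ‖f z‖ ≤ ‖f z₀‖ + 1 := by
    have hc : ContinuousAt f z₀ := (hf.differentiableAt (hU.mem_nhds hz₀)).continuousAt
    have : ∀ᶠ z in 𝓝 z₀, z ∈ U ∧ ‖f z‖ < ‖f z₀‖ + 1 :=
      (hU.eventually_mem hz₀).and (hc.norm.eventually_lt_const (by linarith))
    obtain ⟨ε, hε, h⟩ := Metric.eventually_nhds_iff_ball.1 this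
    refine ⟨ε / 4, by positivity, fun z hz ↦ (h z ?_).1, fun z hz ↦ (h z ?_).2.le⟩ <;>
    · rwa [mul_div_cancel₀ _ (by norm_num)] at hz
  have hsub' : ∀ {z}, z ∈ ball z₀ (2 * R) → ball z (2 * R) ⊆ ball z₀ (4 * R) := fun hz ↦
    ball_subset_ball' (by rw [mem_ball] at hz; linarith)
  have hbd : ∀ z ∈ ball z₀ (2 * R), ‖fderiv ℂ f z‖ ≤ 2 * (‖f z₀‖ + 1) / (2 * R) := fun z hz ↦
    norm_fderiv_le_of_norm_le_on_ball (by positivity) (hf.mono ((hsub' hz).trans hsub))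
      fun z' hz' ↦ hM z' (hsub' hz hz')
  obtain ⟨r, hr, hrR⟩ : ∃ r > 0, r * ‖w‖ < R := by
    refine ⟨R / (‖w‖ + 1), by positivity, ?_⟩
    rw [div_mul_eq_mul_div, div_lt_iff₀ (by positivity)]
    nlinarith [norm_nonneg w]
  have hcirc : ∀ z ∈ ball z₀ R, ∀ θ, z + circleMap 0 r θ • w ∈ ball z₀ (2 * R) := fun z hz θ ↦ by
    rw [mem_ball_iff_norm] at hz ⊢
    calc ‖z + circleMap 0 r θ • w - z₀‖ = ‖(z - z₀) + circleMap 0 r θ • w‖ := by congr 1; abel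
      _ ≤ ‖z - z₀‖ + ‖circleMap 0 r θ • w‖ := norm_add_le _ _
      _ = ‖z - z₀‖ + r * ‖w‖ := by rw [norm_smul, norm_circleMap_zero, abs_of_pos hr]
      _ < 2 * R := by linarith
  have heq : (fun z ↦ fderiv ℂ f z w) =ᶠ[𝓝 z₀] fun z ↦ (2 * Real.pi * Complex.I : ℂ)⁻¹ •
      ∮ ζ in C(0, r), ((ζ - 0) ^ 2)⁻¹ • f (z + ζ • w) := by
    filter_upwards [ball_mem_nhds z₀ hR] with z hz
    refine fderiv_apply_eq_circleIntegral hr (R := 2 * R) (by linarith) (hf.mono ?_)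
    exact (hsub' (ball_subset_ball (by linarith) hz)).trans hsub
  refine DifferentiableAt.congr_of_eventuallyEq ?_ heq
  refine DifferentiableAt.fun_const_smul ?_ _
  set c : ℝ → ℂ := fun θ ↦ deriv (circleMap 0 r) θ * ((circleMap 0 r θ - 0) ^ 2)⁻¹ with hc
  have hccont : Continuous c := by
    have h1 : Continuous (deriv (circleMap 0 r)) := by
      simp only [funext fun θ ↦ deriv_circleMap 0 r θ]; fun_prop
    refine h1.mul (Continuous.inv₀ (by fun_prop) fun θ ↦ ?_)
    simp [circleMap_eq_center_iff, hr.ne']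
  have hline : ∀ z, Continuous fun θ ↦ z + circleMap 0 r θ • w := fun z ↦ by fun_prop
  have hFcont : ∀ z ∈ ball z₀ R, Continuous fun θ ↦ c θ • f (z + circleMap 0 r θ • w) :=
    fun z hz ↦ hccont.smul <| hf.continuousOn.comp_continuous (hline z) fun θ ↦
      hsub (ball_subset_ball (by linarith) (hcirc z hz θ))
  borelize W
  have : CompleteSpace W := FiniteDimensional.complete ℂ W
  have := FiniteDimensional.proper ℂ W
  have key := intervalIntegral.hasFDerivAt_integral_of_dominated_of_fderiv_le
    (𝕜 := ℂ) (μ := volume) (a := 0) (b := 2 * Real.pi)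
    (F := fun z θ ↦ c θ • f (z + circleMap 0 r θ • w))
    (F' := fun z θ ↦ c θ • fderiv ℂ f (z + circleMap 0 r θ • w))
    (bound := fun θ ↦ ‖c θ‖ * (2 * (‖f z₀‖ + 1) / (2 * R))) (x₀ := z₀) (ball_mem_nhds z₀ hR)
    (by
      filter_upwards [ball_mem_nhds z₀ hR] with z hz
      exact (hFcont z hz).aestronglyMeasurable)
    ((hFcont z₀ (mem_ball_self hR)).intervalIntegrable _ _)
    (by
      refine (hccont.measurable.smul ?_).aestronglyMeasurable
      exact (measurable_fderiv ℂ f).comp (hline z₀).measurable)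
    (Eventually.of_forall fun θ _ z hz ↦ by
      rw [norm_smul]
      exact mul_le_mul_of_nonneg_left (hbd _ (hcirc z hz θ)) (norm_nonneg _))
    ((hccont.norm.mul continuous_const).intervalIntegrable _ _)
    (Eventually.of_forall fun θ _ z hz ↦ by
      have hmem := hsub (ball_subset_ball (by linarith) (hcirc z hz θ))
      have h1 := (hf.differentiableAt (hU.mem_nhds hmem)).hasFDerivAt
      have h2 : HasFDerivAt (fun z : W ↦ z + circleMap 0 r θ • w) (ContinuousLinearMap.id ℂ W) z :=
        (hasFDerivAt_id z).add_const _
      exact (h1.comp z h2).const_smul (c θ))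
  refine key.differentiableAt.congr_of_eventuallyEq (Eventually.of_forall fun z ↦ ?_)
  simp only [circleIntegral, hc, smul_eq_mul, mul_assoc]

/-- Directional derivatives are again complex differentiable, so induction on the order applies. -/
theorem contDiffOn_of_differentiableOn_complex [FiniteDimensional ℂ W] (hU : IsOpen U)
    (hf : DifferentiableOn ℂ f U) : ContDiffOn ℂ ∞ f U := by
  rw [contDiffOn_infty]
  intro n
  induction n generalizing f with
  | zero => exact contDiffOn_zero.2 hf.continuousOn
  | succ n ih =>
    push_cast
    rw [contDiffOn_succ_iff_fderiv_apply hU.uniqueDiffOn]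
    refine ⟨hf, fun h ↦ absurd h (by simp), fun w ↦ ?_⟩
    refine (ih (differentiableOn_fderiv_apply hU hf w)).congr fun z hz ↦ ?_
    rw [fderivWithin_of_isOpen hU hz]

end Osgood

/-! ### Holomorphic functions on `E × Ē` and identity theorems. -/

section HolomorphicOnProduct

open Metric Filter Topology

variable {E : Type*} [NormedAddCommGroup E] [NormedSpace ℂ E]

variable (E) in
/-- Multiplication by `i` on the complex vector space `E × Ē`. -/
def modelJ : E × E →L[ℝ] E × E :=
  (Complex.I • ContinuousLinearMap.id ℝ E : E →L[ℝ] E).prodMap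
    (-(Complex.I • ContinuousLinearMap.id ℝ E : E →L[ℝ] E))

@[simp]
theorem modelJ_apply (z : E × E) : modelJ E z = (Complex.I • z.1, -(Complex.I • z.2)) := rfl

theorem modelJ_modelJ (z : E × E) : modelJ E (modelJ E z) = -z := by
  simp [smul_smul, Prod.ext_iff]

/-- `f` is complex differentiable at `z` as a function on the complex vector space `E × Ē`. -/
def JDiffAt (f : E × E → ℂ) (z : E × E) : Prop :=
  DifferentiableAt ℝ f z ∧ ∀ w, fderiv ℝ f z (modelJ E w) = Complex.I * fderiv ℝ f z w

variable {f g : E × E → ℂ} {z : E × E} {S : Set (E × E)}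

theorem JDiffAt.congr_of_eventuallyEq (hf : JDiffAt f z) (h : g =ᶠ[𝓝 z] f) : JDiffAt g z :=
  ⟨hf.1.congr_of_eventuallyEq h, fun w ↦ by rw [h.fderiv_eq, hf.2]⟩

theorem JDiffAt.add (hf : JDiffAt f z) (hg : JDiffAt g z) : JDiffAt (fun z ↦ f z + g z) z :=
  ⟨hf.1.add hg.1, fun w ↦ by
    rw [fderiv_fun_add hf.1 hg.1, add_apply, add_apply, hf.2, hg.2, mul_add]⟩

theorem JDiffAt.sub (hf : JDiffAt f z) (hg : JDiffAt g z) : JDiffAt (fun z ↦ f z - g z) z :=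
  ⟨hf.1.sub hg.1, fun w ↦ by
    rw [fderiv_fun_sub hf.1 hg.1, sub_apply, sub_apply, hf.2, hg.2, mul_sub]⟩

theorem JDiffAt.mul_const (hf : JDiffAt f z) (c : ℂ) : JDiffAt (fun z ↦ f z * c) z :=
  ⟨hf.1.mul_const c, fun w ↦ by
    rw [fderiv_mul_const hf.1]
    simp only [smul_apply, smul_eq_mul, hf.2]
    ring⟩

theorem jDiffAt_const (c : ℂ) : JDiffAt (fun _ : E × E ↦ c) z :=
  ⟨differentiableAt_const c, fun w ↦ by rw [fderiv_fun_const]; simp⟩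

theorem JDiffAt.sum {ι : Type*} {s : Finset ι} {f : ι → E × E → ℂ}
    (h : ∀ i ∈ s, JDiffAt (f i) z) : JDiffAt (fun z ↦ ∑ i ∈ s, f i z) z := by
  classical
  induction s using Finset.induction_on with
  | empty => simpa using jDiffAt_const 0
  | insert i s hi ih =>
    simp only [Finset.sum_insert hi]
    exact (h i (Finset.mem_insert_self i s)).add
      (ih fun j hj ↦ h j (Finset.mem_insert_of_mem hj))

theorem JDiffAt.comp_complex_curve {W : Type*} [NormedAddCommGroup W] [NormedSpace ℂ W]
    {γ : W → E × E} {γ' : W →L[ℝ] E × E} {η : W} (hγ : HasFDerivAt γ γ' η)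
    (hJ : ∀ w, γ' (Complex.I • w) = modelJ E (γ' w)) (hf : JDiffAt f (γ η)) :
    DifferentiableAt ℂ (f ∘ γ) η := by
  have h := hf.1.hasFDerivAt.comp η hγ
  rw [differentiableAt_iff_restrictScalars ℝ h.differentiableAt, h.fderiv]
  set L := (fderiv ℝ f (γ η)).comp γ'
  have hL : ∀ w, L (Complex.I • w) = Complex.I * L w := fun w ↦ by
    simp only [L, ContinuousLinearMap.comp_apply, hJ, hf.2]
  refine ⟨{ toFun := L, map_add' := L.map_add, map_smul' := fun c w ↦ ?_, cont := L.cont }, rfl⟩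
  have hc : c • w = c.re • w + c.im • Complex.I • w := by
    conv_lhs => rw [← Complex.re_add_im c]
    rw [add_smul, mul_smul]; rfl
  rw [hc, L.map_add, L.map_smul, L.map_smul, hL]
  conv_rhs => rw [RingHom.id_apply, ← Complex.re_add_im c]
  simp only [Complex.real_smul, smul_eq_mul]
  ring

/-- The complex line through `a` with direction `d` in `E × Ē`. -/
def complexLine (a d : E × E) (η : ℂ) : E × E := a + (η.re • d + η.im • modelJ E d)

theorem continuous_complexLine (a d : E × E) : Continuous (complexLine a d) := by
  unfold complexLine; fun_prop

theorem JDiffAt.comp_complexLine {a d : E × E} {η : ℂ} (hf : JDiffAt f (complexLine a d η)) :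
    DifferentiableAt ℂ (f ∘ complexLine a d) η := by
  have h : HasFDerivAt (complexLine a d)
      (Complex.reCLM.smulRight d + Complex.imCLM.smulRight (modelJ E d)) η := by
    unfold complexLine
    exact (((Complex.reCLM.smulRight d + Complex.imCLM.smulRight (modelJ E d)).hasFDerivAt
      (x := η)).const_add a)
  refine hf.comp_complex_curve h fun w ↦ ?_
  simp only [add_apply, ContinuousLinearMap.smulRight_apply, Complex.reCLM_apply,
    Complex.imCLM_apply, map_add, map_smul, modelJ_modelJ]
  simp
  abel

theorem convex_preimage_complexLine (hS : Convex ℝ S) (a d : E × E) :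
    Convex ℝ (complexLine a d ⁻¹' S) := by
  intro x hx y hy s t hs ht hst
  have : complexLine a d (s • x + t • y) = s • complexLine a d x + t • complexLine a d y := by
    simp only [complexLine, Complex.add_re, Complex.add_im, Complex.smul_re, Complex.smul_im,
      smul_eq_mul, smul_add, add_smul, mul_smul]
    have : a = s • a + t • a := by rw [← add_smul, hst, one_smul]
    nth_rewrite 1 [this]
    abel
  rw [mem_preimage, this]
  exact hS hx hy hs ht hst

/-- The one-variable identity theorem on the complex line; convexity makes the set of admissible
parameters connected. -/
theorem JDiffAt.eq_zero_of_frequently (hS : IsOpen S) (hconv : Convex ℝ S)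
    (hf : ∀ z ∈ S, JDiffAt f z) {a d : E × E} {η : ℂ} (ha : a ∈ S) (hη : complexLine a d η ∈ S)
    (h0 : ∃ᶠ t in 𝓝[≠] (0 : ℂ), f (complexLine a d t) = 0) : f (complexLine a d η) = 0 := by
  have hopen : IsOpen (complexLine a d ⁻¹' S) := hS.preimage (continuous_complexLine a d)
  have hd : DifferentiableOn ℂ (f ∘ complexLine a d) (complexLine a d ⁻¹' S) := fun t ht ↦
    (hf _ ht).comp_complexLine.differentiableWithinAt
  have h := (hd.analyticOnNhd hopen).eqOn_zero_of_preconnected_of_frequently_eq_zero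
    (convex_preimage_complexLine hconv a d).isPreconnected (z₀ := 0)
    (by simpa [complexLine] using ha) h0
  exact h hη

theorem eqOn_zero_of_eventually_eq_zero (hS : IsOpen S) (hconv : Convex ℝ S)
    (hf : ∀ z ∈ S, JDiffAt f z) {a : E × E} (ha : a ∈ S) (h0 : ∀ᶠ z in 𝓝 a, f z = 0)
    (hz : z ∈ S) : f z = 0 := by
  have h1 : complexLine a (z - a) 1 = z := by simp [complexLine]
  rw [← h1]
  refine JDiffAt.eq_zero_of_frequently hS hconv hf ha (by rwa [h1]) (Eventually.frequently ?_)
  have h2 : Tendsto (complexLine a (z - a)) (𝓝 0) (𝓝 a) :=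
    (continuous_complexLine a (z - a)).tendsto' 0 a (by simp [complexLine])
  exact (h2.eventually h0).filter_mono nhdsWithin_le_nhds

/-- The diagonal is totally real of maximal dimension. Every point lies on a complex line through
the midpoint `(m, m)` whose direction is tangent to the diagonal; real parameters of that line stay
on the diagonal, and `0` is a limit of such zeros. -/
theorem eq_zero_of_eq_zero_on_diagonal {B : Set E} (hB : IsOpen B) (hconv : Convex ℝ B)
    (hf : ∀ z ∈ B ×ˢ B, JDiffAt f z) (h0 : ∀ x ∈ B, f (x, x) = 0) (hz : z ∈ B ×ˢ B) : f z = 0 := by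
  set m : E := (2⁻¹ : ℝ) • (z.1 + z.2)
  -- Chosen so that the parameter `-i` reaches `z`: there the line is at `(m - ie, m + ie)`, and
  -- `-ie` is half of `z.1 - z.2`.
  set e : E := (2⁻¹ : ℝ) • Complex.I • (z.1 - z.2)
  have hm : m ∈ B := by
    have := hconv hz.1 hz.2 (a := 2⁻¹) (b := 2⁻¹) (by norm_num) (by norm_num) (by norm_num)
    rwa [← smul_add] at this
  have hI : Complex.I • e = -((2⁻¹ : ℝ) • (z.1 - z.2)) := by
    simp only [e]; rw [smul_comm, smul_smul, Complex.I_mul_I, neg_one_smul, smul_neg]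
  have h1 : complexLine (m, m) (e, e) (-Complex.I) = z := by
    have h2 : ∀ x y : E, (2⁻¹ : ℝ) • (x + y) + (2⁻¹ : ℝ) • (x - y) = x := fun x y ↦ by
      rw [← smul_add, add_add_sub_cancel, ← two_smul ℝ x, smul_smul]; norm_num
    have h3 : ∀ x y : E, (2⁻¹ : ℝ) • (x + y) - (2⁻¹ : ℝ) • (x - y) = y := fun x y ↦ by
      rw [← smul_sub, add_sub_sub_cancel, ← two_smul ℝ y, smul_smul]; norm_num
    simp only [complexLine, modelJ_apply, hI]
    ext
    · simpa [m] using h2 z.1 z.2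
    · simpa [m, ← sub_eq_add_neg] using h3 z.1 z.2
  rw [← h1]
  refine JDiffAt.eq_zero_of_frequently (hB.prod hB) (hconv.prod hconv) hf ⟨hm, hm⟩
    (by rwa [h1]) ?_
  have hev : ∀ᶠ t : ℝ in 𝓝[≠] 0, f (complexLine (m, m) (e, e) (t : ℂ)) = 0 := by
    have hc : ContinuousAt (fun t : ℝ ↦ m + t • e) 0 := by fun_prop
    have : ∀ᶠ t : ℝ in 𝓝 0, m + t • e ∈ B :=
      hc.eventually (by simpa using hB.eventually_mem hm)
    filter_upwards [this.filter_mono nhdsWithin_le_nhds] with t ht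
    simpa [complexLine] using h0 _ ht
  have htend : Tendsto (fun t : ℝ ↦ (t : ℂ)) (𝓝[≠] 0) (𝓝[≠] 0) := by
    refine tendsto_nhdsWithin_iff.2 ⟨?_, ?_⟩
    · exact (Complex.continuous_ofReal.tendsto' 0 0 (by simp)).mono_left nhdsWithin_le_nhds
    · filter_upwards [self_mem_nhdsWithin] with t ht
      simpa using ht
  exact htend.frequently hev.frequently

section FiniteDimensional

variable [FiniteDimensional ℂ E]

variable (E) in
/-- Complex linear coordinates on `E`. -/
def complexCoordinates : (Fin (Module.finrank ℂ E) → ℂ) ≃L[ℂ] E :=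
  ContinuousLinearEquiv.ofFinrankEq (by simp)

/-- Complex conjugation on `ℂⁿ`. -/
def piConj (n : ℕ) : (Fin n → ℂ) ≃L[ℝ] (Fin n → ℂ) :=
  ContinuousLinearEquiv.piCongrRight fun _ ↦ Complex.conjCLE

variable (E) in
/-- Complex linear coordinates on `E × Ē`. -/
def conjCoordinates : ((Fin (Module.finrank ℂ E) → ℂ) × (Fin (Module.finrank ℂ E) → ℂ)) ≃L[ℝ]
    E × E :=
  let e : (Fin (Module.finrank ℂ E) → ℂ) ≃L[ℝ] E := 
    { (complexCoordinates E).toLinearEquiv.restrictScalars ℝ with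
      continuous_toFun := (complexCoordinates E).continuous
      continuous_invFun := (complexCoordinates E).symm.continuous }
  e.prodCongr ((piConj _).trans e)

theorem conjCoordinates_smul (w) :
    conjCoordinates E (Complex.I • w) = modelJ E (conjCoordinates E w) := by
  have h1 : complexCoordinates E (Complex.I • w.1) = Complex.I • complexCoordinates E w.1 :=
    map_smul _ _ _
  have h2 : complexCoordinates E (piConj _ (Complex.I • w.2)) =
      -(Complex.I • complexCoordinates E (piConj _ w.2)) := by
    rw [← map_smul, ← map_neg]
    congr 1; ext i; simp [piConj]
  exact Prod.ext h1 h2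

/-- Conjugating the coordinates of the second factor turns `modelJ` into ordinary multiplication by
`i`, so the theory of complex differentiable functions applies. -/
theorem jDiffAt_iff_differentiableAt_conjCoordinates {w} :
    JDiffAt f (conjCoordinates E w) ↔ DifferentiableAt ℂ (f ∘ conjCoordinates E) w := by
  refine ⟨fun h ↦ h.comp_complex_curve (conjCoordinates E).hasFDerivAt conjCoordinates_smul,
    fun h ↦ ?_⟩
  have hf : f = (f ∘ conjCoordinates E) ∘ (conjCoordinates E).symm := by ext z; simp
  have hw : w = (conjCoordinates E).symm (conjCoordinates E w) := by simp
  have h1 := h.hasFDerivAt.restrictScalars ℝ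
  rw [hw] at h1
  have h2 := h1.comp _ (conjCoordinates E).symm.hasFDerivAt
  rw [← hf] at h2
  refine ⟨h2.differentiableAt, fun u ↦ ?_⟩
  rw [h2.fderiv]
  obtain ⟨v, rfl⟩ := (conjCoordinates E).surjective u
  rw [← conjCoordinates_smul]
  simp

theorem contDiffOn_of_jDiffAt (hS : IsOpen S) (hf : ∀ z ∈ S, JDiffAt f z) :
    ContDiffOn ℝ ∞ f S := by
  have hopen : IsOpen (conjCoordinates E ⁻¹' S) := hS.preimage (conjCoordinates E).continuous
  have h1 : DifferentiableOn ℂ (f ∘ conjCoordinates E) (conjCoordinates E ⁻¹' S) := fun w hw ↦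
    (jDiffAt_iff_differentiableAt_conjCoordinates.1 (hf _ hw)).differentiableWithinAt
  have h2 := (contDiffOn_of_differentiableOn_complex hopen h1).restrict_scalars ℝ
  exact ((conjCoordinates E).contDiffOn_comp_iff).1 h2

/-- By symmetry of the second derivative, the derivative of `Df(w)` along `Jv` is the derivative of
`Df(Jv) = i Df(v)` along `w`. -/
theorem jDiffAt_fderiv_apply (hS : IsOpen S) (hf : ∀ z ∈ S, JDiffAt f z) (hz : z ∈ S) (w : E × E) :
    JDiffAt (fun z ↦ fderiv ℝ f z w) z := by
  have hc : ContDiffAt ℝ ∞ f z := (contDiffOn_of_jDiffAt hS hf).contDiffAt (hS.mem_nhds hz)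
  have hd : DifferentiableAt ℝ (fderiv ℝ f) z :=
    (hc.fderiv_right (m := 1) (by norm_cast)).differentiableAt one_ne_zero
  have hsymm : IsSymmSndFDerivAt ℝ f z := hc.isSymmSndFDerivAt (by simpa using ENat.LEInfty.out)
  refine ⟨hd.clm_apply (differentiableAt_const w), fun v ↦ ?_⟩
  have h1 : ∀ v w, fderiv ℝ (fun z ↦ fderiv ℝ f z w) z v = fderiv ℝ (fderiv ℝ f) z v w :=
    fun v w ↦ by rw [fderiv_clm_apply hd (differentiableAt_const w)]; simp
  have h2 : (fun z ↦ fderiv ℝ f z (modelJ E v)) =ᶠ[𝓝 z]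
      fun z ↦ Complex.I * fderiv ℝ f z v := by
    filter_upwards [hS.mem_nhds hz] with y hy using (hf y hy).2 v
  rw [h1, h1, hsymm (modelJ E v) w, ← h1, h2.fderiv_eq,
    fderiv_const_mul (hd.clm_apply (differentiableAt_const v)), smul_apply, h1, hsymm w v,
    smul_eq_mul]

end FiniteDimensional

end HolomorphicOnProduct

/-! ### Transition maps and their derivatives. -/

section CoordinateChange

variable {E : Type*} [NormedAddCommGroup E] [NormedSpace ℝ E]
  {H : Type*} [TopologicalSpace H] {I : ModelWithCorners ℝ E H}
  {M : Type*} [TopologicalSpace M] [ChartedSpace H M] [IsManifold I ω M] [I.Boundaryless] {p q r : M}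

theorem hasFDerivAt_coordChange (hp : r ∈ (chartAt H p).source) (hq : r ∈ (chartAt H q).source) :
    HasFDerivAt (extChartAt I q ∘ (extChartAt I p).symm) (tangentCoordChange I p q r)
      (extChartAt I p r) := by
  have h := hasFDerivWithinAt_tangentCoordChange (I := I) (x := p) (y := q) (z := r)
    (by simp only [extChartAt_source]; exact ⟨hp, hq⟩)
  rwa [I.range_eq_univ, hasFDerivWithinAt_univ] at h

theorem contDiffAt_coordChange (hp : r ∈ (chartAt H p).source) (hq : r ∈ (chartAt H q).source) :
    ContDiffAt ℝ ω (extChartAt I q ∘ (extChartAt I p).symm) (extChartAt I p r) := by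
  have h := contDiffWithinAt_ext_coord_change (I := I) (n := ω) q p (y := extChartAt I p r) (by
    rw [PartialEquiv.trans_source, PartialEquiv.symm_source]
    refine ⟨(extChartAt I p).map_source (by rwa [extChartAt_source]), ?_⟩
    rw [mem_preimage, (extChartAt I p).left_inv (by rwa [extChartAt_source]), extChartAt_source]
    exact hq)
  rwa [I.range_eq_univ, contDiffWithinAt_univ] at h

end CoordinateChange

theorem fderiv_clm_apply_apply {F G V W : Type*} [NormedAddCommGroup F] [NormedSpace ℝ F]
    [NormedAddCommGroup G] [NormedSpace ℝ G] [NormedAddCommGroup V] [NormedSpace ℝ V]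
    [NormedAddCommGroup W] [NormedSpace ℝ W] {β : F → G →L[ℝ] W →L[ℝ] V} {z : F}
    (hβ : DifferentiableAt ℝ β z) (u : F) (v : G) (w : W) :
    fderiv ℝ (fun z ↦ β z v w) z u = fderiv ℝ β z u v w := by
  have h := (hβ.hasFDerivAt.clm_apply (hasFDerivAt_const v z)).clm_apply (hasFDerivAt_const w z)
  rw [h.fderiv]
  simp

/-! ### Product charts of `N × N̄` and holomorphic 2-forms. -/

section ComplexManifoldCharts

open Filter Topology

variable {E : Type*} [NormedAddCommGroup E] [NormedSpace ℂ E]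
  {N : Type*} [TopologicalSpace N] [ChartedSpace E N] [IsManifold 𝓘(ℂ, E) ω N]

/-- Transition maps are holomorphic; by uniqueness of derivatives their real derivative is the
complex one, which commutes with `i`. -/
theorem tangentCoordChange_I_smul {x y r : N} (hx : r ∈ (chartAt E x).source)
    (hy : r ∈ (chartAt E y).source) (u : E) :
    tangentCoordChange 𝓘(ℝ, E) x y r (Complex.I • u) =
      Complex.I • tangentCoordChange 𝓘(ℝ, E) x y r u := by
  have h1 := hasFDerivWithinAt_tangentCoordChange (I := 𝓘(ℂ, E)) (x := x) (y := y) (z := r)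
    (by simp only [extChartAt_source]; exact ⟨hx, hy⟩)
  have h2 := hasFDerivAt_coordChange (I := 𝓘(ℝ, E)) hx hy
  rw [modelWithCornersSelf_coe, range_id, hasFDerivWithinAt_univ] at h1
  have h3 := (h1.restrictScalars ℝ).unique h2
  rw [← h3]
  exact map_smul (tangentCoordChange 𝓘(ℂ, E) x y r) Complex.I u

theorem chartFrame_I_smul {x q : N} (hq : q ∈ (chartAt E x).source) (u : E) :
    chartFrame 𝓘(ℝ, E) x q (Complex.I • u) = I₀ q (chartFrame 𝓘(ℝ, E) x q u) := by
  rw [chartFrame_eq hq]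
  exact (tangentCoordChange_I_smul hq (mem_chart_source E q) u).trans
    (congrArg (fun w : E ↦ Complex.I • w) (chartFrame_eq hq u).symm)

omit [NormedSpace ℂ E] [IsManifold 𝓘(ℂ, E) ω N] in
theorem mem_chartAt_prod_source {p r : N × N} : r ∈ (chartAt (ModelProd E E) p).source ↔
    r.1 ∈ (chartAt E p.1).source ∧ r.2 ∈ (chartAt E p.2).source := by
  rw [prodChartedSpace_chartAt]; rfl

theorem tangentCoordChange_prod {p q r : N × N} (hp : r ∈ (chartAt (ModelProd E E) p).source)
    (hq : r ∈ (chartAt (ModelProd E E) q).source) (u : E × E) :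
    tangentCoordChange (𝓘(ℝ, E).prod 𝓘(ℝ, E)) p q r u =
      (tangentCoordChange 𝓘(ℝ, E) p.1 q.1 r.1 u.1, tangentCoordChange 𝓘(ℝ, E) p.2 q.2 r.2 u.2) := by
  have h := hasFDerivAt_coordChange (I := 𝓘(ℝ, E).prod 𝓘(ℝ, E)) hp hq
  have hp' := mem_chartAt_prod_source.1 hp
  have hq' := mem_chartAt_prod_source.1 hq
  have h1 := hasFDerivAt_coordChange (I := 𝓘(ℝ, E)) hp'.1 hq'.1
  have h2 := hasFDerivAt_coordChange (I := 𝓘(ℝ, E)) hp'.2 hq'.2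
  have h3 : HasFDerivAt (extChartAt (𝓘(ℝ, E).prod 𝓘(ℝ, E)) q ∘
      (extChartAt (𝓘(ℝ, E).prod 𝓘(ℝ, E)) p).symm) _ (extChartAt 𝓘(ℝ, E) p.1 r.1, extChartAt 𝓘(ℝ, E) p.2 r.2) :=
    HasFDerivAt.prodMap (f := extChartAt 𝓘(ℝ, E) q.1 ∘ (extChartAt 𝓘(ℝ, E) p.1).symm)
      (f₂ := extChartAt 𝓘(ℝ, E) q.2 ∘ (extChartAt 𝓘(ℝ, E) p.2).symm) (p := (_, _)) h1 h2
  rw [h.unique h3]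
  rfl

theorem chartFrame_prod {p q : N × N} (hq : q ∈ (chartAt (ModelProd E E) p).source) (u : E × E) :
    chartFrame (𝓘(ℝ, E).prod 𝓘(ℝ, E)) p q u =
      pairT (chartFrame 𝓘(ℝ, E) p.1 q.1 u.1) (chartFrame 𝓘(ℝ, E) p.2 q.2 u.2) := by
  have hq' := mem_chartAt_prod_source.1 hq
  rw [chartFrame_eq hq, chartFrame_eq hq'.1, chartFrame_eq hq'.2]
  exact tangentCoordChange_prod hq (mem_chart_source _ q) u

theorem tangentCoordChange_modelJ {p q r : N × N} (hp : r ∈ (chartAt (ModelProd E E) p).source)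
    (hq : r ∈ (chartAt (ModelProd E E) q).source) (u : E × E) :
    tangentCoordChange (𝓘(ℝ, E).prod 𝓘(ℝ, E)) p q r (modelJ E u) =
      modelJ E (tangentCoordChange (𝓘(ℝ, E).prod 𝓘(ℝ, E)) p q r u) := by
  have hp' := mem_chartAt_prod_source.1 hp
  have hq' := mem_chartAt_prod_source.1 hq
  rw [tangentCoordChange_prod hp hq, tangentCoordChange_prod hp hq, modelJ_apply, modelJ_apply,
    map_neg, tangentCoordChange_I_smul hp'.1 hq'.1, tangentCoordChange_I_smul hp'.2 hq'.2]

theorem chartFrame_modelJ {p q : N × N} (hq : q ∈ (chartAt (ModelProd E E) p).source) (u : E × E) :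
    chartFrame (𝓘(ℝ, E).prod 𝓘(ℝ, E)) p q (modelJ E u) =
      Jc E q (chartFrame (𝓘(ℝ, E).prod 𝓘(ℝ, E)) p q u) := by
  rw [chartFrame_eq hq]
  exact (tangentCoordChange_modelJ hq (mem_chart_source _ q) u).trans
    (congrArg (fun w : E × E ↦ modelJ E w) (chartFrame_eq hq u).symm)

theorem JDiffAt.comp {f : E × E → ℂ} {ψ : E × E → E × E} {T : E × E →L[ℝ] E × E} {z : E × E}
    (hf : JDiffAt f (ψ z)) (hψ : HasFDerivAt ψ T z) (hT : ∀ u, T (modelJ E u) = modelJ E (T u)) :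
    JDiffAt (f ∘ ψ) z := by
  have h := hf.1.hasFDerivAt.comp z hψ
  exact ⟨h.differentiableAt, fun w ↦ by
    rw [h.fderiv, ContinuousLinearMap.comp_apply, hT, hf.2]; rfl⟩

theorem JDiffAt.chartChange {f : N × N → ℂ} {p q r : N × N}
    (hp : r ∈ (chartAt (ModelProd E E) p).source) (hq : r ∈ (chartAt (ModelProd E E) q).source)
    (hf : JDiffAt (f ∘ (extChartAt (𝓘(ℝ, E).prod 𝓘(ℝ, E)) q).symm)
      (extChartAt (𝓘(ℝ, E).prod 𝓘(ℝ, E)) q r)) :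
    JDiffAt (f ∘ (extChartAt (𝓘(ℝ, E).prod 𝓘(ℝ, E)) p).symm)
      (extChartAt (𝓘(ℝ, E).prod 𝓘(ℝ, E)) p r) := by
  have hp' : r ∈ (extChartAt (𝓘(ℝ, E).prod 𝓘(ℝ, E)) p).source := by rwa [extChartAt_source]
  have h := hasFDerivAt_coordChange (I := 𝓘(ℝ, E).prod 𝓘(ℝ, E)) hp hq
  have h1 := JDiffAt.comp (by
    rwa [Function.comp_apply, PartialEquiv.left_inv _ hp']) h (tangentCoordChange_modelJ hp hq)
  refine h1.congr_of_eventuallyEq ?_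
  filter_upwards [eventually_mem_extChartAt_target (I := 𝓘(ℝ, E).prod 𝓘(ℝ, E)) hp,
    (continuousAt_extChartAt_symm' (I := 𝓘(ℝ, E).prod 𝓘(ℝ, E)) hp').eventually_mem (by
      rw [PartialEquiv.left_inv _ hp']
      exact (chartAt (ModelProd E E) q).open_source.mem_nhds hq)] with z hz hz'
  simp only [Function.comp_apply]
  rw [PartialEquiv.left_inv _ (by rwa [extChartAt_source])]

theorem isComplexDiffAt_iff_jDiffAt_center {f : N × N → ℂ} {p : N × N} :
    IsComplexDiffAt E f p ↔ JDiffAt (f ∘ (extChartAt (𝓘(ℝ, E).prod 𝓘(ℝ, E)) p).symm)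
      (extChartAt (𝓘(ℝ, E).prod 𝓘(ℝ, E)) p p) := by
  have h := mdifferentiableAt_iff_comp_extChartAt_symm (I := 𝓘(ℝ, E).prod 𝓘(ℝ, E)) (f := f)
    (mem_chart_source (ModelProd E E) p)
  constructor
  · rintro ⟨h1, h2⟩
    refine ⟨h.1 h1, fun w ↦ ?_⟩
    exact (mvfderiv_apply_eq h1 _).symm.trans ((h2 w).trans (congrArg _ (mvfderiv_apply_eq h1 _)))
  · rintro ⟨h1, h2⟩
    refine ⟨h.2 h1, fun w ↦ ?_⟩
    exact (mvfderiv_apply_eq (h.2 h1) _).trans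
      ((h2 w).trans (congrArg _ (mvfderiv_apply_eq (h.2 h1) _).symm))

/-- Complex differentiability can be tested in any product chart around the point, because
transition maps intertwine `modelJ`. -/
theorem isComplexDiffAt_iff_jDiffAt {f : N × N → ℂ} {p q : N × N}
    (hq : q ∈ (chartAt (ModelProd E E) p).source) :
    IsComplexDiffAt E f q ↔ JDiffAt (f ∘ (extChartAt (𝓘(ℝ, E).prod 𝓘(ℝ, E)) p).symm)
      (extChartAt (𝓘(ℝ, E).prod 𝓘(ℝ, E)) p q) := by
  rw [isComplexDiffAt_iff_jDiffAt_center]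
  exact ⟨JDiffAt.chartChange hq (mem_chart_source _ q),
    JDiffAt.chartChange (mem_chart_source _ q) hq⟩

section HolomorphicForms

variable {Ω : CForm E N} {U : Set (N × N)} {p q : N × N}

theorem IsHolomorphicTwoFormOn.mono {V : Set (N × N)} (h : IsHolomorphicTwoFormOn U Ω)
    (hV : V ⊆ U) : IsHolomorphicTwoFormOn V Ω where
  alternating p hp := h.alternating p (hV hp)
  complexLinear p hp := h.complexLinear p (hV hp)
  holomorphic p₀ u v p hp := h.holomorphic p₀ u v p ⟨hV hp.1, hp.2⟩

theorem IsHolomorphicTwoFormOn.neg_swap (h : IsHolomorphicTwoFormOn U Ω) (hp : p ∈ U)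
    (u v : TC E p) : Ω p u v = - Ω p v u := by
  have h1 := h.alternating p hp (u + v)
  rw [map_add, map_add, add_apply, add_apply, h.alternating p hp, h.alternating p hp, zero_add,
    add_zero] at h1
  exact eq_neg_of_add_eq_zero_right h1

theorem coordField_eq_constField (hq : q ∈ (chartAt (ModelProd E E) p).source) (u : E × E) :
    coordField p u q = constField (𝓘(ℝ, E).prod 𝓘(ℝ, E)) p u q :=
  (Trivialization.symmL_apply (R := ℝ) (trivializationAt (E × E)
    (TangentSpace (𝓘(ℝ, E).prod 𝓘(ℝ, E)) : N × N → Type _) p) hq u).symm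

theorem IsHolomorphicTwoFormOn.jDiffAt (h : IsHolomorphicTwoFormOn U Ω) {z : E × E}
    (hz : z ∈ (extChartAt (𝓘(ℝ, E).prod 𝓘(ℝ, E)) p).target)
    (hzU : (extChartAt (𝓘(ℝ, E).prod 𝓘(ℝ, E)) p).symm z ∈ U) (u v : E × E) :
    JDiffAt (fun z ↦ formRep (𝓘(ℝ, E).prod 𝓘(ℝ, E)) Ω p z u v) z := by
  have hs := extChartAt_symm_mem_source hz
  have h1 := (isComplexDiffAt_iff_jDiffAt hs).1 (h.holomorphic p u v _ ⟨hzU, hs⟩)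
  rw [(extChartAt (𝓘(ℝ, E).prod 𝓘(ℝ, E)) p).right_inv hz] at h1
  refine h1.congr_of_eventuallyEq ?_
  filter_upwards [(isOpen_extChartAt_target p).mem_nhds hz] with y hy
  have hy' := extChartAt_symm_mem_source hy
  rw [Function.comp_apply, coordField_eq_constField hy', coordField_eq_constField hy']
  rfl

theorem IsHolomorphicTwoFormOn.formRep_neg_swap (h : IsHolomorphicTwoFormOn U Ω) {z : E × E}
    (hzU : (extChartAt (𝓘(ℝ, E).prod 𝓘(ℝ, E)) p).symm z ∈ U) (u v : E × E) :
    formRep (𝓘(ℝ, E).prod 𝓘(ℝ, E)) Ω p z u v = - formRep (𝓘(ℝ, E).prod 𝓘(ℝ, E)) Ω p z v u :=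
  h.neg_swap hzU _ _

theorem IsHolomorphicTwoFormOn.formRep_modelJ (h : IsHolomorphicTwoFormOn U Ω) {z : E × E}
    (hz : z ∈ (extChartAt (𝓘(ℝ, E).prod 𝓘(ℝ, E)) p).target)
    (hzU : (extChartAt (𝓘(ℝ, E).prod 𝓘(ℝ, E)) p).symm z ∈ U) (u v : E × E) :
    formRep (𝓘(ℝ, E).prod 𝓘(ℝ, E)) Ω p z (modelJ E u) v =
      Complex.I * formRep (𝓘(ℝ, E).prod 𝓘(ℝ, E)) Ω p z u v := by
  rw [formRep_apply, chartFrame_modelJ (extChartAt_symm_mem_source hz)]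
  exact h.complexLinear _ hzU _ _

omit [IsManifold 𝓘(ℂ, E) ω N] in
theorem isOpen_chart_preimage (hU : IsOpen U) (p : N × N) :
    IsOpen ((extChartAt (𝓘(ℝ, E).prod 𝓘(ℝ, E)) p).target ∩
      (extChartAt (𝓘(ℝ, E).prod 𝓘(ℝ, E)) p).symm ⁻¹' U) :=
  (continuousOn_extChartAt_symm p).isOpen_inter_preimage (isOpen_extChartAt_target p) hU

variable [FiniteDimensional ℂ E]

theorem IsHolomorphicTwoFormOn.contDiffAt (h : IsHolomorphicTwoFormOn U Ω) (hU : IsOpen U)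
    {z : E × E}
    (hz : z ∈ (extChartAt (𝓘(ℝ, E).prod 𝓘(ℝ, E)) p).target)
    (hzU : (extChartAt (𝓘(ℝ, E).prod 𝓘(ℝ, E)) p).symm z ∈ U) :
    ContDiffAt ℝ ∞ (formRep (𝓘(ℝ, E).prod 𝓘(ℝ, E)) Ω p) z := by
  have : FiniteDimensional ℝ E := FiniteDimensional.complexToReal E
  have hS := isOpen_chart_preimage (E := E) hU p
  have h1 : ContDiffOn ℝ ∞ (formRep (𝓘(ℝ, E).prod 𝓘(ℝ, E)) Ω p) _ :=
    contDiffOn_clm_apply.2 fun u ↦ contDiffOn_clm_apply.2 fun v ↦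
      contDiffOn_of_jDiffAt hS fun z hz ↦ h.jDiffAt hz.1 hz.2 u v
  exact h1.contDiffAt (hS.mem_nhds ⟨hz, hzU⟩)

theorem IsHolomorphicTwoFormOn.jDiffAt_fderiv (h : IsHolomorphicTwoFormOn U Ω) (hU : IsOpen U)
    {z : E × E}
    (hz : z ∈ (extChartAt (𝓘(ℝ, E).prod 𝓘(ℝ, E)) p).target)
    (hzU : (extChartAt (𝓘(ℝ, E).prod 𝓘(ℝ, E)) p).symm z ∈ U) (u v w : E × E) :
    JDiffAt (fun z ↦ fderiv ℝ (formRep (𝓘(ℝ, E).prod 𝓘(ℝ, E)) Ω p) z u v w) z := by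
  have hS := isOpen_chart_preimage (E := E) hU p
  refine (jDiffAt_fderiv_apply hS (fun z hz ↦ h.jDiffAt hz.1 hz.2 v w) ⟨hz, hzU⟩ u
    ).congr_of_eventuallyEq ?_
  filter_upwards [hS.mem_nhds ⟨hz, hzU⟩] with y hy
  exact (fderiv_clm_apply_apply ((h.contDiffAt hU hy.1 hy.2).differentiableAt (by simp)) u v w).symm

end HolomorphicForms

end ComplexManifoldCharts

/-! ### Propagation of holomorphic identities from the diagonal. -/

section ConnectedTube

open Filter Topology Metric

variable {E : Type*} [NormedAddCommGroup E] [NormedSpace ℂ E]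
  {N : Type*} [TopologicalSpace N] [ChartedSpace E N]

/-- An open neighbourhood of the diagonal with connected vertical slices. -/
structure IsConnectedTube (U : Set (N × N)) : Prop where
  isOpen : IsOpen U
  diagonal_mem : ∀ x, (x, x) ∈ U
  isPreconnected : ∀ x, IsPreconnected {y | (x, y) ∈ U}

theorem exists_box_subset {U : Set (N × N)} (hU : IsOpen U) {p : N × N} (hp : p ∈ U) :
    ∃ r > 0, ball (extChartAt 𝓘(ℝ, E) p.1 p.1) r ×ˢ ball (extChartAt 𝓘(ℝ, E) p.2 p.2) r ⊆
      (extChartAt (𝓘(ℝ, E).prod 𝓘(ℝ, E)) p).target ∩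
        (extChartAt (𝓘(ℝ, E).prod 𝓘(ℝ, E)) p).symm ⁻¹' U := by
  obtain ⟨r, hr, h⟩ := Metric.isOpen_iff.1 (isOpen_chart_preimage (E := E) hU p)
    (extChartAt (𝓘(ℝ, E).prod 𝓘(ℝ, E)) p p)
    ⟨mem_extChartAt_target p, by rwa [mem_preimage, extChartAt_to_inv]⟩
  refine ⟨r, hr, ?_⟩
  rw [ball_prod_same]
  exact h

/-- Analytic continuation for a property `P` that in each chart is the vanishing of a family of
holomorphic functions. On a slice, the set of `y` such that `P` holds near `(x, y)` is open,
contains `x` by the identity theorem on the diagonal, and is relatively closed by the identity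
theorem on a box around a limit point; the slice being connected, it is everything. -/
theorem IsConnectedTube.induction {U : Set (N × N)} (hU : IsConnectedTube U) {ι : Type*}
    {F : N × N → ι → E × E → ℂ} {P : N × N → Prop}
    (hF : ∀ p i z, z ∈ (extChartAt (𝓘(ℝ, E).prod 𝓘(ℝ, E)) p).target →
      (extChartAt (𝓘(ℝ, E).prod 𝓘(ℝ, E)) p).symm z ∈ U → JDiffAt (F p i) z)
    (hP : ∀ p q, q ∈ (chartAt (ModelProd E E) p).source → q ∈ U →
      (P q ↔ ∀ i, F p i (extChartAt (𝓘(ℝ, E).prod 𝓘(ℝ, E)) p q) = 0))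
    (hd : ∀ x, P (x, x)) {p : N × N} (hp : p ∈ U) : P p := by
  have hnear : ∀ p ∈ U, ∀ S ∈ 𝓝 (extChartAt (𝓘(ℝ, E).prod 𝓘(ℝ, E)) p p),
      (∀ i, ∀ z ∈ S, F p i z = 0) → ∀ᶠ q in 𝓝 p, P q := by
    intro p hp S hS h
    filter_upwards [(continuousAt_extChartAt p).preimage_mem_nhds hS, hU.isOpen.mem_nhds hp,
      (chartAt (ModelProd E E) p).open_source.mem_nhds (mem_chart_source _ p)] with q hq hq' hqs
    exact (hP p q hqs hq').2 fun i ↦ h i _ hq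
  obtain ⟨x, y⟩ := p
  suffices h : {y | (x, y) ∈ U} ⊆ {y | ∀ᶠ q in 𝓝 (x, y), P q} from
    (show ∀ᶠ q in 𝓝 (x, y), P q from h hp).self_of_nhds
  have hc : Continuous fun y : N ↦ (x, y) := by fun_prop
  refine (hU.isPreconnected x).subset_of_closure_inter_subset
    (isOpen_setOfPred_eventually_nhds.preimage hc) ⟨x, hU.diagonal_mem x, ?_⟩ ?_
  · obtain ⟨r, hr, hS⟩ := exists_box_subset (E := E) hU.isOpen (hU.diagonal_mem x)
    refine hnear _ (hU.diagonal_mem x) _ (prod_mem_nhds (ball_mem_nhds _ hr) (ball_mem_nhds _ hr))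
      fun i z hz ↦ eq_zero_of_eq_zero_on_diagonal isOpen_ball (convex_ball _ _)
        (fun z hz ↦ hF (x, x) i z (hS hz).1 (hS hz).2) (fun w hw ↦ ?_) hz
    have hw' := hS (mk_mem_prod hw hw)
    have h1 := (hP (x, x) _ (extChartAt_symm_mem_source hw'.1) hw'.2).1
      (hd ((extChartAt 𝓘(ℝ, E) x).symm w)) i
    rwa [(extChartAt (𝓘(ℝ, E).prod 𝓘(ℝ, E)) (x, x)).right_inv hw'.1] at h1
  · rintro y ⟨hy, hyU⟩
    obtain ⟨r, hr, hS⟩ := exists_box_subset (E := E) hU.isOpen (p := (x, y)) hyU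
    have hbox := prod_mem_nhds (ball_mem_nhds (extChartAt 𝓘(ℝ, E) x x) hr)
      (ball_mem_nhds (extChartAt 𝓘(ℝ, E) y y) hr)
    have h1 : ∀ᶠ q in 𝓝 (x, y), q ∈ (chartAt (ModelProd E E) (x, y)).source ∧
        extChartAt (𝓘(ℝ, E).prod 𝓘(ℝ, E)) (x, y) q ∈
          ball (extChartAt 𝓘(ℝ, E) x x) r ×ˢ ball (extChartAt 𝓘(ℝ, E) y y) r :=
      ((chartAt (ModelProd E E) (x, y)).open_source.eventually_mem (mem_chart_source _ _)).and
        ((continuousAt_extChartAt (I := 𝓘(ℝ, E).prod 𝓘(ℝ, E)) (x, y)).preimage_mem_nhds hbox)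
    -- A point of the slice inside the box around the limit point, near which `P` already holds; the
    -- functions in the chart at `(x, y)` vanish near it, hence on the whole box.
    obtain ⟨y', ⟨hy's, hy'b⟩, hy'⟩ := mem_closure_iff_nhds.1 hy _ (hc.continuousAt.eventually h1)
    refine hnear _ hyU _ hbox fun i z hz ↦ eqOn_zero_of_eventually_eq_zero
      (isOpen_ball.prod isOpen_ball) ((convex_ball _ _).prod (convex_ball _ _))
      (fun z hz ↦ hF (x, y) i z (hS hz).1 (hS hz).2) hy'b ?_ hz
    have hs' : (x, y') ∈ (extChartAt (𝓘(ℝ, E).prod 𝓘(ℝ, E)) (x, y)).source := by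
      rwa [extChartAt_source]
    have h2 := (continuousAt_extChartAt_symm' hs').eventually (by
      rw [PartialEquiv.left_inv _ hs']; exact hy')
    filter_upwards [h2, (isOpen_ball.prod isOpen_ball).mem_nhds hy'b] with w hw hwb
    have hw' := hS hwb
    have h3 := (hP (x, y) _ (extChartAt_symm_mem_source hw'.1) hw'.2).1 hw i
    rwa [(extChartAt (𝓘(ℝ, E).prod 𝓘(ℝ, E)) (x, y)).right_inv hw'.1] at h3

/-- `E × Ē` is the complexification of its diagonal, so complex linear objects are determined by
diagonal vectors. -/
theorem eq_diagonal_add_modelJ (u : E × E) : ∃ c d : E, u = (c, c) + modelJ E (d, d) := by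
  refine ⟨(2⁻¹ : ℂ) • (u.1 + u.2), (2⁻¹ : ℂ) • -(Complex.I • (u.1 - u.2)), ?_⟩
  have h : Complex.I • (2⁻¹ : ℂ) • -(Complex.I • (u.1 - u.2)) = (2⁻¹ : ℂ) • (u.1 - u.2) := by
    rw [smul_comm, smul_neg, smul_smul, Complex.I_mul_I, neg_one_smul, neg_neg]
  rw [modelJ_apply, h]
  ext
  · simp only [Prod.fst_add]; module
  · simp only [Prod.snd_add]; module

theorem eq_zero_of_diagonal {L : E × E → ℂ} (hadd : ∀ u v, L (u + v) = L u + L v)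
    (hL : ∀ u, L (modelJ E u) = Complex.I * L u) (h : ∀ a, L (a, a) = 0) (u : E × E) : L u = 0 := by
  obtain ⟨c, d, rfl⟩ := eq_diagonal_add_modelJ u
  rw [hadd, hL, h, h, mul_zero, add_zero]

theorem bilin_eq_zero_of_diagonal {β : E × E →L[ℝ] E × E →L[ℝ] ℂ}
    (h1 : ∀ u v, β (modelJ E u) v = Complex.I * β u v)
    (h2 : ∀ u v, β u (modelJ E v) = Complex.I * β u v)
    (h : ∀ a b, β (a, a) (b, b) = 0) (u v : E × E) : β u v = 0 :=
  eq_zero_of_diagonal (map_add (β u)) (h2 u) (fun b ↦ eq_zero_of_diagonal (L := fun u ↦ β u (b, b))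
      (fun u v ↦ by rw [map_add, add_apply]) (fun u ↦ h1 u _) (fun a ↦ h a b) u) v

variable [IsManifold 𝓘(ℂ, E) ω N]

section TwoForms

variable {U : Set (N × N)} {Ω Ω' : CForm E N} {k : AnalyticKahlerStructure E N}

theorem IsHolomorphicTwoFormOn.complexLinear_right (h : IsHolomorphicTwoFormOn U Ω) {p : N × N}
    (hp : p ∈ U) (u v : TC E p) : Ω p u (Jc E p v) = Complex.I * Ω p u v := by
  rw [h.neg_swap hp, h.complexLinear p hp, h.neg_swap hp v u]
  ring

theorem eq_of_eq_on_diagonal (h : IsHolomorphicTwoFormOn U Ω) (h' : IsHolomorphicTwoFormOn U Ω')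
    {x : N} (hx : (x, x) ∈ U) (hdiag : ∀ a b : TangentSpace 𝓘(ℝ, E) x,
      Ω (x, x) (pairT a a) (pairT b b) = Ω' (x, x) (pairT a a) (pairT b b)) :
    Ω (x, x) = Ω' (x, x) := by
  have flat (β β' : E × E →L[ℝ] E × E →L[ℝ] ℂ)
      (h1 : ∀ u v, β (modelJ E u) v = Complex.I * β u v)
      (h2 : ∀ u v, β' (modelJ E u) v = Complex.I * β' u v)
      (h3 : ∀ u v, β u (modelJ E v) = Complex.I * β u v)
      (h4 : ∀ u v, β' u (modelJ E v) = Complex.I * β' u v)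
      (h5 : ∀ a b, β (a, a) (b, b) = β' (a, a) (b, b)) : β = β' := by
    refine ContinuousLinearMap.ext fun u ↦ ContinuousLinearMap.ext fun v ↦ sub_eq_zero.1
      (bilin_eq_zero_of_diagonal (β := β - β') (fun u v ↦ ?_) (fun u v ↦ ?_) (fun a b ↦ ?_) u v)
    · simp only [sub_apply, h1, h2, mul_sub]
    · simp only [sub_apply, h3, h4, mul_sub]
    · simp only [sub_apply, h5, sub_self]
  exact flat _ _ (h.complexLinear _ hx) (h'.complexLinear _ hx) (h.complexLinear_right hx)
    (h'.complexLinear_right hx) hdiag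

theorem formRep_extChartAt {V : Type*} [NormedAddCommGroup V] [NormedSpace ℝ V] {H F M : Type*}
    [NormedAddCommGroup F] [NormedSpace ℝ F] [TopologicalSpace H] {I : ModelWithCorners ℝ F H}
    [TopologicalSpace M] [ChartedSpace H M] [IsManifold I ω M]
    (b : Π q : M, TangentSpace I q →L[ℝ] TangentSpace I q →L[ℝ] V) {p q : M}
    (hq : q ∈ (chartAt H p).source) (u v : F) :
    formRep I b p (extChartAt I p q) u v = b q (chartFrame I p q u) (chartFrame I p q v) := by
  rw [formRep, (extChartAt I p).left_inv (by rwa [extChartAt_source])]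
  rfl

theorem form_eq_iff_formRep {V : Type*} [NormedAddCommGroup V] [NormedSpace ℝ V] {H F M : Type*}
    [NormedAddCommGroup F] [NormedSpace ℝ F] [TopologicalSpace H] {I : ModelWithCorners ℝ F H}
    [TopologicalSpace M] [ChartedSpace H M] [IsManifold I ω M]
    {b b' : Π q : M, TangentSpace I q →L[ℝ] TangentSpace I q →L[ℝ] V} {p q : M}
    (hq : q ∈ (chartAt H p).source) :
    b q = b' q ↔ ∀ u v, formRep I b p (extChartAt I p q) u v =
      formRep I b' p (extChartAt I p q) u v := by
  simp only [formRep_extChartAt _ hq]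
  refine ⟨fun h u v ↦ by rw [h], fun h ↦ ?_⟩
  ext u v
  rw [← chartFrame_chartCoframe hq u, ← chartFrame_chartCoframe hq v]
  exact h _ _

/-- On the diagonal both forms are the complex bilinear extension of `ω₀`; the equality spreads over
the tube. -/
theorem IsHolomorphicTwoFormOn.eqOn (hU : IsConnectedTube U) (h : IsHolomorphicTwoFormOn U Ω)
    (h' : IsHolomorphicTwoFormOn U Ω') (hk : ExtendsKahlerForm k Ω) (hk' : ExtendsKahlerForm k Ω')
    {p : N × N} (hp : p ∈ U) : Ω p = Ω' p := by
  refine hU.induction (E := E) (ι := (E × E) × (E × E)) (P := fun p ↦ Ω p = Ω' p)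
    (F := fun p i z ↦ formRep (𝓘(ℝ, E).prod 𝓘(ℝ, E)) Ω p z i.1 i.2 -
      formRep (𝓘(ℝ, E).prod 𝓘(ℝ, E)) Ω' p z i.1 i.2)
    (fun p i z hz hzU ↦ (h.jDiffAt hz hzU _ _).sub (h'.jDiffAt hz hzU _ _))
    (fun p q hq _ ↦ ?_) (fun x ↦ ?_) hp
  · rw [form_eq_iff_formRep (I := 𝓘(ℝ, E).prod 𝓘(ℝ, E)) hq]
    simp [sub_eq_zero]
  · exact eq_of_eq_on_diagonal h h' (hU.diagonal_mem x) fun a b ↦ (hk x a b).trans (hk' x a b).symm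

end TwoForms

end ConnectedTube

/-! ### Invariance of the exterior derivative under chart changes. -/

section CyclicDerivative

open Filter Topology

variable {F V : Type*} [NormedAddCommGroup F] [NormedSpace ℝ F] [NormedAddCommGroup V]
  [NormedSpace ℝ V]

set_option synthInstance.maxHeartbeats 200000 in
theorem hasFDerivAt_pullback {β : F → F →L[ℝ] F →L[ℝ] V} {ψ : F → F} {z : F}
    (hψ : ContDiffAt ℝ 2 ψ z) (hβ : DifferentiableAt ℝ β (ψ z)) (v w : F) :
    ∃ T : F →L[ℝ] V, HasFDerivAt (fun y ↦ β (ψ y) (fderiv ℝ ψ y v) (fderiv ℝ ψ y w)) T z ∧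
      ∀ u, T u = fderiv ℝ β (ψ z) (fderiv ℝ ψ z u) (fderiv ℝ ψ z v) (fderiv ℝ ψ z w) +
        β (ψ z) (fderiv ℝ (fderiv ℝ ψ) z u v) (fderiv ℝ ψ z w) +
        β (ψ z) (fderiv ℝ ψ z v) (fderiv ℝ (fderiv ℝ ψ) z u w) := by
  have hd : DifferentiableAt ℝ (fderiv ℝ ψ) z :=
    (hψ.fderiv_right (m := 1) (by norm_num)).differentiableAt one_ne_zero
  have hψ' := (hψ.differentiableAt (by norm_num)).hasFDerivAt
  have hc : HasFDerivAt (fun y ↦ β (ψ y)) ((fderiv ℝ β (ψ z)).comp (fderiv ℝ ψ z)) z :=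
    HasFDerivAt.comp (G := F →L[ℝ] F →L[ℝ] V) z hβ.hasFDerivAt hψ'
  have h2 := (hc.clm_apply
    (hd.hasFDerivAt.clm_apply (hasFDerivAt_const v z))).clm_apply
    (hd.hasFDerivAt.clm_apply (hasFDerivAt_const w z))
  refine ⟨_, h2, fun u ↦ ?_⟩
  simp
  abel

-- The terms containing the second derivative of `ψ` cancel in the cyclic sum, since that derivative
-- is symmetric and `β'` is skew at `ψ z`.
set_option synthInstance.maxHeartbeats 200000 in
theorem cyclicDeriv_comp {β β' : F → F →L[ℝ] F →L[ℝ] V} {ψ : F → F} {z : F}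
    (hψ : ContDiffAt ℝ 2 ψ z) (hβ : DifferentiableAt ℝ β z) (hβ' : DifferentiableAt ℝ β' (ψ z))
    (halt : ∀ u v, β' (ψ z) u v = - β' (ψ z) v u)
    (h : ∀ᶠ y in 𝓝 z, ∀ u v, β y u v = β' (ψ y) (fderiv ℝ ψ y u) (fderiv ℝ ψ y v)) (u v w : F) :
    cyclicDeriv β z u v w =
      cyclicDeriv β' (ψ z) (fderiv ℝ ψ z u) (fderiv ℝ ψ z v) (fderiv ℝ ψ z w) := by
  have hsymm : IsSymmSndFDerivAt ℝ ψ z := hψ.isSymmSndFDerivAt (by simp)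
  have key : ∀ u v w, fderiv ℝ β z u v w =
      fderiv ℝ β' (ψ z) (fderiv ℝ ψ z u) (fderiv ℝ ψ z v) (fderiv ℝ ψ z w) +
      β' (ψ z) (fderiv ℝ (fderiv ℝ ψ) z u v) (fderiv ℝ ψ z w) +
      β' (ψ z) (fderiv ℝ ψ z v) (fderiv ℝ (fderiv ℝ ψ) z u w) := fun u v w ↦ by
    rw [← fderiv_clm_apply_apply hβ]
    have h1 : (fun y ↦ β y v w) =ᶠ[𝓝 z] fun y ↦ β' (ψ y) (fderiv ℝ ψ y v) (fderiv ℝ ψ y w) := by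
      filter_upwards [h] with y hy using hy v w
    obtain ⟨T, hT, hTu⟩ := hasFDerivAt_pullback hψ hβ' v w
    rw [h1.fderiv_eq, hT.fderiv, hTu]
  rw [cyclicDeriv, cyclicDeriv, key, key, key, hsymm v u, hsymm w v, hsymm w u,
    halt (fderiv ℝ ψ z u), halt (fderiv ℝ ψ z v), halt (fderiv ℝ ψ z w)]
  abel

variable {H : Type*} [TopologicalSpace H] {I : ModelWithCorners ℝ F H}
  {M : Type*} [TopologicalSpace M] [ChartedSpace H M] [IsManifold I ω M] [I.Boundaryless] {p q r : M}

theorem cyclicDeriv_formRep_eq_zero {b : Π q : M, TangentSpace I q →L[ℝ] TangentSpace I q →L[ℝ] V}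
    (hp : r ∈ (chartAt H p).source) (hq : r ∈ (chartAt H q).source)
    (hbp : DifferentiableAt ℝ (formRep I b p) (extChartAt I p r))
    (hbq : DifferentiableAt ℝ (formRep I b q) (extChartAt I q r))
    (halt : ∀ u v, b r u v = - b r v u)
    (h : ∀ u v w, cyclicDeriv (formRep I b p) (extChartAt I p r) u v w = 0) (u v w : F) :
    cyclicDeriv (formRep I b q) (extChartAt I q r) u v w = 0 := by
  have hq' : r ∈ (extChartAt I q).source := by rwa [extChartAt_source]
  have hψ : extChartAt I p ((extChartAt I q).symm (extChartAt I q r)) = extChartAt I p r := by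
    rw [(extChartAt I q).left_inv hq']
  rw [cyclicDeriv_comp (ψ := extChartAt I p ∘ (extChartAt I q).symm) (β' := formRep I b p)
    ((contDiffAt_coordChange hq hp).of_le le_top) hbq (by rwa [Function.comp_apply, hψ])]
  · rw [Function.comp_apply, hψ, h]
  · intro u v
    rw [Function.comp_apply, hψ, formRep_extChartAt _ hp, formRep_extChartAt _ hp]
    exact halt _ _
  · filter_upwards [eventually_mem_extChartAt_target (I := I) hq,
      (continuousAt_extChartAt_symm' hq').eventually_mem (by
        rw [PartialEquiv.left_inv _ hq']
        exact (chartAt H p).open_source.mem_nhds hp)] with z hz hz' u v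
    have hs := extChartAt_symm_mem_source hz
    have h1 := hasFDerivAt_coordChange (I := I) hs hz'
    rw [(extChartAt I q).right_inv hz] at h1
    rw [h1.fderiv]
    exact formRep_chartChange b hz hz' u v

end CyclicDerivative

/-! ### Hermitian symmetry, regularity and closedness of the Kähler form. -/

section KahlerExtension

open Filter Topology

variable {E : Type*} [NormedAddCommGroup E] [NormedSpace ℂ E]
  {N : Type*} [TopologicalSpace N] [ChartedSpace E N] [IsManifold 𝓘(ℂ, E) ω N]

section Metric

variable (k : AnalyticKahlerStructure E N)

theorem AnalyticKahlerStructure.inner_I_left (x : N) (u v : E) :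
    k.metric.inner x (Complex.I • u : E) v = - k.metric.inner x u (Complex.I • v : E) := by
  exact (k.skew x u v).trans (congrArg Neg.neg (k.metric.symm x (I₀ x (v : TangentSpace 𝓘(ℝ, E) x)) u))

theorem AnalyticKahlerStructure.inner_I_I (x : N) (u v : E) :
    k.metric.inner x (Complex.I • u : E) (Complex.I • v : E) = k.metric.inner x u v := by
  rw [k.inner_I_left, smul_smul, Complex.I_mul_I, neg_one_smul]
  have h (g : E →L[ℝ] E →L[ℝ] ℝ) : - g u (-v) = g u v := by rw [map_neg, neg_neg]
  exact h _

theorem AnalyticKahlerStructure.contDiffAt_formRep (x : N) :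
    ContDiffAt ℝ ω (formRep 𝓘(ℝ, E) k.metric.inner x) (extChartAt 𝓘(ℝ, E) x x) :=
  (contMDiffAt_form_iff k.metric.inner).1 (k.metric.contMDiff x)

theorem AnalyticKahlerStructure.formRep_form {x : N} {z : E}
    (hz : z ∈ (extChartAt 𝓘(ℝ, E) x).target) (u v : E) :
    formRep 𝓘(ℝ, E) k.form x z u v = formRep 𝓘(ℝ, E) k.metric.inner x z (Complex.I • u) v := by
  rw [formRep_apply, formRep_apply, chartFrame_I_smul (extChartAt_symm_mem_source hz)]
  rfl

theorem AnalyticKahlerStructure.differentiableAt_formRep_form (x : N) :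
    DifferentiableAt ℝ (formRep 𝓘(ℝ, E) k.form x) (extChartAt 𝓘(ℝ, E) x x) := by
  have h1 : DifferentiableAt ℝ (fun z ↦ (formRep 𝓘(ℝ, E) k.metric.inner x z).comp
      (Complex.I • ContinuousLinearMap.id ℝ E : E →L[ℝ] E)) (extChartAt 𝓘(ℝ, E) x x) :=
    ((k.contDiffAt_formRep x).differentiableAt (by simp)).clm_comp (differentiableAt_const _)
  refine h1.congr_of_eventuallyEq ?_
  filter_upwards [eventually_mem_extChartAt_target (I := 𝓘(ℝ, E)) (mem_chart_source E x)] with z hz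
  ext u v
  exact k.formRep_form hz u v

theorem AnalyticKahlerStructure.form_neg_swap (x : N) (u v : TangentSpace 𝓘(ℝ, E) x) :
    k.form x u v = - k.form x v u := k.skew x u v

/-- Both `g₀` and `I₀` are parallel for the Levi-Civita connection, hence so is `ω₀`; a parallel
form is closed. -/
theorem AnalyticKahlerStructure.cyclicDeriv_form (x : N) (u v w : E) :
    cyclicDeriv (formRep 𝓘(ℝ, E) k.form x) (extChartAt 𝓘(ℝ, E) x x) u v w = 0 := by
  obtain ⟨cov, h1, h2⟩ := k.integrable
  refine cyclicDeriv_eq_zero_of_parallel h1 (fun p hp u hu Y Z hY hZ ↦ ?_) (mem_univ x)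
    (k.differentiableAt_formRep_form x) (k.form_neg_swap x) u v w
  have hI : FieldDiffAt 𝓘(ℝ, E) (fun q ↦ I₀ q (Y q)) p := by
    refine fieldDiffAt_end_apply ?_ hY
    refine (differentiableAt_const
      (Complex.I • ContinuousLinearMap.id ℝ E : E →L[ℝ] E)).congr_of_eventuallyEq ?_
    filter_upwards [eventually_mem_extChartAt_target (I := 𝓘(ℝ, E)) (mem_chart_source E p)]
      with z hz
    ext u
    have hs := extChartAt_symm_mem_source hz
    exact (congrArg (chartCoframe 𝓘(ℝ, E) p _) (chartFrame_I_smul hs u).symm).trans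
      (chartCoframe_chartFrame hs _)
  have h3 := h1.metric p hp u hu _ Z hI hZ
  rw [h2 p hp u hu Y hY] at h3
  exact h3

end Metric

end KahlerExtension

/-! ### A holomorphic extension of the Kähler form is closed and bi-Lagrangian. -/

section BiLagrangian

open Filter Topology

variable {E : Type*} [NormedAddCommGroup E] [NormedSpace ℂ E]

/-- From the splitting `2 (u, 0) = (u, u) - J(iu, iu)`. -/
theorem two_mul_apply_fst {L : E × E →L[ℝ] ℂ} (h : ∀ u, L (modelJ E u) = Complex.I * L u) (u : E) :
    2 * L (u, 0) = L (u, u) - Complex.I * L (Complex.I • u, Complex.I • u) := by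
  have h1 : (2 : ℝ) • ((u, 0) : E × E) = (u, u) - modelJ E (Complex.I • u, Complex.I • u) := by
    simp [smul_smul, two_smul]
  have h2 := congrArg L h1
  rw [map_smul, map_sub, h] at h2
  rw [← h2, Complex.real_smul]
  norm_num

theorem two_mul_apply_snd {L : E × E →L[ℝ] ℂ} (h : ∀ u, L (modelJ E u) = Complex.I * L u) (v : E) :
    2 * L (0, v) = L (v, v) + Complex.I * L (Complex.I • v, Complex.I • v) := by
  have h1 : (2 : ℝ) • ((0, v) : E × E) = (v, v) + modelJ E (Complex.I • v, Complex.I • v) := by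
    simp [smul_smul, two_smul]
  have h2 := congrArg L h1
  rw [map_smul, map_add, h] at h2
  rw [← h2, Complex.real_smul]
  norm_num

set_option synthInstance.maxHeartbeats 400000 in
theorem cyclic_eq_zero_of_diagonal {D : E × E →L[ℝ] E × E →L[ℝ] E × E →L[ℝ] ℂ}
    (h1 : ∀ u v w, D (modelJ E u) v w = Complex.I * D u v w)
    (h2 : ∀ u v w, D u (modelJ E v) w = Complex.I * D u v w)
    (h3 : ∀ u v w, D u v w = - D u w v)
    (h : ∀ a b c, D (a, a) (b, b) (c, c) + D (b, b) (c, c) (a, a) + D (c, c) (a, a) (b, b) = 0)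
    (u v w : E × E) : D u v w + D v w u + D w u v = 0 := by
  have h4 : ∀ u v w, D u v (modelJ E w) = Complex.I * D u v w := fun u v w ↦ by
    rw [h3, h2, h3 u v w]; ring
  refine eq_zero_of_diagonal (L := fun w ↦ D u v w + D v w u + D w u v) ?_ ?_
    (fun c ↦ eq_zero_of_diagonal
      (L := fun v ↦ D u v (c, c) + D v (c, c) u + D (c, c) u v) ?_ ?_ (fun b ↦
        eq_zero_of_diagonal (L := fun u ↦ D u (b, b) (c, c) + D (b, b) (c, c) u +
          D (c, c) u (b, b)) ?_ ?_ (fun a ↦ h a b c) u) v) w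
  all_goals
    intros
    simp only [map_add, add_apply, h1, h2, h4]
    ring

variable {N : Type*} [TopologicalSpace N] [ChartedSpace E N] [IsManifold 𝓘(ℂ, E) ω N]
  {U : Set (N × N)} {Ω : CForm E N} {k : AnalyticKahlerStructure E N}

/-- The flat form of a bilinear form field at a point. -/
def flatForm {V : Type*} [NormedAddCommGroup V] [NormedSpace ℝ V]
    (b : Π p : N × N, TC E p →L[ℝ] TC E p →L[ℝ] V) (p : N × N) : E × E →L[ℝ] E × E →L[ℝ] V := b p

/-- Write each vector of a factor as a complex combination of diagonal vectors. The invariance of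
`ω₀` under `I₀` makes the components within one factor cancel, and leaves the mixed component, which
is the Hermitian form of `g₀`. -/
theorem IsHolomorphicTwoFormOn.flatForm_diagonal (h : IsHolomorphicTwoFormOn U Ω)
    (hk : ExtendsKahlerForm k Ω) {x : N} (hx : (x, x) ∈ U) (u v : E) :
    flatForm Ω (x, x) (u, 0) (v, 0) = 0 ∧ flatForm Ω (x, x) (0, u) (0, v) = 0 ∧
    2 * flatForm Ω (x, x) (u, 0) (0, v) =
      k.metric.inner x (Complex.I • u : E) v + Complex.I * k.metric.inner x u v := by
  have flat (β : E × E →L[ℝ] E × E →L[ℝ] ℂ) (g : E →L[ℝ] E →L[ℝ] ℝ)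
      (h1 : ∀ u v, β (modelJ E u) v = Complex.I * β u v)
      (h2 : ∀ u v, β u (modelJ E v) = Complex.I * β u v)
      (h3 : ∀ u v, β u v = - β v u)
      (h4 : ∀ a b, β (a, a) (b, b) = g (Complex.I • a) b)
      (h5 : ∀ a b, g (Complex.I • a) b = - g a (Complex.I • b))
      (h6 : ∀ a b, g (Complex.I • a) (Complex.I • b) = g a b) :
      β (u, 0) (v, 0) = 0 ∧ β (0, u) (0, v) = 0 ∧
      2 * β (u, 0) (0, v) = g (Complex.I • u) v + Complex.I * g u v := by
    have hI := Complex.I_mul_I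
    have hI' : ∀ v : E, Complex.I • Complex.I • v = -v := fun v ↦ by
      rw [smul_smul, hI, neg_one_smul]
    have h7 : (g u (Complex.I • v) : ℂ) = - g (Complex.I • u) v := by
      rw [h5]; push_cast; ring
    have f1 (w : E × E) (u : E) := two_mul_apply_fst (L := β.flip w) (fun u ↦ h1 u w) u
    have f2 (w : E × E) (u : E) := two_mul_apply_fst (L := β w) (fun u ↦ h2 w u) u
    have f3 (w : E × E) (u : E) := two_mul_apply_snd (L := β.flip w) (fun u ↦ h1 u w) u
    have f4 (w : E × E) (u : E) := two_mul_apply_snd (L := β w) (fun u ↦ h2 w u) u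
    simp only [ContinuousLinearMap.flip_apply] at f1 f3
    have g1 := f2 (u, u) v
    have g2 := f2 (Complex.I • u, Complex.I • u) v
    have g3 := f4 (u, u) v
    have g4 := f4 (Complex.I • u, Complex.I • u) v
    simp only [h4, h6, hI', map_neg, neg_apply, Complex.ofReal_neg, h7] at g1 g2 g3 g4
    refine ⟨?_, ?_, ?_⟩
    · linear_combination 2⁻¹ * f1 (v, 0) u + 4⁻¹ * g1 - 4⁻¹ * Complex.I * g2 +
        4⁻¹ * (g (Complex.I • u) v : ℂ) * hI
    · linear_combination 2⁻¹ * f3 (0, v) u + 4⁻¹ * g3 + 4⁻¹ * Complex.I * g4 +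
        4⁻¹ * (g (Complex.I • u) v : ℂ) * hI
    · linear_combination f1 (0, v) u + 2⁻¹ * g3 - 2⁻¹ * Complex.I * g4 -
        2⁻¹ * (g (Complex.I • u) v : ℂ) * hI
  exact flat _ _ (h.complexLinear _ hx) (h.complexLinear_right hx) (h.neg_swap hx) (hk x)
    (k.inner_I_left x) (k.inner_I_I x)

variable [FiniteDimensional ℂ E]

theorem IsHolomorphicTwoFormOn.fderiv_formRep_apply (h : IsHolomorphicTwoFormOn U Ω) (hU : IsOpen U)
    {p : N × N} {z : E × E} (hz : z ∈ (extChartAt (𝓘(ℝ, E).prod 𝓘(ℝ, E)) p).target)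
    (hzU : (extChartAt (𝓘(ℝ, E).prod 𝓘(ℝ, E)) p).symm z ∈ U) (u v w : E × E) :
    fderiv ℝ (formRep (𝓘(ℝ, E).prod 𝓘(ℝ, E)) Ω p) z (modelJ E u) v w =
        Complex.I * fderiv ℝ (formRep (𝓘(ℝ, E).prod 𝓘(ℝ, E)) Ω p) z u v w ∧
      fderiv ℝ (formRep (𝓘(ℝ, E).prod 𝓘(ℝ, E)) Ω p) z u (modelJ E v) w =
        Complex.I * fderiv ℝ (formRep (𝓘(ℝ, E).prod 𝓘(ℝ, E)) Ω p) z u v w ∧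
      fderiv ℝ (formRep (𝓘(ℝ, E).prod 𝓘(ℝ, E)) Ω p) z u v w =
        - fderiv ℝ (formRep (𝓘(ℝ, E).prod 𝓘(ℝ, E)) Ω p) z u w v := by
  have hS := (isOpen_chart_preimage (E := E) hU p).mem_nhds ⟨hz, hzU⟩
  have hd := (h.contDiffAt hU hz hzU).differentiableAt (by simp)
  have hd' := fun v w ↦ (h.jDiffAt hz hzU v w).1
  refine ⟨?_, ?_, ?_⟩
  · rw [← fderiv_clm_apply_apply hd, ← fderiv_clm_apply_apply hd]
    exact (h.jDiffAt hz hzU v w).2 u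
  · rw [← fderiv_clm_apply_apply hd, ← fderiv_clm_apply_apply hd]
    have e : (fun z ↦ formRep (𝓘(ℝ, E).prod 𝓘(ℝ, E)) Ω p z (modelJ E v) w) =ᶠ[𝓝 z]
        fun z ↦ Complex.I * formRep (𝓘(ℝ, E).prod 𝓘(ℝ, E)) Ω p z v w := by
      filter_upwards [hS] with y hy using h.formRep_modelJ hy.1 hy.2 v w
    rw [e.fderiv_eq, fderiv_const_mul (hd' v w), smul_apply, smul_eq_mul]
  · rw [← fderiv_clm_apply_apply hd, ← fderiv_clm_apply_apply hd]
    have e : (fun z ↦ formRep (𝓘(ℝ, E).prod 𝓘(ℝ, E)) Ω p z v w) =ᶠ[𝓝 z]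
        fun z ↦ - formRep (𝓘(ℝ, E).prod 𝓘(ℝ, E)) Ω p z w v := by
      filter_upwards [hS] with y hy using h.formRep_neg_swap hy.2 v w
    rw [e.fderiv_eq, fderiv_fun_neg, neg_apply]

/-- The cyclic sum is complex trilinear, so diagonal vectors suffice; on them it is that of `ω₀`,
which is closed. -/
theorem IsHolomorphicTwoFormOn.cyclicDeriv_diagonal (h : IsHolomorphicTwoFormOn U Ω)
    (hU : IsOpen U) (hk : ExtendsKahlerForm k Ω) {x : N} (hx : (x, x) ∈ U) (u v w : E × E) :
    cyclicDeriv (formRep (𝓘(ℝ, E).prod 𝓘(ℝ, E)) Ω (x, x))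
      (extChartAt (𝓘(ℝ, E).prod 𝓘(ℝ, E)) (x, x) (x, x)) u v w = 0 := by
  have hxt := mem_extChartAt_target (I := 𝓘(ℝ, E).prod 𝓘(ℝ, E)) (x, x)
  have hxU : (extChartAt (𝓘(ℝ, E).prod 𝓘(ℝ, E)) (x, x)).symm
      (extChartAt (𝓘(ℝ, E).prod 𝓘(ℝ, E)) (x, x) (x, x)) ∈ U := by rwa [extChartAt_to_inv]
  have hD := h.fderiv_formRep_apply hU hxt hxU
  have hd := (h.contDiffAt hU hxt hxU).differentiableAt (by simp)
  -- Restricting to the curve `y ↦ (y, y)` computes derivatives in diagonal directions, where the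
  -- components of `Ω` are those of `ω₀`.
  have hdiag : ∀ a b c : E, fderiv ℝ (formRep (𝓘(ℝ, E).prod 𝓘(ℝ, E)) Ω (x, x))
      (extChartAt (𝓘(ℝ, E).prod 𝓘(ℝ, E)) (x, x) (x, x)) (a, a) (b, b) (c, c) =
      fderiv ℝ (formRep 𝓘(ℝ, E) k.form x) (extChartAt 𝓘(ℝ, E) x x) a b c := by
    intro a b c
    have h1 : HasFDerivAt (fun y : E ↦ (y, y))
        ((ContinuousLinearMap.id ℝ E).prod (ContinuousLinearMap.id ℝ E)) (extChartAt 𝓘(ℝ, E) x x) :=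
      (hasFDerivAt_id _).prodMk (hasFDerivAt_id _)
    have h2 := HasFDerivAt.comp (f := fun y : E ↦ (y, y)) (extChartAt 𝓘(ℝ, E) x x)
      (g := fun z ↦ formRep (𝓘(ℝ, E).prod 𝓘(ℝ, E)) Ω (x, x) z (b, b) (c, c))
      ((h.jDiffAt hxt hxU (b, b) (c, c)).1.hasFDerivAt) h1
    have h3 := Complex.ofRealCLM.hasFDerivAt.comp (extChartAt 𝓘(ℝ, E) x x)
      (((k.differentiableAt_formRep_form x).clm_apply (differentiableAt_const b)).clm_apply
        (differentiableAt_const c)).hasFDerivAt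
    have e : (fun z ↦ formRep (𝓘(ℝ, E).prod 𝓘(ℝ, E)) Ω (x, x) z (b, b) (c, c)) ∘
        (fun y : E ↦ (y, y)) =ᶠ[𝓝 (extChartAt 𝓘(ℝ, E) x x)]
        Complex.ofRealCLM ∘ fun y ↦ formRep 𝓘(ℝ, E) k.form x y b c := by
      filter_upwards [eventually_mem_extChartAt_target (I := 𝓘(ℝ, E)) (mem_chart_source E x)]
        with y hy
      have hs : (extChartAt (𝓘(ℝ, E).prod 𝓘(ℝ, E)) (x, x)).symm (y, y) ∈
          (chartAt (ModelProd E E) (x, x)).source :=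
        mem_chartAt_prod_source.2 ⟨extChartAt_symm_mem_source hy, extChartAt_symm_mem_source hy⟩
      rw [Function.comp_apply, formRep_apply, chartFrame_prod hs, chartFrame_prod hs]
      exact hk _ _ _
    have h4 := congrArg (fun L : E →L[ℝ] ℂ ↦ L a) (h2.unique (h3.congr_of_eventuallyEq e))
    rw [← fderiv_clm_apply_apply hd, ← fderiv_clm_apply_apply (k.differentiableAt_formRep_form x)]
    exact h4
  exact cyclic_eq_zero_of_diagonal (fun u v w ↦ (hD u v w).1) (fun u v w ↦ (hD u v w).2.1)
    (fun u v w ↦ (hD u v w).2.2) (fun a b c ↦ by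
      rw [hdiag, hdiag, hdiag]
      exact_mod_cast k.cyclicDeriv_form x a b c) u v w

/-- The components of `dΩ` are holomorphic and vanish on the diagonal. Closedness at `q` is read in
the chart at `q` but propagated in the chart at `p`, whence the chart invariance of the cyclic sum.
-/
theorem IsHolomorphicTwoFormOn.cyclicDeriv_eq_zero (h : IsHolomorphicTwoFormOn U Ω)
    (hU : IsConnectedTube U) (hk : ExtendsKahlerForm k Ω) {p : N × N} (hp : p ∈ U) :
    ∀ u v w, cyclicDeriv (formRep (𝓘(ℝ, E).prod 𝓘(ℝ, E)) Ω p)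
      (extChartAt (𝓘(ℝ, E).prod 𝓘(ℝ, E)) p p) u v w = 0 := by
  refine hU.induction (E := E) (ι := (E × E) × (E × E) × (E × E))
    (P := fun p ↦ ∀ u v w, cyclicDeriv (formRep (𝓘(ℝ, E).prod 𝓘(ℝ, E)) Ω p)
      (extChartAt (𝓘(ℝ, E).prod 𝓘(ℝ, E)) p p) u v w = 0)
    (F := fun p i z ↦ cyclicDeriv (formRep (𝓘(ℝ, E).prod 𝓘(ℝ, E)) Ω p) z i.1 i.2.1 i.2.2)
    (fun p i z hz hzU ↦ ?_) (fun p q hq hqU ↦ ?_) (fun x ↦ ?_) hp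
  · exact ((h.jDiffAt_fderiv hU.isOpen hz hzU _ _ _).add
      (h.jDiffAt_fderiv hU.isOpen hz hzU _ _ _)).add (h.jDiffAt_fderiv hU.isOpen hz hzU _ _ _)
  · have hd : ∀ p, q ∈ (chartAt (ModelProd E E) p).source →
        DifferentiableAt ℝ (formRep (𝓘(ℝ, E).prod 𝓘(ℝ, E)) Ω p)
          (extChartAt (𝓘(ℝ, E).prod 𝓘(ℝ, E)) p q) := fun p hq ↦ by
      have hq' : q ∈ (extChartAt (𝓘(ℝ, E).prod 𝓘(ℝ, E)) p).source := by rwa [extChartAt_source]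
      exact (h.contDiffAt hU.isOpen (PartialEquiv.map_source _ hq')
        (by rwa [PartialEquiv.left_inv _ hq'])).differentiableAt (by simp)
    have hq' := mem_chart_source (ModelProd E E) q
    constructor
    · exact fun H i ↦ cyclicDeriv_formRep_eq_zero hq' hq (hd q hq') (hd p hq) (h.neg_swap hqU) H _ _ _
    · exact fun H ↦ cyclicDeriv_formRep_eq_zero hq hq' (hd p hq) (hd q hq')
        (h.neg_swap hqU) (fun u v w ↦ H (u, v, w))
  · exact h.cyclicDeriv_diagonal hU.isOpen hk (hU.diagonal_mem x)

omit [FiniteDimensional ℂ E] in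
theorem IsHolomorphicTwoFormOn.flatForm_lagrangian (h : IsHolomorphicTwoFormOn U Ω)
    (hU : IsConnectedTube U) (hk : ExtendsKahlerForm k Ω) {p : N × N} (hp : p ∈ U) :
    ∀ u v : E, flatForm Ω p (u, 0) (v, 0) = 0 ∧ flatForm Ω p (0, u) (0, v) = 0 := by
  -- The Boolean selects the foliation: `true` for pairs of horizontal vectors, `false` for pairs of
  -- vertical ones.
  refine hU.induction (E := E) (ι := Bool × E × E)
    (P := fun p ↦ ∀ u v : E, flatForm Ω p (u, 0) (v, 0) = 0 ∧ flatForm Ω p (0, u) (0, v) = 0)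
    (F := fun p i z ↦ formRep (𝓘(ℝ, E).prod 𝓘(ℝ, E)) Ω p z
      (cond i.1 (i.2.1, 0) (0, i.2.1)) (cond i.1 (i.2.2, 0) (0, i.2.2)))
    (fun p i z hz hzU ↦ h.jDiffAt hz hzU _ _) (fun p q hq hqU ↦ ?_) (fun x u v ↦ ?_) hp
  · have hq' := mem_chartAt_prod_source.1 hq
    have h1 : ∀ u v : E, formRep (𝓘(ℝ, E).prod 𝓘(ℝ, E)) Ω p
        (extChartAt (𝓘(ℝ, E).prod 𝓘(ℝ, E)) p q) (u, 0) (v, 0) =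
        flatForm Ω q (chartFrame 𝓘(ℝ, E) p.1 q.1 u, 0) (chartFrame 𝓘(ℝ, E) p.1 q.1 v, 0) := by
      intro u v
      rw [formRep_extChartAt _ hq, chartFrame_prod hq, chartFrame_prod hq]
      simp only [map_zero]
      rfl
    have h2 : ∀ u v : E, formRep (𝓘(ℝ, E).prod 𝓘(ℝ, E)) Ω p
        (extChartAt (𝓘(ℝ, E).prod 𝓘(ℝ, E)) p q) (0, u) (0, v) =
        flatForm Ω q (0, chartFrame 𝓘(ℝ, E) p.2 q.2 u) (0, chartFrame 𝓘(ℝ, E) p.2 q.2 v) := by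
      intro u v
      rw [formRep_extChartAt _ hq, chartFrame_prod hq, chartFrame_prod hq]
      simp only [map_zero]
      rfl
    constructor
    · rintro H ⟨_ | _, u, v⟩
      · exact (h2 u v).trans (H _ _).2
      · exact (h1 u v).trans (H _ _).1
    · intro H u v
      have e1 (u : E) := chartFrame_chartCoframe (I := 𝓘(ℝ, E)) hq'.1 u
      have e2 (u : E) := chartFrame_chartCoframe (I := 𝓘(ℝ, E)) hq'.2 u
      refine ⟨?_, ?_⟩
      · rw [← e1 u, ← e1 v]
        exact (h1 _ _).symm.trans (H (true, _, _))
      · rw [← e2 u, ← e2 v]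
        exact (h2 _ _).symm.trans (H (false, _, _))
  · have := h.flatForm_diagonal hk (hU.diagonal_mem x) u v
    exact ⟨this.1, this.2.1⟩

theorem IsHolomorphicTwoFormOn.isComplexBiLagrangianOn (h : IsHolomorphicTwoFormOn U Ω)
    (hU : IsConnectedTube U) (hk : ExtendsKahlerForm k Ω) (hnd : IsNondegenerateOn U Ω) :
    IsComplexBiLagrangianOn U Ω where
  holomorphic := h
  nondegenerate := hnd
  closed := isClosedFormOn_of_cyclicDeriv (fun p hp ↦ (h.contDiffAt hU.isOpen
    (mem_extChartAt_target p) (by rwa [extChartAt_to_inv])).differentiableAt (by simp))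
    (fun p hp ↦ h.neg_swap hp) (fun p hp ↦ h.cyclicDeriv_eq_zero hU hk hp)
  vertical := by
    rintro p hp _ ⟨u, rfl⟩ _ ⟨v, rfl⟩
    exact (h.flatForm_lagrangian hU hk hp u v).2
  horizontal := by
    rintro p hp _ ⟨u, rfl⟩ _ ⟨v, rfl⟩
    exact (h.flatForm_lagrangian hU hk hp u v).1

end BiLagrangian

/-! ### Linear algebra of the quadruple at one point. -/

section PointwiseAlgebra

variable {E : Type*} [NormedAddCommGroup E] [NormedSpace ℂ E]

/-- Twice the imaginary part of the mixed part of a bilinear form on `E × Ē`. -/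
def mixedForm (β : E × E →L[ℝ] E × E →L[ℝ] ℂ) : E →L[ℝ] E →L[ℝ] ℝ :=
  (2 : ℝ) • ((Complex.imCLM.compL ℝ E ℂ ℝ).comp
    (β.bilinearComp (ContinuousLinearMap.inl ℝ E E) (ContinuousLinearMap.inr ℝ E E)).flip)

/-- The isomorphism between the tangent spaces of the two factors for which the mixed part of `β`
corresponds to the Hermitian form of `g`. -/
def transfer (g : E →L[ℝ] E →L[ℝ] ℝ) (β : E × E →L[ℝ] E × E →L[ℝ] ℂ) : E →L[ℝ] E :=
  g.inverse.comp (mixedForm β)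

/-- The metric on `E × Ē` induced by `g` and the isomorphism `B`. -/
def pairMetric (g : E →L[ℝ] E →L[ℝ] ℝ) (B : E →L[ℝ] E) : E × E →L[ℝ] E × E →L[ℝ] ℝ :=
  (2⁻¹ : ℝ) • (g.bilinearComp (ContinuousLinearMap.fst ℝ E E) (ContinuousLinearMap.fst ℝ E E) +
    g.bilinearComp (B.comp (ContinuousLinearMap.snd ℝ E E))
      (B.comp (ContinuousLinearMap.snd ℝ E E)))

/-- The complex structure interchanging the two factors of `E × Ē` by means of `iB`. -/
def pairI (B : E →L[ℝ] E) : E × E →L[ℝ] E × E :=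
  (Complex.I • B.comp (ContinuousLinearMap.snd ℝ E E)).prod
    (Complex.I • B.inverse.comp (ContinuousLinearMap.fst ℝ E E))

/-- The complex structure interchanging the two factors of `E × Ē` by means of `B`. -/
def pairK (B : E →L[ℝ] E) : E × E →L[ℝ] E × E :=
  (B.comp (ContinuousLinearMap.snd ℝ E E)).prod (-B.inverse.comp (ContinuousLinearMap.fst ℝ E E))

/-- `g` is a Hermitian inner product on `E`. -/
structure IsHermitianMetric (g : E →L[ℝ] E →L[ℝ] ℝ) : Prop where
  symm : ∀ u v, g u v = g v u
  pos : ∀ u, u ≠ 0 → 0 < g u u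
  I_I : ∀ u v, g (Complex.I • u) (Complex.I • v) = g u v

/-- `β` is a complex symplectic form on `E × Ē` for which both factors are Lagrangian. -/
structure IsLagrangianForm (β : E × E →L[ℝ] E × E →L[ℝ] ℂ) : Prop where
  neg_swap : ∀ u v, β u v = - β v u
  modelJ : ∀ u v, β (modelJ E u) v = Complex.I * β u v
  nondegenerate : ∀ u, (∀ v, β u v = 0) → u = 0
  fst : ∀ u v : E, β (u, 0) (v, 0) = 0
  snd : ∀ u v : E, β (0, u) (0, v) = 0

variable {g : E →L[ℝ] E →L[ℝ] ℝ} {β : E × E →L[ℝ] E × E →L[ℝ] ℂ} {B : E →L[ℝ] E}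

theorem mixedForm_apply (u v : E) : mixedForm β v u = 2 * (β (u, 0) (0, v)).im := rfl

theorem pairMetric_apply (a b : E × E) :
    pairMetric g B a b = 2⁻¹ * (g a.1 b.1 + g (B a.2) (B b.2)) := rfl

theorem pairI_apply (a : E × E) :
    pairI B a = (Complex.I • B a.2, Complex.I • B.inverse a.1) := rfl

theorem pairK_apply (a : E × E) : pairK B a = (B a.2, -B.inverse a.1) := rfl

theorem IsHermitianMetric.I_left (hg : IsHermitianMetric g) (u v : E) :
    g (Complex.I • u) v = - g u (Complex.I • v) := by
  rw [← hg.I_I u (Complex.I • v), smul_smul, Complex.I_mul_I, neg_one_smul, map_neg, neg_neg]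

theorem IsHermitianMetric.eq_of_forall (hg : IsHermitianMetric g) {u v : E}
    (h : ∀ w, g u w = g v w) : u = v := by
  by_contra hne
  have h1 := hg.pos (u - v) (sub_ne_zero.2 hne)
  rw [map_sub, map_sub, sub_apply, sub_apply, h, h, sub_self, sub_self, sub_self] at h1
  exact h1.false

theorem IsLagrangianForm.modelJ_right (hβ : IsLagrangianForm β) (u v : E × E) :
    β u (_root_.modelJ E v) = Complex.I * β u v := by
  rw [hβ.neg_swap, hβ.modelJ, hβ.neg_swap v u]; ring

theorem IsLagrangianForm.apply_eq (hβ : IsLagrangianForm β) (a b : E × E) :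
    β a b = β (a.1, 0) (0, b.2) - β (b.1, 0) (0, a.2) := by
  have h : ∀ c : E × E, c = (c.1, 0) + (0, c.2) := fun c ↦ by simp
  conv_lhs => rw [h a, h b]
  simp only [map_add, add_apply, hβ.fst, hβ.snd, hβ.neg_swap (0, a.2)]
  ring

theorem IsLagrangianForm.fst_I (hβ : IsLagrangianForm β) (u v : E) :
    β (Complex.I • u, 0) (0, v) = Complex.I * β (u, 0) (0, v) := by
  rw [← hβ.modelJ]; simp

theorem IsLagrangianForm.snd_I (hβ : IsLagrangianForm β) (u v : E) :
    β (u, 0) (0, Complex.I • v) = - (Complex.I * β (u, 0) (0, v)) := by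
  rw [← hβ.modelJ_right, ← map_neg]; simp

variable [FiniteDimensional ℝ E]

theorem transfer_apply (hg : IsHermitianMetric g) (u v : E) :
    g (transfer g β v) u = 2 * (β (u, 0) (0, v)).im := by
  have h : g.IsInvertible := isInvertible_of_nondegenerate fun u hu ↦
    hg.eq_of_forall fun w ↦ by rw [hu, map_zero]; rfl
  rw [transfer, ContinuousLinearMap.comp_apply, h.self_apply_inverse, mixedForm_apply]

/-- The mixed part of `β` is antilinear in the second vector, and `i` is skew for `g`; the two signs
cancel. -/
theorem transfer_I (hg : IsHermitianMetric g) (hβ : IsLagrangianForm β) (v : E) :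
    transfer g β (Complex.I • v) = Complex.I • transfer g β v := by
  refine hg.eq_of_forall fun w ↦ ?_
  rw [hg.I_left, transfer_apply hg, transfer_apply hg, hβ.snd_I, hβ.fst_I]
  simp

/-- The imaginary part is the defining property of `transfer`; the real part follows from it on
replacing `u` by `iu`. -/
theorem mixed_eq (hg : IsHermitianMetric g) (hβ : IsLagrangianForm β) (u v : E) :
    2 * β (u, 0) (0, v) = g (Complex.I • u) (transfer g β v) + Complex.I * g u (transfer g β v) := by
  rw [hg.symm _ (transfer g β v), hg.symm _ (transfer g β v), transfer_apply hg, transfer_apply hg,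
    hβ.fst_I]
  apply Complex.ext <;> simp

/-- If `B v = 0` then `(0, v)` pairs to zero with the first factor, and with the second because that
is Lagrangian; nondegeneracy gives `v = 0`. -/
theorem isInvertible_transfer (hg : IsHermitianMetric g) (hβ : IsLagrangianForm β) :
    (transfer g β).IsInvertible := by
  have hinj : Function.Injective (transfer g β).toLinearMap := by
    rw [← LinearMap.ker_eq_bot, LinearMap.ker_eq_bot']
    intro v hv
    have hv' : transfer g β v = 0 := hv
    have h := hβ.nondegenerate (0, v) fun w ↦ by
      have h1 := mixed_eq hg hβ w.1 v
      rw [hv', map_zero, map_zero] at h1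
      rw [hβ.apply_eq]
      have h2 : β (w.1, 0) (0, v) = 0 := by simpa using h1
      have h3 : ((0, 0) : E × E) = 0 := rfl
      simp [h2, h3]
    simpa using h
  exact ⟨(LinearEquiv.ofInjectiveEndo _ hinj).toContinuousLinearEquiv, by ext u; rfl⟩

theorem transfer_transfer_inverse (hg : IsHermitianMetric g) (hβ : IsLagrangianForm β) (u : E) :
    transfer g β ((transfer g β).inverse u) = u :=
  (isInvertible_transfer hg hβ).self_apply_inverse u

theorem transfer_inverse_transfer (hg : IsHermitianMetric g) (hβ : IsLagrangianForm β) (u : E) :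
    (transfer g β).inverse (transfer g β u) = u :=
  (isInvertible_transfer hg hβ).inverse_apply_self u

theorem transfer_inverse_I (hg : IsHermitianMetric g) (hβ : IsLagrangianForm β) (u : E) :
    (transfer g β).inverse (Complex.I • u) = Complex.I • (transfer g β).inverse u := by
  conv_lhs => rw [← transfer_transfer_inverse hg hβ u, ← transfer_I hg hβ]
  rw [transfer_inverse_transfer hg hβ]

/-- With `pairMetric_pairK`, this is the admissibility condition `ω_I - iω_K = ω` split into real
and imaginary parts. -/
theorem pairMetric_pairI (hg : IsHermitianMetric g) (hβ : IsLagrangianForm β) (a b : E × E) :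
    pairMetric g (transfer g β) (pairI (transfer g β) a) b = (β a b).re := by
  have h1 := congrArg Complex.re (mixed_eq hg hβ a.1 b.2)
  have h2 := congrArg Complex.re (mixed_eq hg hβ b.1 a.2)
  rw [hβ.apply_eq, pairMetric_apply, pairI_apply, transfer_I hg hβ,
    transfer_transfer_inverse hg hβ, hg.I_left (transfer g β a.2), hg.symm (transfer g β a.2)]
  simp at h1 h2
  simp
  linarith

theorem pairMetric_pairK (hg : IsHermitianMetric g) (hβ : IsLagrangianForm β) (a b : E × E) :
    pairMetric g (transfer g β) (pairK (transfer g β) a) b = - (β a b).im := by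
  have h1 := congrArg Complex.im (mixed_eq hg hβ a.1 b.2)
  have h2 := congrArg Complex.im (mixed_eq hg hβ b.1 a.2)
  rw [hβ.apply_eq, pairMetric_apply, pairK_apply, map_neg,
    transfer_transfer_inverse hg hβ, hg.symm (transfer g β a.2)]
  simp at h1 h2
  simp
  linarith

omit [FiniteDimensional ℝ E] in
theorem pairMetric_symm (hg : IsHermitianMetric g) (a b : E × E) :
    pairMetric g B a b = pairMetric g B b a := by
  rw [pairMetric_apply, pairMetric_apply, hg.symm a.1, hg.symm (B a.2)]

theorem pairMetric_pos (hg : IsHermitianMetric g) (hβ : IsLagrangianForm β) (a : E × E)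
    (ha : a ≠ 0) : 0 < pairMetric g (transfer g β) a a := by
  have hnn : ∀ u, 0 ≤ g u u := fun u ↦ by
    rcases eq_or_ne u 0 with rfl | hu
    · simp
    · exact (hg.pos u hu).le
  rw [pairMetric_apply]
  by_cases h : a.1 = 0
  · have h2 : transfer g β a.2 ≠ 0 := fun h2 ↦ ha (Prod.ext h (by
      rw [← transfer_inverse_transfer hg hβ a.2, h2, map_zero]; rfl))
    linarith [hnn a.1, hg.pos _ h2]
  · linarith [hg.pos _ h, hnn (transfer g β a.2)]

theorem pairI_pairI (hg : IsHermitianMetric g) (hβ : IsLagrangianForm β) (a : E × E) :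
    pairI (transfer g β) (pairI (transfer g β) a) = -a := by
  simp only [pairI_apply, transfer_I hg hβ, transfer_inverse_I hg hβ,
    transfer_transfer_inverse hg hβ, transfer_inverse_transfer hg hβ, smul_smul, Complex.I_mul_I]
  ext <;> simp

theorem pairK_pairK (hg : IsHermitianMetric g) (hβ : IsLagrangianForm β) (a : E × E) :
    pairK (transfer g β) (pairK (transfer g β) a) = -a := by
  simp only [pairK_apply, map_neg,
    transfer_transfer_inverse hg hβ, transfer_inverse_transfer hg hβ]
  rfl

theorem pairI_modelJ (hg : IsHermitianMetric g) (hβ : IsLagrangianForm β) (a : E × E) :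
    pairI (transfer g β) (modelJ E a) = pairK (transfer g β) a := by
  simp only [pairI_apply, pairK_apply, modelJ_apply, map_neg, transfer_I hg hβ,
    transfer_inverse_I hg hβ, smul_neg, smul_smul, Complex.I_mul_I, neg_one_smul, neg_neg]

omit [FiniteDimensional ℝ E] in
theorem modelJ_pairI (a : E × E) : modelJ E (pairI B a) = - pairK B a := by
  simp [pairI_apply, pairK_apply, modelJ_apply, smul_smul]

theorem pairMetric_modelJ (hg : IsHermitianMetric g) (hβ : IsLagrangianForm β) (a b : E × E) :
    pairMetric g (transfer g β) (modelJ E a) (modelJ E b) = pairMetric g (transfer g β) a b := by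
  simp only [pairMetric_apply, modelJ_apply, map_neg, transfer_I hg hβ, hg.I_I, neg_apply, neg_neg]

theorem pairMetric_pairI_pairI (hg : IsHermitianMetric g) (hβ : IsLagrangianForm β) (a b : E × E) :
    pairMetric g (transfer g β) (pairI (transfer g β) a) (pairI (transfer g β) b) =
      pairMetric g (transfer g β) a b := by
  simp only [pairMetric_apply, pairI_apply, transfer_I hg hβ, transfer_transfer_inverse hg hβ,
    hg.I_I]
  ring

theorem pairMetric_pairK_pairK (hg : IsHermitianMetric g) (hβ : IsLagrangianForm β) (a b : E × E) :
    pairMetric g (transfer g β) (pairK (transfer g β) a) (pairK (transfer g β) b) =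
      pairMetric g (transfer g β) a b := by
  simp only [pairMetric_apply, pairK_apply, transfer_transfer_inverse hg hβ, map_neg, neg_apply,
    neg_neg]
  ring

theorem transfer_eq_id (hg : IsHermitianMetric g)
    (h : ∀ u v, 2 * β (u, 0) (0, v) = g (Complex.I • u) v + Complex.I * g u v) :
    transfer g β = ContinuousLinearMap.id ℝ E := by
  ext v
  refine hg.eq_of_forall fun w ↦ ?_
  have h1 := congrArg Complex.im (h w v)
  rw [transfer_apply hg, ContinuousLinearMap.id_apply, hg.symm v]
  simpa using h1

end PointwiseAlgebra

/-! ### Christoffel symbols of the bi-Lagrangian connection. -/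

section Christoffel

set_option synthInstance.maxHeartbeats 400000

section Koszul

variable {F : Type*} [NormedAddCommGroup F] [NormedSpace ℝ F]

/-- The real part of the restriction of a bilinear form along two endomorphisms. -/
def reRestrict (P Q : F →L[ℝ] F) : (F →L[ℝ] F →L[ℝ] ℂ) →L[ℝ] (F →L[ℝ] F →L[ℝ] ℝ) :=
  (ContinuousLinearMap.compL ℝ F (F →L[ℝ] ℂ) (F →L[ℝ] ℝ)
    ((ContinuousLinearMap.compL ℝ F ℂ ℝ Complex.reCLM).comp
      (ContinuousLinearMap.precomp ℂ Q))).comp (ContinuousLinearMap.precomp (F →L[ℝ] ℂ) P)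

/-- The solution `Γ` of `Re β(Γ(a, b), c) = Re (D(Pa, Pb, Qc) + D(Qa, Qb, Pc))`. -/
def koszulSolution (P Q : F →L[ℝ] F) (β : F →L[ℝ] F →L[ℝ] ℂ) (D : F →L[ℝ] F →L[ℝ] F →L[ℝ] ℂ) :
    F →L[ℝ] F →L[ℝ] F :=
  let K := ContinuousLinearMap.compL ℝ F (F →L[ℝ] ℝ) F
    (reRestrict (ContinuousLinearMap.id ℝ F) (ContinuousLinearMap.id ℝ F) β).inverse
  K.comp ((reRestrict P Q).comp (D.comp P)) + K.comp ((reRestrict Q P).comp (D.comp Q))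

/-- Only the real part of `β` is inverted, since it identifies the real space `F` with its real
dual; complex linearity later recovers the imaginary part. -/
theorem re_apply_koszulSolution [FiniteDimensional ℝ F] {β : F →L[ℝ] F →L[ℝ] ℂ}
    (h : ∀ u, (∀ v, (β u v).re = 0) → u = 0) (P Q : F →L[ℝ] F)
    (D : F →L[ℝ] F →L[ℝ] F →L[ℝ] ℂ) (a b c : F) :
    (β (koszulSolution P Q β D a b) c).re =
      (D (P a) (P b) (Q c) + D (Q a) (Q b) (P c)).re := by
  have hinv : (reRestrict (ContinuousLinearMap.id ℝ F)
      (ContinuousLinearMap.id ℝ F) β).IsInvertible := isInvertible_of_nondegenerate h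
  have h1 : ∀ τ : F →L[ℝ] ℝ, (β ((reRestrict (ContinuousLinearMap.id ℝ F)
      (ContinuousLinearMap.id ℝ F) β).inverse τ) c).re = τ c := fun τ ↦
    congrArg (fun L : F →L[ℝ] ℝ ↦ L c) (hinv.self_apply_inverse τ)
  refine (congrArg Complex.re (congrArg (fun L : F →L[ℝ] ℂ ↦ L c) (map_add β _ _))).trans ?_
  exact congrArg₂ (· + ·) (h1 _) (h1 _)

end Koszul

variable {E : Type*} [NormedAddCommGroup E] [NormedSpace ℂ E]

variable (E) in
/-- The projection of `E × Ē` to its first factor. -/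
def projFst : E × E →L[ℝ] E × E :=
  (ContinuousLinearMap.inl ℝ E E).comp (ContinuousLinearMap.fst ℝ E E)

variable (E) in
/-- The projection of `E × Ē` to its second factor. -/
def projSnd : E × E →L[ℝ] E × E :=
  (ContinuousLinearMap.inr ℝ E E).comp (ContinuousLinearMap.snd ℝ E E)

variable (E) in
/-- The para-complex structure of `E × Ē`. -/
def modelF : E × E →L[ℝ] E × E :=
  (-(ContinuousLinearMap.id ℝ E)).prodMap (ContinuousLinearMap.id ℝ E)

theorem modelF_apply (a : E × E) : modelF E a = (-a.1, a.2) := rfl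

/-- The derivative of a closed complex symplectic form for which both factors of `E × Ē` are
Lagrangian. -/
structure IsLagrangianDeriv (D : E × E →L[ℝ] E × E →L[ℝ] E × E →L[ℝ] ℂ) : Prop where
  modelJ : ∀ u v w, D u (modelJ E v) w = Complex.I * D u v w
  neg_swap : ∀ u v w, D u v w = - D u w v
  fst : ∀ w u v, D w (u, 0) (v, 0) = 0
  snd : ∀ w u v, D w (0, u) (0, v) = 0
  cyclic : ∀ u v w, D u v w + D v w u + D w u v = 0

/-- The Christoffel symbols of the bi-Lagrangian connection of a form with value `β` and derivative
`D` at a point. -/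
def christoffel (β : E × E →L[ℝ] E × E →L[ℝ] ℂ) (D : E × E →L[ℝ] E × E →L[ℝ] E × E →L[ℝ] ℂ) :
    E × E →L[ℝ] E × E →L[ℝ] E × E :=
  koszulSolution (projFst E) (projSnd E) β D

variable {β : E × E →L[ℝ] E × E →L[ℝ] ℂ} {D : E × E →L[ℝ] E × E →L[ℝ] E × E →L[ℝ] ℂ}

theorem IsLagrangianForm.eq_zero_of_re (hβ : IsLagrangianForm β) {u : E × E}
    (h : ∀ v, (β u v).re = 0) : u = 0 := by
  refine hβ.nondegenerate u fun v ↦ ?_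
  have h1 := h (_root_.modelJ E v)
  rw [hβ.modelJ_right] at h1
  apply Complex.ext
  · exact h v
  · simpa using h1

variable [FiniteDimensional ℝ E]

/-- The real part holds by construction, and replacing `c` by `Jc` gives the imaginary part. The
formula says that two horizontal arguments give a horizontal vector, two vertical ones a vertical
vector, and mixed ones zero. -/
theorem apply_christoffel (hβ : IsLagrangianForm β) (hD : IsLagrangianDeriv D) (a b c : E × E) :
    β (christoffel β D a b) c = D (projFst E a) (projFst E b) (projSnd E c) +
      D (projSnd E a) (projSnd E b) (projFst E c) := by
  have h1 := re_apply_koszulSolution (fun u hu ↦ hβ.eq_zero_of_re hu) (projFst E) (projSnd E) D a b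
  have h2 := h1 (modelJ E c)
  have e1 : projFst E (modelJ E c) = modelJ E (projFst E c) := by
    simp [projFst]
  have e2 : projSnd E (modelJ E c) = modelJ E (projSnd E c) := by
    simp [projSnd]
  have e3 : ∀ u v w, D u v (modelJ E w) = Complex.I * D u v w := fun u v w ↦ by
    rw [hD.neg_swap, hD.modelJ, hD.neg_swap u v]; ring
  rw [hβ.modelJ_right, e1, e2, e3, e3, ← mul_add] at h2
  apply Complex.ext
  · exact h1 c
  · simp only [Complex.I_mul_re, Complex.add_im, neg_inj] at h2 ⊢
    exact h2

omit [FiniteDimensional ℝ E] in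
theorem IsLagrangianDeriv.projFst_projFst (hD : IsLagrangianDeriv D) (a b c : E × E) :
    D a (projFst E b) (projFst E c) = 0 := hD.fst a b.1 c.1

omit [FiniteDimensional ℝ E] in
theorem IsLagrangianDeriv.projSnd_projSnd (hD : IsLagrangianDeriv D) (a b c : E × E) :
    D a (projSnd E b) (projSnd E c) = 0 := hD.snd a b.2 c.2

omit [FiniteDimensional ℝ E] in
theorem projFst_add_projSnd (a : E × E) : projFst E a + projSnd E a = a := by
  simp [projFst, projSnd]

/-- In the cyclic identity for three vectors, two of which are tangent to the same foliation, the
Lagrangian condition kills the term pairing those two; what remains is symmetry. -/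
theorem christoffel_comm (hβ : IsLagrangianForm β) (hD : IsLagrangianDeriv D) (a b : E × E) :
    christoffel β D a b = christoffel β D b a := by
  rw [← sub_eq_zero]
  refine hβ.nondegenerate _ fun c ↦ ?_
  have h1 := hD.cyclic (projFst E a) (projFst E b) (projSnd E c)
  have h2 := hD.cyclic (projSnd E a) (projSnd E b) (projFst E c)
  rw [hD.projFst_projFst, hD.neg_swap (projFst E b)] at h1
  rw [hD.projSnd_projSnd, hD.neg_swap (projSnd E b)] at h2
  rw [map_sub, sub_apply, apply_christoffel hβ hD, apply_christoffel hβ hD]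
  linear_combination h1 + h2

/-- This is `∇ω = 0` at a point: after splitting into components, the four mixed terms of `D(a, b,
c)` are exactly the four given by `apply_christoffel`. -/
theorem deriv_eq_christoffel (hβ : IsLagrangianForm β) (hD : IsLagrangianDeriv D) (a b c : E × E) :
    D a b c = β (christoffel β D a b) c + β b (christoffel β D a c) := by
  rw [hβ.neg_swap b, apply_christoffel hβ hD, apply_christoffel hβ hD,
    hD.neg_swap _ (projFst E c), hD.neg_swap _ (projSnd E c)]
  conv_lhs => rw [← projFst_add_projSnd a, ← projFst_add_projSnd b, ← projFst_add_projSnd c]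
  simp only [map_add, add_apply, hD.projFst_projFst, hD.projSnd_projSnd]
  ring

/-- The connection preserves both foliations; together with `∇ω = 0` this makes the metric `ω(F·,·)`
parallel. -/
theorem christoffel_modelF (hβ : IsLagrangianForm β) (hD : IsLagrangianDeriv D) (a b : E × E) :
    christoffel β D a (modelF E b) = modelF E (christoffel β D a b) := by
  rw [← sub_eq_zero]
  refine hβ.nondegenerate _ fun c ↦ ?_
  have h : ∀ u v, β (modelF E u) v = - β u (modelF E v) := fun u v ↦ by
    rw [hβ.apply_eq, hβ.apply_eq u]
    have h1 : ((-u.1, 0) : E × E) = -(u.1, 0) := by simp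
    have h2 : ((-v.1, 0) : E × E) = -(v.1, 0) := by simp
    simp only [modelF_apply, h1, h2, map_neg, neg_apply]
    ring
  have e1 : ∀ u, projFst E (modelF E u) = - projFst E u := fun u ↦ by
    simp [projFst, modelF_apply]
  have e2 : ∀ u, projSnd E (modelF E u) = projSnd E u := fun u ↦ by
    simp [projSnd, modelF_apply]
  rw [map_sub, sub_apply, h, apply_christoffel hβ hD, apply_christoffel hβ hD, e1, e1, e2, e2]
  simp only [map_neg, neg_apply]
  ring

/-- By `apply_christoffel` its pairing with every vertical vector vanishes, and so does that of the
horizontal part. A horizontal vector orthogonal to the vertical factor is zero. -/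
theorem fst_christoffel_vertical (hβ : IsLagrangianForm β) (hD : IsLagrangianDeriv D) (w : E)
    (b : E × E) : (christoffel β D (0, w) b).1 = 0 := by
  have h := hβ.nondegenerate ((christoffel β D (0, w) b).1, 0) fun c ↦ by
    have h1 := apply_christoffel hβ hD (0, w) b (projSnd E c)
    have e1 : projFst E ((0, w) : E × E) = 0 := by simp [projFst]
    have e2 : projFst E (projSnd E c) = 0 := by simp [projFst, projSnd]
    rw [e1, e2, hβ.apply_eq] at h1
    have e3 : ((0, 0) : E × E) = 0 := rfl
    rw [hβ.apply_eq]
    simpa [projSnd, e3] using h1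
  simpa using h

theorem christoffel_vertical_fst (hβ : IsLagrangianForm β) (hD : IsLagrangianDeriv D) (w u : E) :
    christoffel β D (0, w) (u, 0) = 0 := by
  refine hβ.nondegenerate _ fun c ↦ ?_
  have e1 : projFst E ((0, w) : E × E) = 0 := by simp [projFst]
  have e2 : projSnd E ((u, 0) : E × E) = 0 := by simp [projSnd]
  rw [apply_christoffel hβ hD, e1, e2]
  simp

end Christoffel

/-! ### The bi-Lagrangian connection of a Kähler extension. -/

section Connection

set_option synthInstance.maxHeartbeats 400000
set_option linter.unusedSectionVars false

open Filter Topology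

variable {E : Type*} [NormedAddCommGroup E] [NormedSpace ℂ E]
  {N : Type*} [TopologicalSpace N] [ChartedSpace E N] [IsManifold 𝓘(ℂ, E) ω N]
  {U : Set (N × N)} {Ω : CForm E N} {k : AnalyticKahlerStructure E N} {p : N × N}

variable (k) in
/-- The metric at a point, as a bilinear form on the model space. -/
def AnalyticKahlerStructure.flatInner (x : N) : E →L[ℝ] E →L[ℝ] ℝ := k.metric.inner x

theorem AnalyticKahlerStructure.isHermitianMetric (x : N) : IsHermitianMetric (k.flatInner x) where
  symm := k.metric.symm x
  pos := k.metric.pos x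
  I_I := k.inner_I_I x

variable (k) in
/-- `Ω` is a nondegenerate holomorphic extension of the Kähler form to `U`. -/
structure IsKahlerExtensionOn (U : Set (N × N)) (Ω : CForm E N) : Prop where
  tube : IsConnectedTube U
  holomorphic : IsHolomorphicTwoFormOn U Ω
  nondegenerate : IsNondegenerateOn U Ω
  extends_form : ExtendsKahlerForm k Ω

theorem formRep_fst (h : ∀ p ∈ U, ∀ u v : E, flatForm Ω p (u, 0) (v, 0) = 0) {z : E × E}
    (hz : z ∈ (extChartAt (𝓘(ℝ, E).prod 𝓘(ℝ, E)) p).target)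
    (hzU : (extChartAt (𝓘(ℝ, E).prod 𝓘(ℝ, E)) p).symm z ∈ U) (u v : E) :
    formRep (𝓘(ℝ, E).prod 𝓘(ℝ, E)) Ω p z (u, 0) (v, 0) = 0 := by
  have hs := extChartAt_symm_mem_source hz
  rw [formRep_apply, chartFrame_prod hs, chartFrame_prod hs]
  simp only [map_zero]
  exact h _ hzU _ _

theorem formRep_snd (h : ∀ p ∈ U, ∀ u v : E, flatForm Ω p (0, u) (0, v) = 0) {z : E × E}
    (hz : z ∈ (extChartAt (𝓘(ℝ, E).prod 𝓘(ℝ, E)) p).target)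
    (hzU : (extChartAt (𝓘(ℝ, E).prod 𝓘(ℝ, E)) p).symm z ∈ U) (u v : E) :
    formRep (𝓘(ℝ, E).prod 𝓘(ℝ, E)) Ω p z (0, u) (0, v) = 0 := by
  have hs := extChartAt_symm_mem_source hz
  rw [formRep_apply, chartFrame_prod hs, chartFrame_prod hs]
  simp only [map_zero]
  exact h _ hzU _ _

variable [FiniteDimensional ℂ E]

theorem IsKahlerExtensionOn.isLagrangianForm (h : IsKahlerExtensionOn k U Ω) (hp : p ∈ U) :
    IsLagrangianForm (flatForm Ω p) where
  neg_swap := h.holomorphic.neg_swap hp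
  modelJ := h.holomorphic.complexLinear p hp
  nondegenerate := h.nondegenerate p hp
  fst u v := (h.holomorphic.flatForm_lagrangian h.tube h.extends_form hp u v).1
  snd u v := (h.holomorphic.flatForm_lagrangian h.tube h.extends_form hp u v).2

/-- The derivative of a form at a point, in the preferred chart at that point. -/
def formDeriv (Ω : CForm E N) (p : N × N) : E × E →L[ℝ] E × E →L[ℝ] E × E →L[ℝ] ℂ :=
  fderiv ℝ (formRep (𝓘(ℝ, E).prod 𝓘(ℝ, E)) Ω p) (extChartAt (𝓘(ℝ, E).prod 𝓘(ℝ, E)) p p)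

theorem IsKahlerExtensionOn.contDiffAt (h : IsKahlerExtensionOn k U Ω) (hp : p ∈ U) :
    ContDiffAt ℝ ∞ (formRep (𝓘(ℝ, E).prod 𝓘(ℝ, E)) Ω p)
      (extChartAt (𝓘(ℝ, E).prod 𝓘(ℝ, E)) p p) :=
  h.holomorphic.contDiffAt h.tube.isOpen (mem_extChartAt_target p) (by rwa [extChartAt_to_inv])

theorem IsKahlerExtensionOn.differentiableAt (h : IsKahlerExtensionOn k U Ω) (hp : p ∈ U) :
    DifferentiableAt ℝ (formRep (𝓘(ℝ, E).prod 𝓘(ℝ, E)) Ω p)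
      (extChartAt (𝓘(ℝ, E).prod 𝓘(ℝ, E)) p p) :=
  (h.contDiffAt hp).differentiableAt (by simp)

theorem eventually_mem_chart_preimage (hU : IsOpen U) (hp : p ∈ U) :
    ∀ᶠ z in 𝓝 (extChartAt (𝓘(ℝ, E).prod 𝓘(ℝ, E)) p p),
      z ∈ (extChartAt (𝓘(ℝ, E).prod 𝓘(ℝ, E)) p).target ∧
        (extChartAt (𝓘(ℝ, E).prod 𝓘(ℝ, E)) p).symm z ∈ U :=
  (isOpen_chart_preimage (E := E) hU p).mem_nhds
    ⟨mem_extChartAt_target p, by rwa [mem_preimage, extChartAt_to_inv]⟩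

theorem IsKahlerExtensionOn.formDeriv_eq_zero (h : IsKahlerExtensionOn k U Ω) (hp : p ∈ U)
    {u v : E × E} (huv : ∀ᶠ z in 𝓝 (extChartAt (𝓘(ℝ, E).prod 𝓘(ℝ, E)) p p),
      formRep (𝓘(ℝ, E).prod 𝓘(ℝ, E)) Ω p z u v = 0) (w : E × E) : formDeriv Ω p w u v = 0 := by
  have e : (fun z ↦ formRep (𝓘(ℝ, E).prod 𝓘(ℝ, E)) Ω p z u v) =ᶠ[𝓝
    (extChartAt (𝓘(ℝ, E).prod 𝓘(ℝ, E)) p p)] fun _ ↦ (0 : ℂ) := huv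
  rw [formDeriv, ← fderiv_clm_apply_apply (h.differentiableAt hp), e.fderiv_eq, fderiv_fun_const]
  rfl

/-- The Lagrangian conditions hold in a neighbourhood, so they may be differentiated in the chart,
whose frames respect the product splitting. -/
theorem IsKahlerExtensionOn.isLagrangianDeriv (h : IsKahlerExtensionOn k U Ω) (hp : p ∈ U) :
    IsLagrangianDeriv (formDeriv Ω p) := by
  have hD := h.holomorphic.fderiv_formRep_apply h.tube.isOpen
    (mem_extChartAt_target (I := 𝓘(ℝ, E).prod 𝓘(ℝ, E)) p) (by rwa [extChartAt_to_inv])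
  have hev := eventually_mem_chart_preimage (E := E) h.tube.isOpen hp
  refine ⟨fun u v w ↦ (hD u v w).2.1, fun u v w ↦ (hD u v w).2.2, fun w u v ↦ ?_, fun w u v ↦ ?_,
    h.holomorphic.cyclicDeriv_eq_zero h.tube h.extends_form hp⟩
  · refine h.formDeriv_eq_zero hp ?_ w
    filter_upwards [hev] with z hz
    exact formRep_fst (fun p hp ↦ (h.isLagrangianForm hp).fst) hz.1 hz.2 u v
  · refine h.formDeriv_eq_zero hp ?_ w
    filter_upwards [hev] with z hz
    exact formRep_snd (fun p hp ↦ (h.isLagrangianForm hp).snd) hz.1 hz.2 u v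

/-- The Christoffel symbols of the bi-Lagrangian connection at a point, in the preferred chart. -/
def biLagrangianChristoffel (Ω : CForm E N) (p : N × N) : E × E →L[ℝ] E × E →L[ℝ] E × E :=
  christoffel (flatForm Ω p) (formDeriv Ω p)

theorem chartFrame_modelF {p q : N × N} (hq : q ∈ (chartAt (ModelProd E E) p).source) (u : E × E) :
    chartFrame (𝓘(ℝ, E).prod 𝓘(ℝ, E)) p q (modelF E u) =
      paraF E q (chartFrame (𝓘(ℝ, E).prod 𝓘(ℝ, E)) p q u) := by
  rw [chartFrame_prod hq, chartFrame_prod hq, modelF_apply]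
  simp only [map_neg]
  rfl

theorem formRep_biLagrangianMetric {z : E × E}
    (hz : z ∈ (extChartAt (𝓘(ℝ, E).prod 𝓘(ℝ, E)) p).target) (u v : E × E) :
    formRep (𝓘(ℝ, E).prod 𝓘(ℝ, E)) (biLagrangianMetric Ω) p z u v =
      formRep (𝓘(ℝ, E).prod 𝓘(ℝ, E)) Ω p z (modelF E u) v := by
  rw [formRep_apply, formRep_apply, chartFrame_modelF (extChartAt_symm_mem_source hz)]
  rfl

theorem IsKahlerExtensionOn.differentiableAt_metric (h : IsKahlerExtensionOn k U Ω) (hp : p ∈ U) :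
    DifferentiableAt ℝ (formRep (𝓘(ℝ, E).prod 𝓘(ℝ, E)) (biLagrangianMetric Ω) p)
      (extChartAt (𝓘(ℝ, E).prod 𝓘(ℝ, E)) p p) ∧ ∀ u v w : E × E,
    fderiv ℝ (formRep (𝓘(ℝ, E).prod 𝓘(ℝ, E)) (biLagrangianMetric Ω) p)
      (extChartAt (𝓘(ℝ, E).prod 𝓘(ℝ, E)) p p) u v w = formDeriv Ω p u (modelF E v) w := by
  have h1 : DifferentiableAt ℝ (fun z ↦ (formRep (𝓘(ℝ, E).prod 𝓘(ℝ, E)) Ω p z).comp (modelF E))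
      (extChartAt (𝓘(ℝ, E).prod 𝓘(ℝ, E)) p p) :=
    (h.differentiableAt hp).clm_comp (differentiableAt_const _)
  have e : formRep (𝓘(ℝ, E).prod 𝓘(ℝ, E)) (biLagrangianMetric Ω) p
      =ᶠ[𝓝 (extChartAt (𝓘(ℝ, E).prod 𝓘(ℝ, E)) p p)]
      fun z ↦ (formRep (𝓘(ℝ, E).prod 𝓘(ℝ, E)) Ω p z).comp (modelF E) := by
    filter_upwards [eventually_mem_chart_preimage (E := E) h.tube.isOpen hp] with z hz
    exact ContinuousLinearMap.ext fun u ↦ ContinuousLinearMap.ext fun v ↦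
      formRep_biLagrangianMetric hz.1 u v
  refine ⟨h1.congr_of_eventuallyEq e, fun u v w ↦ ?_⟩
  rw [e.fderiv_eq, ← fderiv_clm_apply_apply h1, formDeriv,
    ← fderiv_clm_apply_apply (h.differentiableAt hp)]
  rfl

theorem formRep_flatForm (Ω : CForm E N) (p : N × N) (u v : E × E) :
    formRep (𝓘(ℝ, E).prod 𝓘(ℝ, E)) Ω p (extChartAt (𝓘(ℝ, E).prod 𝓘(ℝ, E)) p p) u v =
      flatForm Ω p u v := formRep_center (I := 𝓘(ℝ, E).prod 𝓘(ℝ, E)) Ω p u v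

theorem IsKahlerExtensionOn.isComplexBiLagrangianConnectionOn (h : IsKahlerExtensionOn k U Ω) :
    IsComplexBiLagrangianConnectionOn U Ω
      (chartConnection (I := 𝓘(ℝ, E).prod 𝓘(ℝ, E)) (biLagrangianChristoffel Ω)) := by
  have : FiniteDimensional ℝ E := FiniteDimensional.complexToReal E
  refine isLeviCivitaOn_chartConnection (fun p hp u v ↦ christoffel_comm (h.isLagrangianForm hp)
    (h.isLagrangianDeriv hp) u v) (fun p hp ↦ (h.differentiableAt_metric hp).1)
    fun p hp u v w ↦ ?_
  rw [(h.differentiableAt_metric hp).2, formRep_biLagrangianMetric (mem_extChartAt_target p),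
    formRep_biLagrangianMetric (mem_extChartAt_target p), formRep_flatForm, formRep_flatForm,
    biLagrangianChristoffel, ← christoffel_modelF (h.isLagrangianForm hp) (h.isLagrangianDeriv hp)]
  exact deriv_eq_christoffel (h.isLagrangianForm hp) (h.isLagrangianDeriv hp) u _ w

theorem IsKahlerExtensionOn.formDeriv_eq (h : IsKahlerExtensionOn k U Ω) (hp : p ∈ U)
    (u v w : E × E) : formDeriv Ω p u v w = flatForm Ω p (biLagrangianChristoffel Ω p u v) w +
      flatForm Ω p v (biLagrangianChristoffel Ω p u w) := by
  have : FiniteDimensional ℝ E := FiniteDimensional.complexToReal E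
  exact deriv_eq_christoffel (h.isLagrangianForm hp) (h.isLagrangianDeriv hp) u v w

end Connection

/-! ### The canonical quadruple: smoothness, quaternion relations and admissibility. -/

section CanonicalQuadruple

set_option synthInstance.maxHeartbeats 400000
set_option linter.unusedSectionVars false

open Filter Topology

theorem contDiffAt_clm_of_apply {X F G : Type*} [NormedAddCommGroup X] [NormedSpace ℝ X]
    [NormedAddCommGroup F] [NormedSpace ℝ F] [NormedAddCommGroup G] [NormedSpace ℝ G]
    [FiniteDimensional ℝ F] {n : WithTop ℕ∞} {f : X → F →L[ℝ] G} {z : X}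
    (h : ∀ y, ContDiffAt ℝ n (fun x ↦ f x y) z) : ContDiffAt ℝ n f z := by
  let d := Module.finrank ℝ F
  have hd : d = Module.finrank ℝ (Fin d → ℝ) := (Module.finrank_fin_fun ℝ).symm
  let e₁ := ContinuousLinearEquiv.ofFinrankEq hd
  let e₂ := (e₁.arrowCongr (1 : G ≃L[ℝ] G)).trans (ContinuousLinearEquiv.piRing (Fin d))
  rw [← Function.id_comp f, ← e₂.symm_comp_self]
  exact e₂.symm.contDiff.contDiffAt.comp z (contDiffAt_pi.mpr fun i ↦ h _)

variable {E : Type*} [NormedAddCommGroup E] [NormedSpace ℂ E]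
  {N : Type*} [TopologicalSpace N] [ChartedSpace E N] [IsManifold 𝓘(ℂ, E) ω N]
  {U : Set (N × N)} {Ω : CForm E N} {k : AnalyticKahlerStructure E N} {p : N × N}

/-- The isomorphism from the second to the first factor of the tangent space of `N × N` at `p`
determined by the Kähler metric and the form `Ω`. -/
def transferAt (k : AnalyticKahlerStructure E N) (Ω : CForm E N) (p : N × N) : E →L[ℝ] E :=
  transfer (k.flatInner p.1) (flatForm Ω p)

/-- The canonical quadruple determined by the Kähler structure and its holomorphic extension. -/
def canonicalQuadruple (k : AnalyticKahlerStructure E N) (Ω : CForm E N) : TensorQuadruple E N where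
  g p := pairMetric (k.flatInner p.1) (transferAt k Ω p)
  I p := pairI (transferAt k Ω p)
  J p := Jc E p
  K p := pairK (transferAt k Ω p)

theorem transfer_congr [FiniteDimensional ℝ E] {g' : E →L[ℝ] E →L[ℝ] ℝ}
    (hg' : IsHermitianMetric g') {β' : E × E →L[ℝ] E × E →L[ℝ] ℂ} {B : E →L[ℝ] E}
    (h : ∀ u v, g' (B v) u = 2 * (β' (u, 0) (0, v)).im) :
    transfer g' β' = B :=
  ContinuousLinearMap.ext fun v ↦ hg'.eq_of_forall fun u ↦ by rw [h, transfer_apply hg']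

theorem contDiffAt_transfer [FiniteDimensional ℝ E] {X : Type*} [NormedAddCommGroup X]
    [NormedSpace ℝ X] {n : WithTop ℕ∞}
    {g : X → E →L[ℝ] E →L[ℝ] ℝ} {β : X → E × E →L[ℝ] E × E →L[ℝ] ℂ} {x : X}
    (hg : ContDiffAt ℝ n g x) (hβ : ContDiffAt ℝ n β x) (hherm : IsHermitianMetric (g x)) :
    ContDiffAt ℝ n (fun x ↦ transfer (g x) (β x)) x := by
  have hinv : (g x).IsInvertible := isInvertible_of_nondegenerate fun u hu ↦
    hherm.eq_of_forall fun w ↦ by rw [hu, map_zero]; rfl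
  refine (hinv.contDiffAt_map_inverse.comp x hg).clm_comp ?_
  refine contDiffAt_clm_of_apply fun v ↦ contDiffAt_clm_of_apply fun u ↦ ?_
  exact contDiffAt_const.mul (Complex.imCLM.contDiff.contDiffAt.comp x
    ((hβ.clm_apply contDiffAt_const).clm_apply contDiffAt_const))

theorem contDiffAt_pairMetric [FiniteDimensional ℝ E] {X : Type*} [NormedAddCommGroup X]
    [NormedSpace ℝ X] {n : WithTop ℕ∞}
    {g : X → E →L[ℝ] E →L[ℝ] ℝ} {B : X → E →L[ℝ] E} {x : X}
    (hg : ContDiffAt ℝ n g x) (hB : ContDiffAt ℝ n B x) :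
    ContDiffAt ℝ n (fun x ↦ pairMetric (g x) (B x)) x := by
  refine contDiffAt_clm_of_apply fun a ↦ contDiffAt_clm_of_apply fun b ↦ ?_
  exact contDiffAt_const.mul (((hg.clm_apply contDiffAt_const).clm_apply contDiffAt_const).add
    ((hg.clm_apply (hB.clm_apply contDiffAt_const)).clm_apply (hB.clm_apply contDiffAt_const)))

theorem IsHermitianMetric.comp {g : E →L[ℝ] E →L[ℝ] ℝ} (hg : IsHermitianMetric g) {f : E →L[ℝ] E}
    (hf : ∀ u, f (Complex.I • u) = Complex.I • f u) (hinj : ∀ u, f u = 0 → u = 0) :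
    IsHermitianMetric (g.bilinearComp f f) where
  symm u v := hg.symm _ _
  pos u hu := hg.pos _ fun h ↦ hu (hinj u h)
  I_I u v := by
    rw [ContinuousLinearMap.bilinearComp_apply, hf, hf, hg.I_I]; rfl

theorem isHermitianMetric_formRep {x : N} {z : E} (hz : z ∈ (extChartAt 𝓘(ℝ, E) x).target) :
    IsHermitianMetric (formRep 𝓘(ℝ, E) k.metric.inner x z) :=
  IsHermitianMetric.comp (k.isHermitianMetric _)
    (fun u ↦ chartFrame_I_smul (extChartAt_symm_mem_source hz) u) fun u hu ↦ by
      rw [← chartCoframe_chartFrame (I := 𝓘(ℝ, E)) (extChartAt_symm_mem_source hz) u]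
      exact (congrArg _ hu).trans (map_zero _)

variable [FiniteDimensional ℂ E]

/-- The construction of `B` is natural under isomorphisms of the two factors: its representative in
a product chart is the `transfer` of the representatives of `g₀` and `Ω`. Smoothness of the metric
follows. -/
theorem formRep_canonicalQuadruple_g {z : E × E}
    (hz : z ∈ (extChartAt (𝓘(ℝ, E).prod 𝓘(ℝ, E)) p).target) :
    formRep (𝓘(ℝ, E).prod 𝓘(ℝ, E)) (canonicalQuadruple k Ω).g p z =
      pairMetric (formRep 𝓘(ℝ, E) k.metric.inner p.1 z.1)
        (transfer (formRep 𝓘(ℝ, E) k.metric.inner p.1 z.1)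
          (formRep (𝓘(ℝ, E).prod 𝓘(ℝ, E)) Ω p z)) := by
  have : FiniteDimensional ℝ E := FiniteDimensional.complexToReal E
  obtain ⟨z₁, z₂⟩ := z
  have hz1 : z₁ ∈ (extChartAt 𝓘(ℝ, E) p.1).target := by
    rw [extChartAt_prod] at hz; exact hz.1
  have hs := extChartAt_symm_mem_source hz
  have hs1 := extChartAt_symm_mem_source hz1
  set q := (extChartAt (𝓘(ℝ, E).prod 𝓘(ℝ, E)) p).symm (z₁, z₂) with hq
  let f₁ : E →L[ℝ] E := chartFrame 𝓘(ℝ, E) p.1 q.1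
  let f₂ : E →L[ℝ] E := chartFrame 𝓘(ℝ, E) p.2 q.2
  let c₁ : E →L[ℝ] E := chartCoframe 𝓘(ℝ, E) p.1 q.1
  have hfc : ∀ u, f₁ (c₁ u) = u := fun u ↦ chartFrame_chartCoframe (I := 𝓘(ℝ, E)) hs1 u
  have hg : ∀ u v, formRep 𝓘(ℝ, E) k.metric.inner p.1 z₁ u v =
    k.flatInner q.1 (f₁ u) (f₁ v) := fun u v ↦ rfl
  have hΩ : ∀ u v, formRep (𝓘(ℝ, E).prod 𝓘(ℝ, E)) Ω p (z₁, z₂) u v =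
      flatForm Ω q (f₁ u.1, f₂ u.2) (f₁ v.1, f₂ v.2) := fun u v ↦ by
    rw [formRep_apply, chartFrame_prod hs, chartFrame_prod hs]; rfl
  have hB : transfer (formRep 𝓘(ℝ, E) k.metric.inner p.1 z₁)
      (formRep (𝓘(ℝ, E).prod 𝓘(ℝ, E)) Ω p (z₁, z₂)) = c₁.comp ((transferAt k Ω q).comp f₂) := by
    refine transfer_congr (isHermitianMetric_formRep hz1) fun u v ↦ ?_
    rw [hg, hΩ, ContinuousLinearMap.comp_apply, hfc, ContinuousLinearMap.comp_apply, transferAt,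
      transfer_apply (k.isHermitianMetric _), map_zero, map_zero]
  rw [hB]
  refine ContinuousLinearMap.ext fun a ↦ ContinuousLinearMap.ext fun b ↦ ?_
  rw [pairMetric_apply, hg, hg]
  simp only [ContinuousLinearMap.comp_apply, hfc]
  rw [formRep_apply, chartFrame_prod hs, chartFrame_prod hs]
  rfl

theorem IsKahlerExtensionOn.contDiffAt_g (h : IsKahlerExtensionOn k U Ω) (hp : p ∈ U) :
    ContDiffAt ℝ ∞ (formRep (𝓘(ℝ, E).prod 𝓘(ℝ, E)) (canonicalQuadruple k Ω).g p)
      (extChartAt (𝓘(ℝ, E).prod 𝓘(ℝ, E)) p p) := by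
  have : FiniteDimensional ℝ E := FiniteDimensional.complexToReal E
  have h1 : ContDiffAt ℝ ∞ (fun z : E × E ↦ formRep 𝓘(ℝ, E) k.metric.inner p.1 z.1)
      (extChartAt (𝓘(ℝ, E).prod 𝓘(ℝ, E)) p p) :=
    ((k.contDiffAt_formRep p.1).of_le le_top).comp (f := Prod.fst)
      (extChartAt (𝓘(ℝ, E).prod 𝓘(ℝ, E)) p p) contDiffAt_fst
  refine (contDiffAt_pairMetric h1 (contDiffAt_transfer h1 (h.contDiffAt hp)
    (isHermitianMetric_formRep (mem_extChartAt_target p.1)))).congr_of_eventuallyEq ?_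
  filter_upwards [(isOpen_extChartAt_target p).mem_nhds (mem_extChartAt_target p)] with z hz
  exact formRep_canonicalQuadruple_g hz

theorem IsKahlerExtensionOn.nondegenerate_g (h : IsKahlerExtensionOn k U Ω) (hp : p ∈ U)
    (u : TC E p) (hu : ∀ v, (canonicalQuadruple k Ω).g p u v = 0) : u = 0 := by
  have : FiniteDimensional ℝ E := FiniteDimensional.complexToReal E
  by_contra hne
  exact (pairMetric_pos (k.isHermitianMetric p.1) (h.isLagrangianForm hp) u hne).ne' (hu u)

/-- The composition of a form with a linear map of the coefficients. -/
def formComp {V : Type*} [NormedAddCommGroup V] [NormedSpace ℝ V] (L : ℂ →L[ℝ] V) (Ω : CForm E N)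
    (p : N × N) : TC E p →L[ℝ] TC E p →L[ℝ] V :=
  (ContinuousLinearMap.compL ℝ (E × E) ℂ V L).comp (flatForm Ω p)

theorem contDiffAt_formComp {V : Type*} [NormedAddCommGroup V] [NormedSpace ℝ V] {L : ℂ →L[ℝ] V}
    {n : WithTop ℕ∞} {z : E × E} (h : ContDiffAt ℝ n (formRep (𝓘(ℝ, E).prod 𝓘(ℝ, E)) Ω p) z) :
    ContDiffAt ℝ n (formRep (𝓘(ℝ, E).prod 𝓘(ℝ, E)) (formComp L Ω) p) z := by
  have : FiniteDimensional ℝ E := FiniteDimensional.complexToReal E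
  exact contDiffAt_clm_of_apply fun a ↦ contDiffAt_clm_of_apply fun b ↦
    L.contDiff.contDiffAt.comp z ((h.clm_apply contDiffAt_const).clm_apply contDiffAt_const)

/-- A constant linear map of the values commutes with differentiation, so it preserves `∇Ω = 0`. The
maps used later are `Re`, `-Im`, the identity and multiplication by `i`. -/
theorem IsKahlerExtensionOn.isParallelFormAlong_formComp {V : Type*} [NormedAddCommGroup V]
    [NormedSpace ℝ V] (h : IsKahlerExtensionOn k U Ω) (L : ℂ →L[ℝ] V)
    (D : Π q : N × N, Set (TC E q)) :
    IsParallelFormAlong (𝓘(ℝ, E).prod 𝓘(ℝ, E))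
      (chartConnection (I := 𝓘(ℝ, E).prod 𝓘(ℝ, E)) (biLagrangianChristoffel Ω)) D U
      (formComp L Ω) := by
  have hd : ∀ p ∈ U, DifferentiableAt ℝ (formRep (𝓘(ℝ, E).prod 𝓘(ℝ, E)) (formComp L Ω) p)
      (extChartAt (𝓘(ℝ, E).prod 𝓘(ℝ, E)) p p) := fun p hp ↦
    (contDiffAt_formComp (h.contDiffAt hp)).differentiableAt (by simp)
  refine isParallelFormAlong_chartConnection hd fun p hp u _ v w ↦ ?_
  have h1 : HasFDerivAt (fun z ↦ formRep (𝓘(ℝ, E).prod 𝓘(ℝ, E)) Ω p z v w) _ _ :=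
    (((h.differentiableAt hp).clm_apply (differentiableAt_const v)).clm_apply
      (differentiableAt_const w)).hasFDerivAt
  have h2 := L.hasFDerivAt.comp (extChartAt (𝓘(ℝ, E).prod 𝓘(ℝ, E)) p p) h1
  rw [← fderiv_clm_apply_apply (hd p hp)]
  refine (congrArg (fun T : E × E →L[ℝ] V ↦ T u) h2.fderiv).trans ?_
  rw [ContinuousLinearMap.comp_apply, fderiv_clm_apply_apply (h.differentiableAt hp)]
  refine (congrArg L (h.formDeriv_eq hp u v w)).trans ?_
  rw [map_add, ← formRep_flatForm, ← formRep_flatForm]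
  rfl

theorem endRep_Jc {z : E × E} (hz : z ∈ (extChartAt (𝓘(ℝ, E).prod 𝓘(ℝ, E)) p).target) :
    endRep (𝓘(ℝ, E).prod 𝓘(ℝ, E)) (Jc E (N := N)) p z = modelJ E := by
  have hs := extChartAt_symm_mem_source hz
  refine ContinuousLinearMap.ext fun u ↦ ?_
  rw [endRep, ContinuousLinearMap.comp_apply, ContinuousLinearMap.comp_apply,
    ← chartFrame_modelJ hs, chartCoframe_chartFrame hs]

theorem contDiffAt_endRep_Jc (p : N × N) : ContDiffAt ℝ ∞
    (endRep (𝓘(ℝ, E).prod 𝓘(ℝ, E)) (Jc E (N := N)) p)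
    (extChartAt (𝓘(ℝ, E).prod 𝓘(ℝ, E)) p p) := by
  refine (contDiffAt_const (c := modelJ E)).congr_of_eventuallyEq ?_
  filter_upwards [(isOpen_extChartAt_target p).mem_nhds (mem_extChartAt_target p)] with z hz
  exact endRep_Jc hz

theorem IsKahlerExtensionOn.form_I (h : IsKahlerExtensionOn k U Ω) (hp : p ∈ U) (u v : TC E p) :
    formComp Complex.reCLM Ω p u v =
      (canonicalQuadruple k Ω).g p ((canonicalQuadruple k Ω).I p u) v := by
  have : FiniteDimensional ℝ E := FiniteDimensional.complexToReal E
  exact (pairMetric_pairI (k.isHermitianMetric p.1) (h.isLagrangianForm hp) u v).symm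

theorem IsKahlerExtensionOn.form_K (h : IsKahlerExtensionOn k U Ω) (hp : p ∈ U) (u v : TC E p) :
    formComp (-Complex.imCLM) Ω p u v =
      (canonicalQuadruple k Ω).g p ((canonicalQuadruple k Ω).K p u) v := by
  have : FiniteDimensional ℝ E := FiniteDimensional.complexToReal E
  exact (pairMetric_pairK (k.isHermitianMetric p.1) (h.isLagrangianForm hp) u v).symm

theorem IsKahlerExtensionOn.contDiffAt_I (h : IsKahlerExtensionOn k U Ω) (hp : p ∈ U) :
    ContDiffAt ℝ ∞ (endRep (𝓘(ℝ, E).prod 𝓘(ℝ, E)) (canonicalQuadruple k Ω).I p)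
      (extChartAt (𝓘(ℝ, E).prod 𝓘(ℝ, E)) p p) := by
  have : FiniteDimensional ℝ E := FiniteDimensional.complexToReal E
  exact contDiffAt_endRep_of_form h.tube.isOpen hp (h.contDiffAt_g hp)
    (contDiffAt_formComp (h.contDiffAt hp)) (fun q hq ↦ h.nondegenerate_g hq) fun q hq ↦ h.form_I hq

theorem IsKahlerExtensionOn.contDiffAt_K (h : IsKahlerExtensionOn k U Ω) (hp : p ∈ U) :
    ContDiffAt ℝ ∞ (endRep (𝓘(ℝ, E).prod 𝓘(ℝ, E)) (canonicalQuadruple k Ω).K p)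
      (extChartAt (𝓘(ℝ, E).prod 𝓘(ℝ, E)) p p) := by
  have : FiniteDimensional ℝ E := FiniteDimensional.complexToReal E
  exact contDiffAt_endRep_of_form h.tube.isOpen hp (h.contDiffAt_g hp)
    (contDiffAt_formComp (h.contDiffAt hp)) (fun q hq ↦ h.nondegenerate_g hq) fun q hq ↦ h.form_K hq

theorem IsKahlerExtensionOn.isAlmostHyperHermitianOn (h : IsKahlerExtensionOn k U Ω) :
    TensorQuadruple.IsAlmostHyperHermitianOn U (canonicalQuadruple k Ω) := by
  have : FiniteDimensional ℝ E := FiniteDimensional.complexToReal E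
  have hg := fun p : N × N ↦ k.isHermitianMetric p.1
  have hβ := fun p hp ↦ h.isLagrangianForm (p := p) hp
  exact
  { smooth_g := fun p hp ↦ ((contMDiffAt_form_iff _).2 (h.contDiffAt_g hp)).contMDiffWithinAt
    smooth_I := fun p hp ↦ ((contMDiffAt_end_iff _).2 (h.contDiffAt_I hp)).contMDiffWithinAt
    smooth_J := fun p hp ↦ ((contMDiffAt_end_iff _).2 (contDiffAt_endRep_Jc p)).contMDiffWithinAt
    smooth_K := fun p hp ↦ ((contMDiffAt_end_iff _).2 (h.contDiffAt_K hp)).contMDiffWithinAt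
    symm := fun p hp u v ↦ pairMetric_symm (hg p) u v
    pos := fun p hp u hu ↦ pairMetric_pos (hg p) (hβ p hp) u hu
    sq_I := fun p hp u ↦ pairI_pairI (hg p) (hβ p hp) u
    sq_J := fun p hp u ↦ modelJ_modelJ (E := E) u
    sq_K := fun p hp u ↦ pairK_pairK (hg p) (hβ p hp) u
    mul_IJ := fun p hp u ↦ pairI_modelJ (hg p) (hβ p hp) u
    mul_JI := fun p hp u ↦ modelJ_pairI (E := E) u
    orth_I := fun p hp u v ↦ pairMetric_pairI_pairI (hg p) (hβ p hp) u v
    orth_J := fun p hp u v ↦ pairMetric_modelJ (hg p) (hβ p hp) u v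
    orth_K := fun p hp u v ↦ pairMetric_pairK_pairK (hg p) (hβ p hp) u v }

theorem IsKahlerExtensionOn.transferAt_diagonal (h : IsKahlerExtensionOn k U Ω) (x : N) :
    transferAt k Ω (x, x) = ContinuousLinearMap.id ℝ E := by
  have : FiniteDimensional ℝ E := FiniteDimensional.complexToReal E
  exact transfer_eq_id (k.isHermitianMetric x) fun u v ↦
    (h.holomorphic.flatForm_diagonal h.extends_form (h.tube.diagonal_mem x) u v).2.2

theorem IsKahlerExtensionOn.isAdmissibleOn (h : IsKahlerExtensionOn k U Ω) :
    TensorQuadruple.IsAdmissibleOn k U Ω (canonicalQuadruple k Ω) := by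
  have hI : ∀ (x : N) (u : TangentSpace 𝓘(ℝ, E) x),
      (canonicalQuadruple k Ω).I (x, x) (pairT u u) = pairT (I₀ x u) (I₀ x u) := fun x u ↦ by
    have h1 : ∀ u : E, pairI (transferAt k Ω (x, x)) (u, u) =
        (Complex.I • u, Complex.I • u) := fun u ↦ by
      rw [pairI_apply, h.transferAt_diagonal, ContinuousLinearMap.inverse_id]; rfl
    exact h1 u
  have hg : ∀ (x : N) (u v : TangentSpace 𝓘(ℝ, E) x),
      (canonicalQuadruple k Ω).g (x, x) (pairT u u) (pairT v v) = k.metric.inner x u v :=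
      fun x u v ↦ by
    have h1 : ∀ u v : E, pairMetric (k.flatInner x) (transferAt k Ω (x, x)) (u, u) (v, v) =
        k.flatInner x u v := fun u v ↦ by
      rw [pairMetric_apply, h.transferAt_diagonal]
      simp only [ContinuousLinearMap.id_apply]
      ring
    exact h1 u v
  refine ⟨fun p hp ↦ rfl, hg, hI, fun x u v ↦ ?_, fun p hp u v ↦ ?_⟩
  · rw [hI, hg]; rfl
  · rw [← h.form_I hp, ← h.form_K hp]
    have h1 : ∀ c : ℂ, (c.re : ℂ) - Complex.I * ((-c.im : ℝ) : ℂ) = c := fun c ↦ by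
      apply Complex.ext <;> simp
    exact h1 (Ω p u v)

end CanonicalQuadruple

/-! ### The canonical quadruple is parallel along the vertical foliation. -/

section Parallel

set_option synthInstance.maxHeartbeats 400000
set_option linter.unusedSectionVars false

open Filter Topology

variable {E : Type*} [NormedAddCommGroup E] [NormedSpace ℂ E] [FiniteDimensional ℂ E]
  {N : Type*} [TopologicalSpace N] [ChartedSpace E N] [IsManifold 𝓘(ℂ, E) ω N]
  {U : Set (N × N)} {Ω : CForm E N} {k : AnalyticKahlerStructure E N} {p : N × N}

theorem IsKahlerExtensionOn.christoffel_vertical (h : IsKahlerExtensionOn k U Ω) (hp : p ∈ U)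
    (w : E) (b : E × E) : (biLagrangianChristoffel Ω p (0, w) b).1 = 0 ∧
      biLagrangianChristoffel Ω p (0, w) b = biLagrangianChristoffel Ω p (0, w) (0, b.2) := by
  have : FiniteDimensional ℝ E := FiniteDimensional.complexToReal E
  refine ⟨fst_christoffel_vertical (h.isLagrangianForm hp) (h.isLagrangianDeriv hp) w b, ?_⟩
  have h1 : b = (b.1, 0) + (0, b.2) := by simp
  conv_lhs => rw [h1, map_add, biLagrangianChristoffel, christoffel_vertical_fst
    (h.isLagrangianForm hp) (h.isLagrangianDeriv hp), zero_add]
  rfl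

/-- Differentiate the identity defining `transfer` with `g` held fixed, as is the case along a
vertical leaf. -/
theorem apply_fderiv_transfer [FiniteDimensional ℝ E] {g : E →L[ℝ] E →L[ℝ] ℝ} (hg : IsHermitianMetric g)
    {β : E → E × E →L[ℝ] E × E →L[ℝ] ℂ} {D : E →L[ℝ] E × E →L[ℝ] E × E →L[ℝ] ℂ}
    {B' : E →L[ℝ] E →L[ℝ] E} {y : E} (hβ : HasFDerivAt β D y)
    (hB : HasFDerivAt (fun y ↦ transfer g (β y)) B' y) (u v w : E) :
    g (B' w v) u = 2 * (D w (u, 0) (0, v)).im := by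
  have e : (fun y ↦ g (transfer g (β y) v) u) = fun y ↦ 2 * (β y (u, 0) (0, v)).im := by
    ext y
    exact transfer_apply hg u v
  have hL := (g.flip u).hasFDerivAt.comp y (hB.clm_apply (hasFDerivAt_const v y))
  have hR := (Complex.imCLM.hasFDerivAt.comp y
    ((hβ.clm_apply (hasFDerivAt_const (u, 0) y)).clm_apply (hasFDerivAt_const (0, v) y))).const_mul 2
  have h2 := congrArg (fun T : E →L[ℝ] ℝ ↦ T w) (hL.unique (e ▸ hR))
  simpa using h2

theorem hasFDerivAt_pairMetric {g : E →L[ℝ] E →L[ℝ] ℝ} {B : E → E →L[ℝ] E}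
    {B' : E →L[ℝ] E →L[ℝ] E} {y : E} (hB : HasFDerivAt B B' y) (a b : E × E) :
    ∃ T : E →L[ℝ] ℝ, HasFDerivAt (fun y ↦ pairMetric g (B y) a b) T y ∧ ∀ w,
      T w = 2⁻¹ * (g (B' w a.2) (B y b.2) + g (B y a.2) (B' w b.2)) := by
  have h := (((g.hasFDerivAt.comp y (hB.clm_apply (hasFDerivAt_const a.2 _))).clm_apply
      (hB.clm_apply (hasFDerivAt_const b.2 _))).const_add (g a.1 b.1)).const_mul (2⁻¹ : ℝ)
  refine ⟨_, h, fun w ↦ ?_⟩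
  simp
  ring

theorem hasFDerivAt_slice (p : N × N) : HasFDerivAt (fun y : E ↦ (extChartAt 𝓘(ℝ, E) p.1 p.1, y))
    (ContinuousLinearMap.inr ℝ E E) (extChartAt 𝓘(ℝ, E) p.2 p.2) := hasFDerivAt_prodMk_right _ _

theorem formRep_inner_center (k : AnalyticKahlerStructure E N) (x : N) :
    formRep 𝓘(ℝ, E) k.metric.inner x (extChartAt 𝓘(ℝ, E) x x) = k.flatInner x :=
  ContinuousLinearMap.ext fun a ↦ ContinuousLinearMap.ext fun b ↦ formRep_center k.metric.inner x a b

theorem formRep_form_center (Ω : CForm E N) (p : N × N) :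
    formRep (𝓘(ℝ, E).prod 𝓘(ℝ, E)) Ω p
      (extChartAt 𝓘(ℝ, E) p.1 p.1, extChartAt 𝓘(ℝ, E) p.2 p.2) = flatForm Ω p :=
  ContinuousLinearMap.ext fun a ↦ ContinuousLinearMap.ext fun b ↦ formRep_flatForm Ω p a b

theorem IsKahlerExtensionOn.hasFDerivAt_formRep_slice (h : IsKahlerExtensionOn k U Ω) (hp : p ∈ U) :
    HasFDerivAt (fun y : E ↦ formRep (𝓘(ℝ, E).prod 𝓘(ℝ, E)) Ω p (extChartAt 𝓘(ℝ, E) p.1 p.1, y))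
      ((formDeriv Ω p).comp (ContinuousLinearMap.inr ℝ E E)) (extChartAt 𝓘(ℝ, E) p.2 p.2) := by
  have hΩ : HasFDerivAt (formRep (𝓘(ℝ, E).prod 𝓘(ℝ, E)) Ω p) (formDeriv Ω p)
    (extChartAt 𝓘(ℝ, E) p.1 p.1, extChartAt 𝓘(ℝ, E) p.2 p.2) := (h.differentiableAt hp).hasFDerivAt
  exact HasFDerivAt.comp (G := E × E →L[ℝ] E × E →L[ℝ] ℂ)
    (f := fun y : E ↦ (extChartAt 𝓘(ℝ, E) p.1 p.1, y)) _ hΩ (hasFDerivAt_slice p)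

/-- The local representative of the isomorphism `transferAt` on the vertical slice. -/
def transferSlice (k : AnalyticKahlerStructure E N) (Ω : CForm E N) (p : N × N) (y : E) : E →L[ℝ] E :=
  transfer (k.flatInner p.1) (formRep (𝓘(ℝ, E).prod 𝓘(ℝ, E)) Ω p (extChartAt 𝓘(ℝ, E) p.1 p.1, y))

theorem transferSlice_center (k : AnalyticKahlerStructure E N) (Ω : CForm E N) (p : N × N) :
    transferSlice k Ω p (extChartAt 𝓘(ℝ, E) p.2 p.2) = transferAt k Ω p := by
  rw [transferSlice, formRep_form_center, transferAt]

/-- The formula `B'(w) v = B Γ(w, v)` says that `B` is parallel along the leaf: `∇Ω = 0`, and the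
horizontal argument contributes no Christoffel term. -/
theorem IsKahlerExtensionOn.hasFDerivAt_transferSlice (h : IsKahlerExtensionOn k U Ω) (hp : p ∈ U) :
    ∃ B' : E →L[ℝ] E →L[ℝ] E, HasFDerivAt (transferSlice k Ω p) B'
      (extChartAt 𝓘(ℝ, E) p.2 p.2) ∧ ∀ w v : E, B' w v =
        transferAt k Ω p (biLagrangianChristoffel Ω p (0, w) (0, v)).2 := by
  have : FiniteDimensional ℝ E := FiniteDimensional.complexToReal E
  have hβ : ContDiffAt ℝ ∞ (fun y : E ↦ formRep (𝓘(ℝ, E).prod 𝓘(ℝ, E)) Ω p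
      (extChartAt 𝓘(ℝ, E) p.1 p.1, y)) (extChartAt 𝓘(ℝ, E) p.2 p.2) :=
    ContDiffAt.comp (f := fun y : E ↦ (extChartAt 𝓘(ℝ, E) p.1 p.1, y)) _
      (h.contDiffAt hp) (contDiffAt_const.prodMk contDiffAt_id)
  have hB : HasFDerivAt (transferSlice k Ω p) _ _ := ((contDiffAt_transfer contDiffAt_const hβ
    (k.isHermitianMetric p.1)).differentiableAt (by simp)).hasFDerivAt
  refine ⟨_, hB, fun w v ↦ (k.isHermitianMetric p.1).eq_of_forall fun u ↦ ?_⟩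
  rw [apply_fderiv_transfer (k.isHermitianMetric p.1) (h.hasFDerivAt_formRep_slice hp) hB]
  have h4 := h.christoffel_vertical hp w
  have h5 : biLagrangianChristoffel Ω p (0, w) (0, v) =
      (0, (biLagrangianChristoffel Ω p (0, w) (0, v)).2) := Prod.ext (h4 _).1 rfl
  have h6 : formDeriv Ω p (0, w) (u, 0) (0, v) =
      flatForm Ω p (u, 0) (0, (biLagrangianChristoffel Ω p (0, w) (0, v)).2) := by
    rw [h.formDeriv_eq hp, (h4 (u, 0)).2, ← h5]
    have : ((0, ((u, 0) : E × E).2) : E × E) = 0 := rfl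
    rw [this, map_zero, map_zero]
    simp
  rw [transferAt, transfer_apply (k.isHermitianMetric p.1), ← h6]
  rfl

theorem formRep_canonicalQuadruple_slice {y : E} (hy : y ∈ (extChartAt 𝓘(ℝ, E) p.2).target) :
    formRep (𝓘(ℝ, E).prod 𝓘(ℝ, E)) (canonicalQuadruple k Ω).g p (extChartAt 𝓘(ℝ, E) p.1 p.1, y) =
      pairMetric (k.flatInner p.1) (transferSlice k Ω p y) := by
  have hz : (extChartAt 𝓘(ℝ, E) p.1 p.1, y) ∈ (extChartAt (𝓘(ℝ, E).prod 𝓘(ℝ, E)) p).target := by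
    rw [extChartAt_prod]; exact ⟨mem_extChartAt_target p.1, hy⟩
  rw [formRep_canonicalQuadruple_g hz, transferSlice, formRep_inner_center]

/-- On a vertical slice the term `g₀(a₁, b₁)` is constant, and the term with `B` varies exactly as
the vertical Christoffel symbols prescribe. -/
theorem IsKahlerExtensionOn.isParallel_g (h : IsKahlerExtensionOn k U Ω) :
    IsParallelFormAlong (𝓘(ℝ, E).prod 𝓘(ℝ, E))
      (chartConnection (I := 𝓘(ℝ, E).prod 𝓘(ℝ, E)) (biLagrangianChristoffel Ω))
      (verticalDist E) U (canonicalQuadruple k Ω).g := by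
  have hd : ∀ p ∈ U, DifferentiableAt ℝ (formRep (𝓘(ℝ, E).prod 𝓘(ℝ, E)) (canonicalQuadruple k Ω).g p)
      (extChartAt (𝓘(ℝ, E).prod 𝓘(ℝ, E)) p p) := fun p hp ↦
    (h.contDiffAt_g hp).differentiableAt (by simp)
  refine isParallelFormAlong_chartConnection hd fun p hp u hu a b ↦ ?_
  obtain ⟨w, rfl⟩ : ∃ w : E, u = (0, w) := hu
  obtain ⟨B', hB', hB⟩ := h.hasFDerivAt_transferSlice hp
  obtain ⟨T, hT, hTw⟩ := hasFDerivAt_pairMetric (g := k.flatInner p.1) hB' a b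
  have hc : ∀ a b, formRep (𝓘(ℝ, E).prod 𝓘(ℝ, E)) (canonicalQuadruple k Ω).g p
      (extChartAt (𝓘(ℝ, E).prod 𝓘(ℝ, E)) p p) a b =
      pairMetric (k.flatInner p.1) (transferAt k Ω p) a b := fun a b ↦ formRep_center
        (I := 𝓘(ℝ, E).prod 𝓘(ℝ, E)) (canonicalQuadruple k Ω).g p a b
  have hL := HasFDerivAt.comp (f := fun y : E ↦ (extChartAt 𝓘(ℝ, E) p.1 p.1, y))
    (g := fun z ↦ formRep (𝓘(ℝ, E).prod 𝓘(ℝ, E)) (canonicalQuadruple k Ω).g p z a b)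
    (extChartAt 𝓘(ℝ, E) p.2 p.2) (((hd p hp).clm_apply (differentiableAt_const a)).clm_apply
      (differentiableAt_const b)).hasFDerivAt (hasFDerivAt_slice p)
  have e : (fun z ↦ formRep (𝓘(ℝ, E).prod 𝓘(ℝ, E)) (canonicalQuadruple k Ω).g p z a b) ∘
      (fun y : E ↦ (extChartAt 𝓘(ℝ, E) p.1 p.1, y)) =ᶠ[𝓝 (extChartAt 𝓘(ℝ, E) p.2 p.2)]
      fun y ↦ pairMetric (k.flatInner p.1) (transferSlice k Ω p y) a b := by
    filter_upwards [(isOpen_extChartAt_target p.2).mem_nhds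
      (mem_extChartAt_target (I := 𝓘(ℝ, E)) p.2)] with y hy
    rw [Function.comp_apply, formRep_canonicalQuadruple_slice hy]
  have h2 := congrArg (fun T : E →L[ℝ] ℝ ↦ T w) (hL.unique (hT.congr_of_eventuallyEq e))
  have h3 : fderiv ℝ (formRep (𝓘(ℝ, E).prod 𝓘(ℝ, E)) (canonicalQuadruple k Ω).g p)
      (extChartAt (𝓘(ℝ, E).prod 𝓘(ℝ, E)) p p) (0, w) a b = T w := by
    rw [← fderiv_clm_apply_apply (hd p hp)]
    exact h2
  have h4 := h.christoffel_vertical hp w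
  rw [h3, hTw, hB, hB, transferSlice_center, hc, hc, pairMetric_apply, pairMetric_apply, (h4 a).1,
    (h4 b).1, ← (h4 a).2, ← (h4 b).2]
  simp
  ring

theorem IsKahlerExtensionOn.isParallelAlongVerticalOn (h : IsKahlerExtensionOn k U Ω) :
    TensorQuadruple.IsParallelAlongVerticalOn U
      (chartConnection (I := 𝓘(ℝ, E).prod 𝓘(ℝ, E)) (biLagrangianChristoffel Ω))
      (canonicalQuadruple k Ω) where
  g := h.isParallel_g
  I := isParallelEndAlong_of_isParallelFormAlong h.tube.isOpen h.isParallel_g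
    (h.isParallelFormAlong_formComp Complex.reCLM _) (fun p hp ↦ h.nondegenerate_g hp)
    (fun p hp ↦ h.form_I hp) fun p hp Y hY ↦
      fieldDiffAt_end_apply ((h.contDiffAt_I hp).differentiableAt (by simp)) hY
  J := by
    -- Here `J` is the quotient of the parallel forms `iΩ` and `Ω`.
    refine isParallelEndAlong_of_isParallelFormAlong h.tube.isOpen
      (h.isParallelFormAlong_formComp (ContinuousLinearMap.id ℝ ℂ) _)
      (h.isParallelFormAlong_formComp (Complex.I • ContinuousLinearMap.id ℝ ℂ) _) h.nondegenerate
      (fun p hp u v ↦ (h.holomorphic.complexLinear p hp u v).symm) fun p hp Y hY ↦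
        fieldDiffAt_end_apply ((contDiffAt_endRep_Jc p).differentiableAt (by simp)) hY
  K := isParallelEndAlong_of_isParallelFormAlong h.tube.isOpen h.isParallel_g
    (h.isParallelFormAlong_formComp (-Complex.imCLM) _) (fun p hp ↦ h.nondegenerate_g hp)
    (fun p hp ↦ h.form_K hp) fun p hp Y hY ↦
      fieldDiffAt_end_apply ((h.contDiffAt_K hp).differentiableAt (by simp)) hY

theorem IsKahlerExtensionOn.isCanonicalOn (h : IsKahlerExtensionOn k U Ω) :
    (canonicalQuadruple k Ω).IsCanonicalOn k U :=
  ⟨Ω, _, h.holomorphic.isComplexBiLagrangianOn h.tube h.extends_form h.nondegenerate,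
    h.extends_form, h.isComplexBiLagrangianConnectionOn, h.isAlmostHyperHermitianOn,
    h.isAdmissibleOn, h.isParallelAlongVerticalOn⟩

end Parallel

/-! ### Uniqueness of the canonical quadruple on a connected tube. -/

section Uniqueness

set_option synthInstance.maxHeartbeats 400000
set_option linter.unusedSectionVars false

open Filter Topology

/-- The uniqueness half of the fundamental lemma of Riemannian geometry: the difference tensor is
symmetric in its first two arguments and skew in its last two, hence zero. -/
theorem eq_of_symm_of_metric {F : Type*} [AddCommGroup F] [Module ℝ F] {b : F →ₗ[ℝ] F →ₗ[ℝ] ℂ}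
    (hsymm : ∀ u v, b u v = b v u) (hnd : ∀ u, (∀ v, b u v = 0) → u = 0) {Γ Γ' : F → F → F}
    (h : ∀ u v, Γ u v = Γ v u) (h' : ∀ u v, Γ' u v = Γ' v u)
    (heq : ∀ u v w, b (Γ u v) w + b v (Γ u w) = b (Γ' u v) w + b v (Γ' u w)) (u v : F) :
    Γ u v = Γ' u v := by
  let T : F → F → F → ℂ := fun u v w ↦ b (Γ u v) w - b (Γ' u v) w
  have h1 : ∀ u v w, T u v w = T v u w := fun u v w ↦ by simp only [T, h u v, h' u v]
  have h2 : ∀ u v w, T u v w = - T u w v := fun u v w ↦ by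
    have := heq u v w
    rw [hsymm v, hsymm v] at this
    simp only [T]
    linear_combination this
  refine sub_eq_zero.1 (hnd _ fun w ↦ ?_)
  have h3 : T u v w = - T u v w := by
    linear_combination h1 u v w + h2 v u w - h1 v w u - h2 w v u + h1 w u v + h2 u w v
  rw [map_sub, LinearMap.sub_apply]
  exact self_eq_neg.1 h3

/-- The derivative is assumed zero only at the centre of each point's own chart; coordinate changes
carry this to a whole ball in one chart, so the function is locally constant. -/
theorem eq_of_hasFDerivAt_chart {E H N G : Type*} [NormedAddCommGroup E] [NormedSpace ℝ E]
    [TopologicalSpace H] {I : ModelWithCorners ℝ E H} [I.Boundaryless] [TopologicalSpace N]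
    [ChartedSpace H N] [IsManifold I ω N] [NormedAddCommGroup G] [NormedSpace ℝ G] {f : N → G}
    {s : Set N} (hs : IsOpen s) (hc : IsPreconnected s)
    (hf : ∀ y ∈ s, HasFDerivAt (f ∘ (extChartAt I y).symm) (0 : E →L[ℝ] G) (extChartAt I y y))
    {x y : N} (hx : x ∈ s) (hy : y ∈ s) : f x = f y := by
  refine hc.induction₂ (fun x y ↦ f x = f y) (fun x hx ↦ ?_) (fun _ _ _ _ _ _ ↦ Eq.trans)
    (fun _ _ _ _ ↦ Eq.symm) hx hy
  refine Filter.Eventually.filter_mono nhdsWithin_le_nhds ?_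
  have hmem : (extChartAt I x).target ∩ (extChartAt I x).symm ⁻¹' s ∈ 𝓝 (extChartAt I x x) :=
    inter_mem ((isOpen_extChartAt_target x).mem_nhds (mem_extChartAt_target x))
      ((continuousAt_extChartAt_symm x).preimage_mem_nhds (by
        rw [extChartAt_to_inv]; exact hs.mem_nhds hx))
  obtain ⟨r, hr, hball⟩ := Metric.mem_nhds_iff.1 hmem
  have hd : ∀ z ∈ Metric.ball (extChartAt I x x) r,
      HasFDerivAt (f ∘ (extChartAt I x).symm) (0 : E →L[ℝ] G) z := fun z hz ↦ by
    obtain ⟨hzt, hzs⟩ := hball hz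
    have hsrc := extChartAt_symm_mem_source hzt
    have h1 := hasFDerivAt_coordChange (I := I) hsrc (mem_chart_source H _)
    rw [(extChartAt I x).right_inv hzt] at h1
    have h2 : HasFDerivAt (f ∘ (extChartAt I ((extChartAt I x).symm z)).symm) (0 : E →L[ℝ] G)
        ((extChartAt I ((extChartAt I x).symm z) ∘ (extChartAt I x).symm) z) := hf _ hzs
    have h3 := h2.comp z h1
    rw [ContinuousLinearMap.zero_comp] at h3
    refine h3.congr_of_eventuallyEq ?_
    filter_upwards [(continuousAt_extChartAt_symm'' hzt).preimage_mem_nhds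
      (extChartAt_source_mem_nhds (I := I) ((extChartAt I x).symm z))] with w hw
    exact congrArg f (PartialEquiv.left_inv _ hw).symm
  filter_upwards [(continuousAt_extChartAt (I := I) x).preimage_mem_nhds (Metric.ball_mem_nhds _ hr),
    extChartAt_source_mem_nhds (I := I) x] with y hy hys
  have h4 := Metric.isOpen_ball.is_const_of_fderiv_eq_zero (convex_ball _ _).isPreconnected
    (fun z hz ↦ (hd z hz).differentiableAt.differentiableWithinAt) (fun z hz ↦ (hd z hz).fderiv)
    (Metric.mem_ball_self hr) hy
  simpa only [Function.comp_apply, extChartAt_to_inv, (extChartAt I x).left_inv hys] using h4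

theorem hasFDerivAt_bilin_slice {X E : Type*} [NormedAddCommGroup X] [NormedSpace ℝ X]
    [NormedAddCommGroup E] [NormedSpace ℝ E] {G : X → E × E →L[ℝ] E × E →L[ℝ] ℝ}
    {G' : X →L[ℝ] E × E →L[ℝ] E × E →L[ℝ] ℝ} {a b : X → E} {a' b' : X →L[ℝ] E} {y : X}
    (hG : HasFDerivAt G G' y) (ha : HasFDerivAt a a' y) (hb : HasFDerivAt b b' y) (c d : E) :
    ∃ T : X →L[ℝ] ℝ, HasFDerivAt (fun z ↦ G z (c, a z) (d, b z)) T y ∧ ∀ w,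
      T w = G' w (c, a y) (d, b y) + G y (0, a' w) (d, b y) + G y (c, a y) (0, b' w) := by
  have h := (hG.clm_apply ((hasFDerivAt_const c y).prodMk ha)).clm_apply
    ((hasFDerivAt_const d y).prodMk hb)
  refine ⟨_, h, fun w ↦ ?_⟩
  simp
  ring

variable {E : Type*} [NormedAddCommGroup E] [NormedSpace ℂ E] [FiniteDimensional ℂ E]
  {N : Type*} [TopologicalSpace N] [ChartedSpace E N] [IsManifold 𝓘(ℂ, E) ω N]
  {U : Set (N × N)} {Ω : CForm E N} {k : AnalyticKahlerStructure E N} {p : N × N}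
  {cov : (Π q : N × N, TC E q) → (Π q : N × N, TC E q →L[ℝ] TC E q)}
  {S : TensorQuadruple E N}

/-- Any bi-Lagrangian connection is torsion-free and preserves the symmetric nondegenerate form
`Ω(F·,·)`, so its Christoffel symbols are the explicit ones. -/
theorem IsKahlerExtensionOn.cov_constField (h : IsKahlerExtensionOn k U Ω) (hp : p ∈ U)
    (hcov : IsComplexBiLagrangianConnectionOn U Ω cov) (u v : E × E) :
    cov (constField (𝓘(ℝ, E).prod 𝓘(ℝ, E)) p v) p u = biLagrangianChristoffel Ω p u v := by
  have : FiniteDimensional ℝ E := FiniteDimensional.complexToReal E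
  have hβ := h.isLagrangianForm hp
  have hD := h.isLagrangianDeriv hp
  have hF : ∀ u v, flatForm Ω p (modelF E u) v = - flatForm Ω p u (modelF E v) := fun u v ↦ by
    rw [hβ.apply_eq, hβ.apply_eq u]
    have e1 : ((-u.1, 0) : E × E) = -(u.1, 0) := by simp
    have e2 : ((-v.1, 0) : E × E) = -(v.1, 0) := by simp
    simp only [modelF_apply, e1, e2, map_neg, neg_apply]
    ring
  have hFF : ∀ u, modelF E (modelF E u) = u := fun u ↦ by simp [modelF_apply]
  let b : E × E →ₗ[ℝ] E × E →ₗ[ℝ] ℂ := LinearMap.mk₂ ℝ (fun u v ↦ flatForm Ω p (modelF E u) v)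
    (fun _ _ _ ↦ by simp only [map_add, add_apply]) (fun _ _ _ ↦ by simp only [map_smul, smul_apply])
    (fun _ _ _ ↦ by simp only [map_add]) (fun _ _ _ ↦ by simp only [map_smul])
  have key := (h.differentiableAt_metric hp)
  refine eq_of_symm_of_metric (b := b)
    (Γ := fun u v ↦ cov (constField (𝓘(ℝ, E).prod 𝓘(ℝ, E)) p v) p u)
    (Γ' := fun u v ↦ biLagrangianChristoffel Ω p u v)
    (fun u v ↦ ?_) (fun u hu ↦ ?_) (fun u v ↦ christoffel_symm hcov hp v u)
    (fun u v ↦ christoffel_comm hβ hD u v) (fun u v w ↦ ?_) u v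
  · exact (hF u v).trans (hβ.neg_swap _ _).symm |>.trans rfl
  · have := hβ.nondegenerate (modelF E u) hu
    rw [← hFF u, this, map_zero]
  · let c : E × E → E × E := fun v ↦ cov (constField (𝓘(ℝ, E).prod 𝓘(ℝ, E)) p v) p u
    have h1 : fderiv ℝ (formRep (𝓘(ℝ, E).prod 𝓘(ℝ, E)) (biLagrangianMetric Ω) p)
        (extChartAt (𝓘(ℝ, E).prod 𝓘(ℝ, E)) p p) u v w =
        formRep (𝓘(ℝ, E).prod 𝓘(ℝ, E)) (biLagrangianMetric Ω) p
          (extChartAt (𝓘(ℝ, E).prod 𝓘(ℝ, E)) p p) (c v) w +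
        formRep (𝓘(ℝ, E).prod 𝓘(ℝ, E)) (biLagrangianMetric Ω) p
          (extChartAt (𝓘(ℝ, E).prod 𝓘(ℝ, E)) p p) v (c w) :=
      fderiv_formRep_of_isParallelFormAlong hcov.metric hp key.1 (mem_univ _) v w
    rw [key.2, formRep_biLagrangianMetric (mem_extChartAt_target p),
      formRep_biLagrangianMetric (mem_extChartAt_target p), formRep_flatForm, formRep_flatForm,
      h.formDeriv_eq hp] at h1
    have h2 : biLagrangianChristoffel Ω p u (modelF E v) =
      modelF E (biLagrangianChristoffel Ω p u v) := christoffel_modelF hβ hD u v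
    rw [h2] at h1
    exact h1.symm

/-- The metric of a quadruple at a point, as a bilinear form on the model space. -/
def TensorQuadruple.flatG (S : TensorQuadruple E N) (p : N × N) : E × E →L[ℝ] E × E →L[ℝ] ℝ := S.g p

/-- The metric is `g₀` on diagonal vectors, and by `J`-orthogonality also on their images under `J`.
The two spaces are orthogonal and together span the tangent space. -/
theorem TensorQuadruple.flatG_diagonal (hS : S.IsAlmostHyperHermitianOn U)
    (hk : ExtendsKahlerForm k Ω) (hΩ : IsHolomorphicTwoFormOn U Ω)
    (had : S.IsAdmissibleOn k U Ω) {x : N} (hx : (x, x) ∈ U) (a b : E × E) :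
    S.flatG (x, x) a b = 2⁻¹ * (k.flatInner x a.1 b.1 + k.flatInner x a.2 b.2) := by
  have flat (G : E × E →L[ℝ] E × E →L[ℝ] ℝ) (g : E →L[ℝ] E →L[ℝ] ℝ)
      (β : E × E →L[ℝ] E × E →L[ℝ] ℂ) (hg : IsHermitianMetric g) (hsymm : ∀ a b, G a b = G b a)
      (hJ : ∀ a b, G (modelJ E a) (modelJ E b) = G a b) (hG : ∀ u v, G (u, u) (v, v) = g u v)
      (hβJ : ∀ a b, β a (modelJ E b) = Complex.I * β a b)
      (hβ : ∀ u v, (β (u, u) (v, v)).im = 0)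
      (hI : ∀ u b, G (Complex.I • u, Complex.I • u) b = (β (u, u) b).re) (a b : E × E) :
      G a b = 2⁻¹ * (g a.1 b.1 + g a.2 b.2) := by
    -- Since `(u, u)` is the image under `I` of the diagonal vector of `-iu`, this value is the real
    -- part of `i Ω` on diagonal vectors, where `Ω` is real.
    have h1 : ∀ u v, G (u, u) (modelJ E (v, v)) = 0 := fun u v ↦ by
      have h2 := hI (-(Complex.I • u)) (modelJ E (v, v))
      rw [smul_neg, smul_smul, Complex.I_mul_I, neg_one_smul, neg_neg, hβJ] at h2
      rw [h2]
      simp [hβ]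
    obtain ⟨c, d, rfl⟩ := eq_diagonal_add_modelJ a
    obtain ⟨c', d', rfl⟩ := eq_diagonal_add_modelJ b
    simp only [map_add, add_apply, h1, hJ, hG, hsymm (modelJ E (d, d)) (c', c')]
    simp only [modelJ_apply, Prod.fst_add, Prod.snd_add, map_add, add_apply, map_neg, neg_apply, hg.I_I]
    ring
  have hcf := fun u v ↦ congrArg Complex.re (had.complexForm _ hx u v)
  refine flat (S.g (x, x)) (k.flatInner x) (Ω (x, x)) (k.isHermitianMetric x) (hS.symm _ hx)
    (fun a b ↦ ?_) (had.extends_g x) (hΩ.complexLinear_right hx) (fun u v ↦ ?_) (fun u b ↦ ?_) a b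
  · have := hS.orth_J _ hx a b
    rw [had.almostComplex _ hx] at this
    exact this
  · exact (congrArg Complex.im (hk x u v)).trans (Complex.ofReal_im _)
  · have h1 : ∀ c, S.I (x, x) (pairT u u) = c → S.g (x, x) c b = (Ω (x, x) (pairT u u) b).re := by
      rintro _ rfl
      refine Eq.trans ?_ (hcf (pairT u u) b)
      simp
    exact h1 _ (had.extends_I x u)

theorem formRep_slice {V : Type*} [NormedAddCommGroup V] [NormedSpace ℝ V]
    (b : Π q : N × N, TC E q →L[ℝ] TC E q →L[ℝ] V) {x y₀ : N} {z : E}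
    (hz : z ∈ (extChartAt 𝓘(ℝ, E) y₀).target) (u v : E × E) :
    formRep (𝓘(ℝ, E).prod 𝓘(ℝ, E)) b (x, y₀) (extChartAt 𝓘(ℝ, E) x x, z) u v =
      b (x, (extChartAt 𝓘(ℝ, E) y₀).symm z)
        (pairT u.1 (chartFrame 𝓘(ℝ, E) y₀ ((extChartAt 𝓘(ℝ, E) y₀).symm z) u.2))
        (pairT v.1 (chartFrame 𝓘(ℝ, E) y₀ ((extChartAt 𝓘(ℝ, E) y₀).symm z) v.2)) := by
  have hz' : (x, (extChartAt 𝓘(ℝ, E) y₀).symm z) ∈ (chartAt (ModelProd E E) (x, y₀)).source :=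
    mem_chartAt_prod_source.2 ⟨mem_chart_source E x, extChartAt_symm_mem_source hz⟩
  have h1 : (extChartAt 𝓘(ℝ, E) x x, z) = extChartAt (𝓘(ℝ, E).prod 𝓘(ℝ, E)) (x, y₀)
      (x, (extChartAt 𝓘(ℝ, E) y₀).symm z) := by
    rw [extChartAt_prod]
    exact Prod.ext rfl ((extChartAt 𝓘(ℝ, E) y₀).right_inv hz).symm
  rw [h1, formRep_extChartAt _ hz', chartFrame_prod hz', chartFrame_prod hz']
  exact congrArg₂ (fun u' v' : E ↦ b (x, (extChartAt 𝓘(ℝ, E) y₀).symm z)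
    (pairT u' (chartFrame 𝓘(ℝ, E) y₀ ((extChartAt 𝓘(ℝ, E) y₀).symm z) u.2))
    (pairT v' (chartFrame 𝓘(ℝ, E) y₀ ((extChartAt 𝓘(ℝ, E) y₀).symm z) v.2)))
    (chartFrame_self (I := 𝓘(ℝ, E)) x u.1) (chartFrame_self (I := 𝓘(ℝ, E)) x v.1)

/-- The frame of the preferred chart at `y₀`, as an endomorphism of the model space. -/
def flatFrame (y₀ y : N) : E →L[ℝ] E := chartFrame 𝓘(ℝ, E) y₀ y

theorem transferSlice_eq {x y₀ : N} {z : E} (hz : z ∈ (extChartAt 𝓘(ℝ, E) y₀).target) :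
    transferSlice k Ω (x, y₀) z = (transferAt k Ω (x, (extChartAt 𝓘(ℝ, E) y₀).symm z)).comp
      (flatFrame y₀ ((extChartAt 𝓘(ℝ, E) y₀).symm z)) := by
  have : FiniteDimensional ℝ E := FiniteDimensional.complexToReal E
  refine transfer_congr (k.isHermitianMetric x) fun u v ↦ ?_
  rw [ContinuousLinearMap.comp_apply, transferAt, transfer_apply (k.isHermitianMetric x),
    formRep_slice Ω hz, map_zero]
  rfl

/-- Differentiate `B (B⁻¹ c) = c` and cancel the injective `B`: the vertical field `B⁻¹ c` is
parallel along the leaf. -/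
theorem IsKahlerExtensionOn.hasFDerivAt_inverse_transferSlice (h : IsKahlerExtensionOn k U Ω)
    (hp : p ∈ U) (c : E) : ∃ a' : E →L[ℝ] E,
      HasFDerivAt (fun z ↦ (transferSlice k Ω p z).inverse c) a' (extChartAt 𝓘(ℝ, E) p.2 p.2) ∧
      ∀ w, a' w = -(biLagrangianChristoffel Ω p (0, w) (0, (transferAt k Ω p).inverse c)).2 := by
  have : FiniteDimensional ℝ E := FiniteDimensional.complexToReal E
  have hinv : (transferSlice k Ω p (extChartAt 𝓘(ℝ, E) p.2 p.2)).IsInvertible := by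
    rw [transferSlice_center]
    exact isInvertible_transfer (k.isHermitianMetric p.1) (h.isLagrangianForm hp)
  obtain ⟨B', hB', hB⟩ := h.hasFDerivAt_transferSlice hp
  have ha := ((hinv.contDiffAt_map_inverse (n := 1)).differentiableAt one_ne_zero).hasFDerivAt.comp
    _ hB' |>.clm_apply (hasFDerivAt_const c _)
  refine ⟨_, ha, fun w ↦ ?_⟩
  have h1 := hB'.clm_apply ha
  obtain ⟨e, he⟩ := hinv
  have h2 : (fun z ↦ transferSlice k Ω p z ((transferSlice k Ω p z).inverse c))
      =ᶠ[𝓝 (extChartAt 𝓘(ℝ, E) p.2 p.2)] fun _ ↦ c := by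
    filter_upwards [hB'.continuousAt.preimage_mem_nhds (he ▸ e.nhds)] with z hz
    exact ContinuousLinearMap.IsInvertible.self_apply_inverse hz c
  have h3 := congrArg (fun T : E →L[ℝ] E ↦ T w)
    (h1.unique ((hasFDerivAt_const c _).congr_of_eventuallyEq h2))
  have hinj : Function.Injective (transferAt k Ω p) := by
    rw [← transferSlice_center, ← he]; exact e.injective
  apply hinj
  rw [map_neg, ← hB, ← transferSlice_center]
  refine eq_neg_of_add_eq_zero_left ?_
  simpa using h3

/-- The metric of a quadruple, read in the frame of the second factor which the canonical metric
identifies with the first factor. -/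
def TensorQuadruple.transported (S : TensorQuadruple E N) (k : AnalyticKahlerStructure E N)
    (Ω : CForm E N) (c d : E × E) (p : N × N) : ℝ :=
  S.flatG p (c.1, (transferAt k Ω p).inverse c.2) (d.1, (transferAt k Ω p).inverse d.2)

/-- The vertical frame cancels between the representative of the metric and that of `B⁻¹`, so
`transported`, defined without charts, can be differentiated in any of them. -/
theorem IsKahlerExtensionOn.transported_slice (h : IsKahlerExtensionOn k U Ω) {x y₀ : N} {z : E}
    (hz : z ∈ (extChartAt 𝓘(ℝ, E) y₀).target) (hzU : (x, (extChartAt 𝓘(ℝ, E) y₀).symm z) ∈ U)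
    (c d : E × E) : S.transported k Ω c d (x, (extChartAt 𝓘(ℝ, E) y₀).symm z) =
      formRep (𝓘(ℝ, E).prod 𝓘(ℝ, E)) S.g (x, y₀) (extChartAt 𝓘(ℝ, E) x x, z)
        (c.1, (transferSlice k Ω (x, y₀) z).inverse c.2)
        (d.1, (transferSlice k Ω (x, y₀) z).inverse d.2) := by
  have : FiniteDimensional ℝ E := FiniteDimensional.complexToReal E
  rw [formRep_slice S.g hz]
  have hs := extChartAt_symm_mem_source hz
  set y := (extChartAt 𝓘(ℝ, E) y₀).symm z with hy
  let f : E →L[ℝ] E := chartFrame 𝓘(ℝ, E) y₀ y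
  let f' : E →L[ℝ] E := chartCoframe 𝓘(ℝ, E) y₀ y
  have hff' : ∀ u, f (f' u) = u := fun u ↦ chartFrame_chartCoframe (I := 𝓘(ℝ, E)) hs u
  have hf'f : ∀ u, f' (f u) = u := fun u ↦ chartCoframe_chartFrame (I := 𝓘(ℝ, E)) hs u
  let e : E ≃L[ℝ] E := ContinuousLinearEquiv.equivOfInverse f f' hf'f hff'
  have hB := isInvertible_transfer (k.isHermitianMetric x) (h.isLagrangianForm hzU)
  have key : ∀ c, f ((transferSlice k Ω (x, y₀) z).inverse c) = (transferAt k Ω (x, y)).inverse c := by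
    intro c
    rw [transferSlice_eq hz]
    change f (((transferAt k Ω (x, y)).comp (e : E →L[ℝ] E)).inverse c) = _
    rw [ContinuousLinearMap.inverse_comp_equiv]
    exact hff' _
  exact congrArg₂ (fun u v : E ↦ S.flatG (x, y) (c.1, u) (d.1, v)) (key c.2).symm (key d.2).symm

/-- The component of a parallel metric on the parallel fields `(c₁, B⁻¹c₂)` and `(d₁, B⁻¹d₂)` has
zero derivative: the Christoffel terms of the metric cancel against the derivatives of `B⁻¹c₂` and
`B⁻¹d₂`. -/
theorem IsKahlerExtensionOn.hasFDerivAt_transported (h : IsKahlerExtensionOn k U Ω)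
    (hcov : IsComplexBiLagrangianConnectionOn U Ω cov) (hS : S.IsAlmostHyperHermitianOn U)
    (hpar : S.IsParallelAlongVerticalOn U cov) {x y : N} (hp : (x, y) ∈ U) (c d : E × E) :
    HasFDerivAt ((fun y ↦ S.transported k Ω c d (x, y)) ∘ (extChartAt 𝓘(ℝ, E) y).symm)
      (0 : E →L[ℝ] ℝ) (extChartAt 𝓘(ℝ, E) y y) := by
  have hg : DifferentiableAt ℝ (formRep (𝓘(ℝ, E).prod 𝓘(ℝ, E)) S.g (x, y))
      (extChartAt (𝓘(ℝ, E).prod 𝓘(ℝ, E)) (x, y) (x, y)) :=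
    ((contMDiffAt_form_iff _).1 ((hS.smooth_g _ hp).contMDiffAt
      (h.tube.isOpen.mem_nhds hp))).differentiableAt (by simp)
  have hG := HasFDerivAt.comp (G := E × E →L[ℝ] E × E →L[ℝ] ℝ)
    (f := fun z : E ↦ (extChartAt 𝓘(ℝ, E) x x, z)) (extChartAt 𝓘(ℝ, E) y y)
    (show HasFDerivAt (formRep (𝓘(ℝ, E).prod 𝓘(ℝ, E)) S.g (x, y)) _
      (extChartAt 𝓘(ℝ, E) x x, extChartAt 𝓘(ℝ, E) y y) from hg.hasFDerivAt)
    (hasFDerivAt_slice (x, y))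
  obtain ⟨a', ha', ha⟩ := h.hasFDerivAt_inverse_transferSlice hp c.2
  obtain ⟨b', hb', hb⟩ := h.hasFDerivAt_inverse_transferSlice hp d.2
  obtain ⟨T, hT, hTw⟩ := hasFDerivAt_bilin_slice hG ha' hb' c.1 d.1
  have hc : Continuous fun y : N ↦ (x, y) := by fun_prop
  have e : (fun y ↦ S.transported k Ω c d (x, y)) ∘ (extChartAt 𝓘(ℝ, E) y).symm
      =ᶠ[𝓝 (extChartAt 𝓘(ℝ, E) y y)] fun z ↦ formRep (𝓘(ℝ, E).prod 𝓘(ℝ, E)) S.g (x, y)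
        (extChartAt 𝓘(ℝ, E) x x, z) (c.1, (transferSlice k Ω (x, y) z).inverse c.2)
        (d.1, (transferSlice k Ω (x, y) z).inverse d.2) := by
    filter_upwards [(isOpen_extChartAt_target y).mem_nhds (mem_extChartAt_target (I := 𝓘(ℝ, E)) y),
      (continuousAt_extChartAt_symm (I := 𝓘(ℝ, E)) y).preimage_mem_nhds (by
        rw [extChartAt_to_inv]; exact (h.tube.isOpen.preimage hc).mem_nhds hp)] with z hz hzU
    exact h.transported_slice hz hzU c d
  have hT0 : T = 0 := by
    refine ContinuousLinearMap.ext fun w ↦ ?_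
    have hΓ := fun v ↦ h.cov_constField hp hcov (0, w) v
    have key : ∀ u v : E × E, fderiv ℝ (formRep (𝓘(ℝ, E).prod 𝓘(ℝ, E)) S.g (x, y))
        (extChartAt (𝓘(ℝ, E).prod 𝓘(ℝ, E)) (x, y) (x, y)) (0, w) u v =
        formRep (𝓘(ℝ, E).prod 𝓘(ℝ, E)) S.g (x, y) (extChartAt (𝓘(ℝ, E).prod 𝓘(ℝ, E)) (x, y) (x, y))
          (biLagrangianChristoffel Ω (x, y) (0, w) u) v +
        formRep (𝓘(ℝ, E).prod 𝓘(ℝ, E)) S.g (x, y) (extChartAt (𝓘(ℝ, E).prod 𝓘(ℝ, E)) (x, y) (x, y))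
          u (biLagrangianChristoffel Ω (x, y) (0, w) v) := fun u v ↦ by
      rw [← hΓ u, ← hΓ v]
      exact fderiv_formRep_of_isParallelFormAlong hpar.g hp hg ⟨w, rfl⟩ u v
    have h4 : ∀ b, biLagrangianChristoffel Ω (x, y) (0, w) b =
        (0, (biLagrangianChristoffel Ω (x, y) (0, w) (0, b.2)).2) := fun b ↦ by
      rw [(h.christoffel_vertical hp w b).2]
      exact Prod.ext (h.christoffel_vertical hp w _).1 rfl
    have hneg : ∀ v : E, ((0, -v) : E × E) = -(0, v) := fun v ↦ by simp
    rw [hTw, ha, hb, transferSlice_center]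
    refine (congrArg₂ (· + ·) (congrArg₂ (· + ·) (key _ _) rfl) rfl).trans ?_
    rw [h4 (c.1, _), h4 (d.1, _), hneg, hneg]
    simp only [map_neg, neg_apply]
    have cancel : ∀ r s : ℝ, r + s + -r + -s = 0 := fun r s ↦ by ring
    exact cancel _ _
  exact (hT0 ▸ hT).congr_of_eventuallyEq e

theorem IsKahlerExtensionOn.flatG_eq (h : IsKahlerExtensionOn k U Ω)
    (hcov : IsComplexBiLagrangianConnectionOn U Ω cov) (hS : S.IsAlmostHyperHermitianOn U)
    (had : S.IsAdmissibleOn k U Ω) (hpar : S.IsParallelAlongVerticalOn U cov) (hp : p ∈ U) :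
    S.flatG p = pairMetric (k.flatInner p.1) (transferAt k Ω p) := by
  have : FiniteDimensional ℝ E := FiniteDimensional.complexToReal E
  obtain ⟨x, y⟩ := p
  have hc : Continuous fun y : N ↦ (x, y) := by fun_prop
  refine ContinuousLinearMap.ext fun a ↦ ContinuousLinearMap.ext fun b ↦ ?_
  have h1 : ∀ c d, S.transported k Ω c d (x, x) = S.transported k Ω c d (x, y) := fun c d ↦
    eq_of_hasFDerivAt_chart (I := 𝓘(ℝ, E)) (f := fun y ↦ S.transported k Ω c d (x, y))
      (h.tube.isOpen.preimage hc) (h.tube.isPreconnected x)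
      (fun y hy ↦ h.hasFDerivAt_transported hcov hS hpar hy c d) (h.tube.diagonal_mem x) hp
  -- The arguments are chosen so that `B⁻¹` returns `a.2` and `b.2` at `(x, y)`, while on the
  -- diagonal `B` is the identity.
  have h2 := h1 (a.1, transferAt k Ω (x, y) a.2) (b.1, transferAt k Ω (x, y) b.2)
  rw [TensorQuadruple.transported, TensorQuadruple.transported, h.transferAt_diagonal,
    ContinuousLinearMap.inverse_id, TensorQuadruple.flatG_diagonal hS h.extends_form h.holomorphic
    had (h.tube.diagonal_mem x)] at h2
  simp only [ContinuousLinearMap.id_apply, transferAt, transfer_inverse_transfer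
    (k.isHermitianMetric x) (h.isLagrangianForm hp)] at h2
  exact h2.symm

/-- Real and imaginary parts of `ω_I - iω_K = Ω` determine `g(I·,·)` and `g(K·,·)`, and the metric
is nondegenerate. -/
theorem TensorQuadruple.AgreeOn.of_g_eq {S' : TensorQuadruple E N}
    (hS : S.IsAlmostHyperHermitianOn U) (had : S.IsAdmissibleOn k U Ω)
    (had' : S'.IsAdmissibleOn k U Ω) (hg : ∀ p ∈ U, S.g p = S'.g p) : S.AgreeOn S' U := by
  intro p hp
  have hnd : ∀ u v : TC E p, (∀ w, S.g p u w = S.g p v w) → u = v := fun u v huv ↦ by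
    by_contra hne
    have h1 := hS.pos p hp (u - v) (sub_ne_zero.2 hne)
    have h2 : S.g p (u - v) (u - v) = S.g p u (u - v) - S.g p v (u - v) :=
      congrArg (fun T : TC E p →L[ℝ] ℝ ↦ T (u - v)) (map_sub (S.g p) u v)
    rw [h2, huv, sub_self] at h1
    exact h1.false
  have hcf : ∀ u w, S.g p (S.I p u) w = S.g p (S'.I p u) w ∧
      S.g p (S.K p u) w = S.g p (S'.K p u) w := fun u w ↦ by
    have h1 := (had.complexForm p hp u w).trans (had'.complexForm p hp u w).symm
    rw [← hg p hp] at h1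
    have h2 := congrArg Complex.re h1
    have h3 := congrArg Complex.im h1
    simp at h2 h3
    exact ⟨h2, h3⟩
  exact ⟨hg p hp, ContinuousLinearMap.ext fun u ↦ hnd _ _ fun w ↦ (hcf u w).1,
    (had.almostComplex p hp).trans (had'.almostComplex p hp).symm,
    ContinuousLinearMap.ext fun u ↦ hnd _ _ fun w ↦ (hcf u w).2⟩

theorem canonicalQuadruple_agreeOn {Ω' : CForm E N} (h : ∀ p ∈ U, Ω p = Ω' p) :
    (canonicalQuadruple k Ω).AgreeOn (canonicalQuadruple k Ω') U := by
  intro p hp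
  have ht : transferAt k Ω p = transferAt k Ω' p :=
    congrArg (transfer (k.flatInner p.1)) (h p hp)
  simp only [canonicalQuadruple, ht]
  exact ⟨rfl, rfl, trivial, rfl⟩

theorem TensorQuadruple.AgreeOn.trans {S₁ S₂ S₃ : TensorQuadruple E N} (h : S₁.AgreeOn S₂ U)
    (h' : S₂.AgreeOn S₃ U) : S₁.AgreeOn S₃ U := fun p hp ↦
  ⟨(h p hp).1.trans (h' p hp).1, (h p hp).2.1.trans (h' p hp).2.1,
    (h p hp).2.2.1.trans (h' p hp).2.2.1, (h p hp).2.2.2.trans (h' p hp).2.2.2⟩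

theorem TensorQuadruple.AgreeOn.symm {S₁ S₂ : TensorQuadruple E N} (h : S₁.AgreeOn S₂ U) :
    S₂.AgreeOn S₁ U := fun p hp ↦
  ⟨(h p hp).1.symm, (h p hp).2.1.symm, (h p hp).2.2.1.symm, (h p hp).2.2.2.symm⟩

theorem TensorQuadruple.IsCanonicalOn.exists_agreeOn (hU : IsConnectedTube U)
    (hS : S.IsCanonicalOn k U) :
    ∃ Ω, IsKahlerExtensionOn k U Ω ∧ S.AgreeOn (canonicalQuadruple k Ω) U := by
  obtain ⟨Ω, cov, hbl, hk, hcov, hH, had, hpar⟩ := hS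
  have h : IsKahlerExtensionOn k U Ω := ⟨hU, hbl.holomorphic, hbl.nondegenerate, hk⟩
  exact ⟨Ω, h, .of_g_eq hH had h.isAdmissibleOn fun p hp ↦ h.flatG_eq hcov hH had hpar hp⟩

theorem TensorQuadruple.IsCanonicalOn.agreeOn {S' : TensorQuadruple E N} (hU : IsConnectedTube U)
    (hS : S.IsCanonicalOn k U) (hS' : S'.IsCanonicalOn k U) : S.AgreeOn S' U := by
  obtain ⟨Ω, h, h1⟩ := hS.exists_agreeOn hU
  obtain ⟨Ω', h', h2⟩ := hS'.exists_agreeOn hU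
  exact (h1.trans (canonicalQuadruple_agreeOn fun p hp ↦ IsHolomorphicTwoFormOn.eqOn hU
    h.holomorphic h'.holomorphic h.extends_form h'.extends_form hp)).trans h2.symm

end Uniqueness

/-! ### Complexification of real power series. -/

section Complexification

open Filter Topology ENNReal NNReal

variable {E : Type*} [NormedAddCommGroup E] [NormedSpace ℝ E] {ι : Type*} [Fintype ι]

/-- The complexification of a formal power series, in the coordinates of a basis. -/
def FormalMultilinearSeries.complexification (p : FormalMultilinearSeries ℝ E ℂ)
    (b : Module.Basis ι ℝ E) : FormalMultilinearSeries ℂ (ι → ℂ) ℂ := fun n ↦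
  ∑ s : Fin n → ι, p n (fun i ↦ b (s i)) •
    (ContinuousMultilinearMap.mkPiAlgebra ℂ (Fin n) ℂ).compContinuousLinearMap
      fun i ↦ ContinuousLinearMap.proj (s i)

/-- Expand each argument in the basis; on real coordinate vectors the polynomial in the coordinates
returns the original term. -/
theorem FormalMultilinearSeries.complexification_apply (p : FormalMultilinearSeries ℝ E ℂ)
    (b : Module.Basis ι ℝ E) (n : ℕ) (y : E) :
    p.complexification b n (fun _ j ↦ (b.repr y j : ℂ)) = p n fun _ ↦ y := by
  classical
  conv_rhs => rw [← b.sum_repr y]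
  rw [ContinuousMultilinearMap.map_sum, complexification, sum_apply]
  refine Finset.sum_congr rfl fun s _ ↦ ?_
  rw [ContinuousMultilinearMap.map_smul_univ]
  simp [mul_comm]

/-- Each monomial in the coordinates has norm at most one for the sup norm, and summing the products
of `‖b (s i)‖` over all words `s` gives the `n`th power of `∑ j, ‖b j‖`. -/
theorem FormalMultilinearSeries.norm_complexification_le (p : FormalMultilinearSeries ℝ E ℂ)
    (b : Module.Basis ι ℝ E) (n : ℕ) :
    ‖p.complexification b n‖ ≤ ‖p n‖ * (∑ j, ‖b j‖) ^ n := by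
  classical
  have h1 : (∑ j, ‖b j‖) ^ n = ∑ s : Fin n → ι, ∏ i, ‖b (s i)‖ :=
    Fintype.sum_pow _ n
  rw [h1, Finset.mul_sum]
  refine (norm_sum_le _ _).trans (Finset.sum_le_sum fun s _ ↦ ?_)
  rw [norm_smul]
  refine (mul_le_of_le_one_right (norm_nonneg _) ?_).trans ((p n).le_opNorm _)
  refine (ContinuousMultilinearMap.norm_compContinuousLinearMap_le _ _).trans ?_
  rw [ContinuousMultilinearMap.norm_mkPiAlgebra, one_mul]
  refine Finset.prod_le_one (fun _ _ ↦ norm_nonneg _) fun i _ ↦ ?_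
  exact ContinuousLinearMap.opNorm_le_bound _ zero_le_one fun z ↦ by
    rw [one_mul]; exact norm_le_pi_norm z (s i)

theorem FormalMultilinearSeries.radius_complexification_pos (p : FormalMultilinearSeries ℝ E ℂ)
    (b : Module.Basis ι ℝ E) (hp : 0 < p.radius) : 0 < (p.complexification b).radius := by
  obtain ⟨r, hr0, hr⟩ := ENNReal.lt_iff_exists_nnreal_btwn.1 hp
  obtain ⟨C, hC, h⟩ := p.norm_mul_pow_le_of_lt_radius hr
  let D : ℝ≥0 := ∑ j, ‖b j‖₊ 
  have hD : (D : ℝ) = ∑ j, ‖b j‖ := by simp [D]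
  have hr0' : 0 < r := by exact_mod_cast hr0
  -- The factor `D ^ n` from the norm bound is absorbed by shrinking the radius; the `+ 1` avoids
  -- division by zero.
  have hρ : 0 < r / (D + 1) := by positivity
  refine lt_of_lt_of_le (ENNReal.coe_pos.2 hρ) (le_radius_of_bound _ C fun n ↦ ?_)
  refine (mul_le_mul_of_nonneg_right (p.norm_complexification_le b n) (by positivity)).trans ?_
  refine le_trans ?_ (h n)
  rw [mul_assoc, ← hD, ← mul_pow]
  refine mul_le_mul_of_nonneg_left (pow_le_pow_left₀ (by positivity) ?_ n) (norm_nonneg _)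
  push_cast
  rw [mul_div_assoc', div_le_iff₀ (by positivity)]
  have : (0 : ℝ) ≤ r := r.2
  nlinarith

/-- A real-analytic function extends to a holomorphic function of complexified coordinates. -/
theorem AnalyticAt.exists_complexification {f : E → ℂ} {x₀ : E} (hf : AnalyticAt ℝ f x₀)
    (b : Module.Basis ι ℝ E) : ∃ G : (ι → ℂ) → ℂ, (∀ᶠ w in 𝓝 0, DifferentiableAt ℂ G w) ∧
      ∀ᶠ x in 𝓝 x₀, G (fun j ↦ (b.repr (x - x₀) j : ℂ)) = f x := by
  obtain ⟨p, r, hp⟩ := hf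
  refine ⟨(p.complexification b).sum, ?_, ?_⟩
  · have h := (p.complexification b).hasFPowerSeriesOnBall
      (p.radius_complexification_pos b (hp.r_pos.trans_le hp.r_le))
    filter_upwards [Metric.eball_mem_nhds (0 : ι → ℂ) h.r_pos] with w hw
    exact (h.analyticAt_of_mem hw).differentiableAt
  · filter_upwards [Metric.eball_mem_nhds x₀ hp.r_pos] with x hx
    have h1 := hp.hasSum_sub hx
    rw [← h1.tsum_eq, FormalMultilinearSeries.sum]
    exact tsum_congr fun n ↦ p.complexification_apply b n (x - x₀)

end Complexification

/-! ### Holomorphic extension of a real-analytic 2-form on a vector space. -/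

section LocalExtension

set_option synthInstance.maxHeartbeats 400000
set_option linter.unusedSectionVars false

open Filter Topology

variable {E : Type*} [NormedAddCommGroup E] [NormedSpace ℂ E]

theorem jDiffAt_comp_of_complexLinear {W : Type*} [NormedAddCommGroup W] [NormedSpace ℂ W]
    {Φ : E × E →L[ℝ] W} (hΦ : ∀ u, Φ (modelJ E u) = Complex.I • Φ u) {G : W → ℂ} {c z : E × E}
    (hG : DifferentiableAt ℂ G (Φ (z - c))) : JDiffAt (fun z ↦ G (Φ (z - c))) z := by
  have h := (hG.hasFDerivAt.restrictScalars ℝ).comp z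
    (Φ.hasFDerivAt.comp z ((hasFDerivAt_id z).sub_const c))
  have h' : HasFDerivAt (fun z ↦ G (Φ (z - c))) _ z := h
  refine ⟨h'.differentiableAt, fun w ↦ ?_⟩
  rw [h'.fderiv]
  simp only [ContinuousLinearMap.comp_apply, ContinuousLinearMap.id_apply, hΦ]
  exact map_smul (fderiv ℂ G _) _ _

variable [FiniteDimensional ℝ E] {ι : Type*} [Fintype ι]

/-- A real coordinate of `E`, extended to a complex coordinate of `E × Ē`. -/
def complexifiedCoord (b : Module.Basis ι ℝ E) (j : ι) : E × E →L[ℝ] ℂ :=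
  let c : E →L[ℝ] ℝ := LinearMap.toContinuousLinearMap (b.coord j)
  (Complex.ofRealCLM.comp c).comp
      ((2⁻¹ : ℂ) • (ContinuousLinearMap.fst ℝ E E + ContinuousLinearMap.snd ℝ E E)) +
    (Complex.I • Complex.ofRealCLM.comp c).comp
      ((-(Complex.I * 2⁻¹) : ℂ) • (ContinuousLinearMap.fst ℝ E E - ContinuousLinearMap.snd ℝ E E))

theorem complexifiedCoord_apply (b : Module.Basis ι ℝ E) (j : ι) (u : E × E) :
    complexifiedCoord b j u = (b.repr ((2⁻¹ : ℂ) • (u.1 + u.2)) j : ℂ) +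
      Complex.I * (b.repr ((-(Complex.I * 2⁻¹) : ℂ) • (u.1 - u.2)) j : ℂ) := rfl

theorem complexifiedCoord_diagonal (b : Module.Basis ι ℝ E) (j : ι) (u : E) :
    complexifiedCoord b j (u, u) = (b.repr u j : ℂ) := by
  have h : (2⁻¹ : ℂ) • (u + u) = u := by module
  rw [complexifiedCoord_apply, h]
  simp

/-- Multiplication by `J` interchanges the two components of `u` along the diagonal and its
`J`-image, up to the sign that produces `i`. -/
theorem complexifiedCoord_modelJ (b : Module.Basis ι ℝ E) (j : ι) (u : E × E) :
    complexifiedCoord b j (modelJ E u) = Complex.I * complexifiedCoord b j u := by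
  have h1 : (2⁻¹ : ℂ) • ((modelJ E u).1 + (modelJ E u).2) =
      -((-(Complex.I * 2⁻¹) : ℂ) • (u.1 - u.2)) := by
    rw [modelJ_apply]; module
  have h2 : (-(Complex.I * 2⁻¹) : ℂ) • ((modelJ E u).1 - (modelJ E u).2) =
      (2⁻¹ : ℂ) • (u.1 + u.2) := by
    rw [modelJ_apply]
    match_scalars <;> ring_nf <;> simp [Complex.I_sq] <;> norm_num
  rw [complexifiedCoord_apply, complexifiedCoord_apply, h1, h2, map_neg, mul_add, ← mul_assoc,
    Complex.I_mul_I]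
  simp
  ring

/-- The alternating form `½ ∑ F i j φⁱ ∧ φʲ` in complexified coordinates. -/
def complexifiedForm (b : Module.Basis ι ℝ E) (F : ι → ι → ℂ) : E × E →L[ℝ] E × E →L[ℝ] ℂ :=
  ∑ i, ∑ j, ((2⁻¹ * F i j) • (complexifiedCoord b i).smulRight (complexifiedCoord b j) -
    (2⁻¹ * F i j) • (complexifiedCoord b j).smulRight (complexifiedCoord b i))

theorem complexifiedForm_apply (b : Module.Basis ι ℝ E) (F : ι → ι → ℂ) (u v : E × E) :
    complexifiedForm b F u v = ∑ i, ∑ j, F i j * (2⁻¹ *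
      (complexifiedCoord b i u * complexifiedCoord b j v -
        complexifiedCoord b j u * complexifiedCoord b i v)) := by
  simp only [complexifiedForm, sum_apply, sub_apply, smul_apply,
    ContinuousLinearMap.smulRight_apply, smul_eq_mul]
  refine Finset.sum_congr rfl fun i _ ↦ Finset.sum_congr rfl fun j _ ↦ ?_
  ring

theorem complexifiedForm_self (b : Module.Basis ι ℝ E) (F : ι → ι → ℂ) (u : E × E) :
    complexifiedForm b F u u = 0 := by
  rw [complexifiedForm_apply]
  refine Finset.sum_eq_zero fun i _ ↦ Finset.sum_eq_zero fun j _ ↦ ?_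
  ring

theorem complexifiedForm_modelJ (b : Module.Basis ι ℝ E) (F : ι → ι → ℂ) (u v : E × E) :
    complexifiedForm b F (modelJ E u) v = Complex.I * complexifiedForm b F u v := by
  simp only [complexifiedForm_apply, complexifiedCoord_modelJ, Finset.mul_sum]
  refine Finset.sum_congr rfl fun i _ ↦ Finset.sum_congr rfl fun j _ ↦ ?_
  ring

/-- On diagonal vectors the complexified coordinates are the real ones. The form is half the
antisymmetrization of the coordinate expansion, which returns a skew `α`. -/
theorem complexifiedForm_diagonal (b : Module.Basis ι ℝ E) {α : E →L[ℝ] E →L[ℝ] ℝ}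
    (hα : ∀ u v, α u v = - α v u) (u v : E) :
    complexifiedForm b (fun i j ↦ (α (b i) (b j) : ℂ)) (u, u) (v, v) = α u v := by
  have h : ∀ u v, ∑ i, ∑ j, α (b i) (b j) * (b.repr u i * b.repr v j) = α u v := fun u v ↦ by
    conv_rhs => rw [← b.sum_repr u, ← b.sum_repr v]
    simp only [map_sum, map_smul, sum_apply, smul_apply, smul_eq_mul, Finset.mul_sum]
    rw [Finset.sum_comm]
    refine Finset.sum_congr rfl fun i _ ↦ Finset.sum_congr rfl fun j _ ↦ ?_
    ring
  have h2 : ∑ i, ∑ j, α (b i) (b j) * (2⁻¹ * (b.repr u i * b.repr v j - b.repr u j * b.repr v i)) =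
      α u v := by
    have h3 := h u v
    have h4 := h v u
    rw [hα v u] at h4
    have h5 : α u v = 2⁻¹ * (α u v - - α u v) := by ring
    conv_rhs => rw [h5, ← h4]
    conv_rhs => rw [← h3]
    rw [← Finset.sum_sub_distrib, Finset.mul_sum]
    refine Finset.sum_congr rfl fun i _ ↦ ?_
    rw [← Finset.sum_sub_distrib, Finset.mul_sum]
    refine Finset.sum_congr rfl fun j _ ↦ ?_
    ring
  rw [complexifiedForm_apply, ← h2]
  push_cast
  simp only [complexifiedCoord_diagonal]

/-- Writing `u = (c, c) + J(d, d)` and testing on `(v, v)` gives `α c v + i α d v`; real and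
imaginary parts vanish separately. -/
theorem nondegenerate_of_diagonal {β : E × E →L[ℝ] E × E →L[ℝ] ℂ} {α : E →L[ℝ] E →L[ℝ] ℝ}
    (hJ : ∀ u v, β (modelJ E u) v = Complex.I * β u v) (h : ∀ u v, β (u, u) (v, v) = α u v)
    (hα : ∀ u, (∀ v, α u v = 0) → u = 0) (u : E × E) (hu : ∀ v, β u v = 0) : u = 0 := by
  obtain ⟨c, d, rfl⟩ := eq_diagonal_add_modelJ u
  have h1 : ∀ v, α c v = 0 ∧ α d v = 0 := fun v ↦ by
    have h2 := hu (v, v)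
    rw [map_add, add_apply, hJ, h, h] at h2
    exact ⟨by simpa using congrArg Complex.re h2, by simpa using congrArg Complex.im h2⟩
  rw [hα c fun v ↦ (h1 v).1, hα d fun v ↦ (h1 v).2]
  exact (zero_add _).trans (map_zero (modelJ E))

/-- A real-analytic nondegenerate 2-form on `E` extends to a holomorphic 2-form on `E × Ē`. -/
theorem exists_holomorphic_extension {α : E → E →L[ℝ] E →L[ℝ] ℝ} {x₀ : E}
    (hα : AnalyticAt ℝ α x₀) (halt : ∀ᶠ x in 𝓝 x₀, ∀ u v, α x u v = - α x v u)
    (hnd : ∀ u, (∀ v, α x₀ u v = 0) → u = 0) :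
    ∃ β : E × E → E × E →L[ℝ] E × E →L[ℝ] ℂ, (∀ z u, β z u u = 0) ∧
      (∀ z u v, β z (modelJ E u) v = Complex.I * β z u v) ∧
      (∀ᶠ z in 𝓝 (x₀, x₀), (∀ u v, JDiffAt (fun z ↦ β z u v) z) ∧
        ∀ u, (∀ v, β z u v = 0) → u = 0) ∧
      ∀ᶠ x in 𝓝 x₀, ∀ u v, β (x, x) (u, u) (v, v) = α x u v := by
  let b := Module.finBasis ℝ E
  let Φ : E × E →L[ℝ] (Fin (Module.finrank ℝ E) → ℂ) :=
    ContinuousLinearMap.pi fun j ↦ complexifiedCoord b j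
  have hΦ : ∀ u, Φ (modelJ E u) = Complex.I • Φ u := fun u ↦
    funext fun j ↦ complexifiedCoord_modelJ b j u
  have hf : ∀ i j, AnalyticAt ℝ (fun x ↦ (α x (b i) (b j) : ℂ)) x₀ := fun i j ↦
    (((Complex.ofRealCLM.comp (ContinuousLinearMap.apply ℝ ℝ (b j))).comp
      (ContinuousLinearMap.apply ℝ (E →L[ℝ] ℝ) (b i))).analyticAt _).comp hα
  choose G hG hGf using fun i j ↦ (hf i j).exists_complexification b
  let F : E × E → Fin (Module.finrank ℝ E) → Fin (Module.finrank ℝ E) → ℂ := fun z i j ↦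
    G i j (Φ (z - (x₀, x₀)))
  have hFJ : ∀ᶠ z in 𝓝 (x₀, x₀), ∀ i j, JDiffAt (fun z ↦ F z i j) z := by
    have hc : Tendsto (fun z : E × E ↦ Φ (z - (x₀, x₀))) (𝓝 (x₀, x₀)) (𝓝 0) :=
      (by fun_prop : Continuous fun z : E × E ↦ Φ (z - (x₀, x₀))).tendsto' _ _ (by simp)
    filter_upwards [hc.eventually (eventually_all.2 fun i ↦ eventually_all.2 (hG i))] with z hz i j
    exact jDiffAt_comp_of_complexLinear hΦ (hz i j)
  have hdiag : ∀ᶠ x in 𝓝 x₀, ∀ u v, complexifiedForm b (F (x, x)) (u, u) (v, v) = α x u v := by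
    filter_upwards [eventually_all.2 fun i ↦ eventually_all.2 (hGf i), halt] with x hx halt u v
    rw [← complexifiedForm_diagonal b halt]
    have : F (x, x) = fun i j ↦ (α x (b i) (b j) : ℂ) := by
      funext i j
      rw [← hx i j]
      exact congrArg (G i j) (funext fun l ↦ complexifiedCoord_diagonal b l (x - x₀))
    rw [this]
  have hJ : ∀ᶠ z in 𝓝 (x₀, x₀), ∀ u v,
      JDiffAt (fun z ↦ complexifiedForm b (F z) u v) z := by
    filter_upwards [hFJ] with z hz u v
    simp only [complexifiedForm_apply]
    exact .sum fun i _ ↦ .sum fun j _ ↦ (hz i j).mul_const _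
  refine ⟨fun z ↦ complexifiedForm b (F z), fun z ↦ complexifiedForm_self b _,
    fun z ↦ complexifiedForm_modelJ b _, hJ.and ?_, hdiag⟩
  -- Nondegeneracy holds at `(x₀, x₀)`, and injectivity of linear maps is an open condition, so
  -- continuity spreads it to a neighbourhood.
  have hcont : ContinuousAt (fun z ↦ complexifiedForm b (F z)) (x₀, x₀) := by
    obtain ⟨t, ht, hto, hxt⟩ := eventually_nhds_iff.1 hJ
    have h1 : ContinuousOn (fun z ↦ complexifiedForm b (F z)) t :=
      continuousOn_clm_apply.2 fun u ↦ continuousOn_clm_apply.2 fun v z hz ↦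
        (ht z hz u v).1.continuousAt.continuousWithinAt
    exact h1.continuousAt (hto.mem_nhds hxt)
  have h0 : Function.Injective (complexifiedForm b (F (x₀, x₀))) :=
    (injective_iff_map_eq_zero _).2 fun u hu ↦ nondegenerate_of_diagonal
      (complexifiedForm_modelJ b _) hdiag.self_of_nhds hnd u fun v ↦ by rw [hu]; rfl
  filter_upwards [hcont.preimage_mem_nhds (ContinuousLinearMap.isOpen_injective.mem_nhds h0)]
    with z hz u hu
  exact (injective_iff_map_eq_zero _).1 hz u (ContinuousLinearMap.ext hu)

end LocalExtension

/-! ### Forms on `N × N̄` defined in one product chart. -/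

section ChartForm

set_option synthInstance.maxHeartbeats 400000
set_option linter.unusedSectionVars false

open Filter Topology

variable {E : Type*} [NormedAddCommGroup E] [NormedSpace ℂ E]

/-- Differentiate `Dψ ∘ J = J ∘ Dψ` and use symmetry of the second derivative. -/
theorem fderiv_fderiv_modelJ {ψ : E × E → E × E} {z : E × E} (hψ : ContDiffAt ℝ 2 ψ z)
    (hJ : ∀ᶠ y in 𝓝 z, ∀ u, fderiv ℝ ψ y (modelJ E u) = modelJ E (fderiv ℝ ψ y u)) (u v : E × E) :
    fderiv ℝ (fderiv ℝ ψ) z (modelJ E u) v = modelJ E (fderiv ℝ (fderiv ℝ ψ) z u v) := by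
  have hd : DifferentiableAt ℝ (fderiv ℝ ψ) z :=
    (hψ.fderiv_right (m := 1) (by norm_num)).differentiableAt one_ne_zero
  have hsymm : IsSymmSndFDerivAt ℝ ψ z := hψ.isSymmSndFDerivAt (by simp)
  have h1 := hd.hasFDerivAt.clm_apply (hasFDerivAt_const (modelJ E u) z)
  have h2 := (modelJ E).hasFDerivAt.comp z (hd.hasFDerivAt.clm_apply (hasFDerivAt_const u z))
  have e : (fun y ↦ fderiv ℝ ψ y (modelJ E u)) =ᶠ[𝓝 z]
      (modelJ E) ∘ fun y ↦ fderiv ℝ ψ y u := by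
    filter_upwards [hJ] with y hy using hy u
  have h3 := congrArg (fun T : E × E →L[ℝ] E × E ↦ T v) (h1.unique (h2.congr_of_eventuallyEq e))
  rw [hsymm, hsymm u v]
  simpa using h3

theorem jDiffAt_pullback {β : E × E → E × E →L[ℝ] E × E →L[ℝ] ℂ} {ψ : E × E → E × E} {z : E × E}
    (hψ : ContDiffAt ℝ 2 ψ z) (hβ : DifferentiableAt ℝ β (ψ z))
    (hβJ : ∀ u v, JDiffAt (fun z ↦ β z u v) (ψ z))
    (hl : ∀ u v, β (ψ z) (modelJ E u) v = Complex.I * β (ψ z) u v)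
    (hr : ∀ u v, β (ψ z) u (modelJ E v) = Complex.I * β (ψ z) u v)
    (hJ : ∀ᶠ y in 𝓝 z, ∀ u, fderiv ℝ ψ y (modelJ E u) = modelJ E (fderiv ℝ ψ y u)) (v w : E × E) :
    JDiffAt (fun y ↦ β (ψ y) (fderiv ℝ ψ y v) (fderiv ℝ ψ y w)) z := by
  obtain ⟨T, hT, hTu⟩ := hasFDerivAt_pullback hψ hβ v w
  refine ⟨hT.differentiableAt, fun u ↦ ?_⟩
  rw [hT.fderiv, hTu, hTu, fderiv_fderiv_modelJ hψ hJ, fderiv_fderiv_modelJ hψ hJ, hl, hr,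
    hJ.self_of_nhds, ← fderiv_clm_apply_apply hβ, ← fderiv_clm_apply_apply hβ, (hβJ _ _).2]
  ring

variable {N : Type*} [TopologicalSpace N] [ChartedSpace E N] [IsManifold 𝓘(ℂ, E) ω N]
  {β : E × E → E × E →L[ℝ] E × E →L[ℝ] ℂ} {p q : N × N}

/-- The form on `N × N̄` which is represented by `β` in the preferred chart at `p`. -/
def chartForm (p : N × N) (β : E × E → E × E →L[ℝ] E × E →L[ℝ] ℂ) : CForm E N := fun q ↦
  let c : E × E →L[ℝ] E × E := chartCoframe (𝓘(ℝ, E).prod 𝓘(ℝ, E)) p q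
  ((β (extChartAt (𝓘(ℝ, E).prod 𝓘(ℝ, E)) p q)).bilinearComp c c : E × E →L[ℝ] E × E →L[ℝ] ℂ)

theorem chartForm_apply (u v : TC E q) : chartForm p β q u v =
    β (extChartAt (𝓘(ℝ, E).prod 𝓘(ℝ, E)) p q) (chartCoframe (𝓘(ℝ, E).prod 𝓘(ℝ, E)) p q u)
      (chartCoframe (𝓘(ℝ, E).prod 𝓘(ℝ, E)) p q v) := rfl

theorem formRep_chartForm {z : E × E} (hz : z ∈ (extChartAt (𝓘(ℝ, E).prod 𝓘(ℝ, E)) p).target) :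
    formRep (𝓘(ℝ, E).prod 𝓘(ℝ, E)) (chartForm p β) p z = β z := by
  have hs := extChartAt_symm_mem_source hz
  refine ContinuousLinearMap.ext fun u ↦ ContinuousLinearMap.ext fun v ↦ ?_
  rw [formRep_apply, chartForm_apply, chartCoframe_chartFrame hs, chartCoframe_chartFrame hs,
    (extChartAt (𝓘(ℝ, E).prod 𝓘(ℝ, E)) p).right_inv hz]

theorem chartCoframe_modelJ (hq : q ∈ (chartAt (ModelProd E E) p).source) (u : TC E q) :
    chartCoframe (𝓘(ℝ, E).prod 𝓘(ℝ, E)) p q (Jc E q u) =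
      modelJ E (chartCoframe (𝓘(ℝ, E).prod 𝓘(ℝ, E)) p q u) := by
  rw [← chartCoframe_chartFrame (I := 𝓘(ℝ, E).prod 𝓘(ℝ, E)) hq
    (modelJ E (chartCoframe (𝓘(ℝ, E).prod 𝓘(ℝ, E)) p q u)), chartFrame_modelJ hq,
    chartFrame_chartCoframe (I := 𝓘(ℝ, E).prod 𝓘(ℝ, E)) hq u]

/-- Components in another product chart are a pullback by a transition map, whose derivative
commutes with `J`; such pullbacks preserve holomorphy. -/
theorem isHolomorphicTwoFormOn_chartForm [FiniteDimensional ℂ E] {U : Set (N × N)} {S : Set (E × E)}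
    (hS : IsOpen S) (hU : ∀ q ∈ U, q ∈ (chartAt (ModelProd E E) p).source ∧
      extChartAt (𝓘(ℝ, E).prod 𝓘(ℝ, E)) p q ∈ S)
    (halt : ∀ z u, β z u u = 0) (hJ : ∀ z u v, β z (modelJ E u) v = Complex.I * β z u v)
    (hβ : ∀ z ∈ S, ∀ u v, JDiffAt (fun z ↦ β z u v) z) :
    IsHolomorphicTwoFormOn U (chartForm p β) where
  alternating q hq u := halt _ _
  complexLinear q hq u v := by
    rw [chartForm_apply, chartCoframe_modelJ (hU q hq).1, hJ, chartForm_apply]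
  holomorphic p₁ u v q hq := by
    obtain ⟨hqp, hqS⟩ := hU q hq.1
    have hq₁ : q ∈ (chartAt (ModelProd E E) p₁).source := hq.2
    rw [isComplexDiffAt_iff_jDiffAt hq₁]
    let ψ : E × E → E × E := extChartAt (𝓘(ℝ, E).prod 𝓘(ℝ, E)) p ∘
      (extChartAt (𝓘(ℝ, E).prod 𝓘(ℝ, E)) p₁).symm
    have hψq : ψ (extChartAt (𝓘(ℝ, E).prod 𝓘(ℝ, E)) p₁ q) =
        extChartAt (𝓘(ℝ, E).prod 𝓘(ℝ, E)) p q := by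
      simp only [ψ, Function.comp_apply]
      rw [(extChartAt (𝓘(ℝ, E).prod 𝓘(ℝ, E)) p₁).left_inv (by rwa [extChartAt_source])]
    have hev : ∀ᶠ z in 𝓝 (extChartAt (𝓘(ℝ, E).prod 𝓘(ℝ, E)) p₁ q),
        z ∈ (extChartAt (𝓘(ℝ, E).prod 𝓘(ℝ, E)) p₁).target ∧
        (extChartAt (𝓘(ℝ, E).prod 𝓘(ℝ, E)) p₁).symm z ∈ (chartAt (ModelProd E E) p).source :=
      (isOpen_chart_preimage (E := E) (chartAt (ModelProd E E) p).open_source p₁).mem_nhds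
        ⟨(extChartAt _ p₁).map_source (by rwa [extChartAt_source]), by
          rwa [mem_preimage, (extChartAt _ p₁).left_inv (by rwa [extChartAt_source])]⟩
    have hψ' : ∀ᶠ z in 𝓝 (extChartAt (𝓘(ℝ, E).prod 𝓘(ℝ, E)) p₁ q),
        z ∈ (extChartAt (𝓘(ℝ, E).prod 𝓘(ℝ, E)) p₁).target ∧
        (extChartAt (𝓘(ℝ, E).prod 𝓘(ℝ, E)) p₁).symm z ∈ (chartAt (ModelProd E E) p).source ∧
        fderiv ℝ ψ z = tangentCoordChange (𝓘(ℝ, E).prod 𝓘(ℝ, E)) p₁ p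
          ((extChartAt (𝓘(ℝ, E).prod 𝓘(ℝ, E)) p₁).symm z) := by
      filter_upwards [hev] with z hz
      have h := hasFDerivAt_coordChange (I := 𝓘(ℝ, E).prod 𝓘(ℝ, E))
        (extChartAt_symm_mem_source hz.1) hz.2
      rw [(extChartAt (𝓘(ℝ, E).prod 𝓘(ℝ, E)) p₁).right_inv hz.1] at h
      exact ⟨hz.1, hz.2, h.fderiv⟩
    have hdiff : DifferentiableAt ℝ β (ψ (extChartAt (𝓘(ℝ, E).prod 𝓘(ℝ, E)) p₁ q)) := by
      rw [hψq]
      have : FiniteDimensional ℝ E := FiniteDimensional.complexToReal E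
      exact (contDiffAt_clm_of_apply fun u ↦ contDiffAt_clm_of_apply fun v ↦
        (contDiffOn_of_jDiffAt hS fun z hz ↦ hβ z hz u v).contDiffAt
          (hS.mem_nhds hqS)).differentiableAt (by simp)
    have hr : ∀ z u v, β z u (modelJ E v) = Complex.I * β z u v := fun z u v ↦ by
      have hsw : ∀ u v, β z u v = - β z v u := fun u v ↦ by
        have h1 := halt z (u + v)
        simp only [map_add, add_apply, halt, zero_add, add_zero] at h1
        exact eq_neg_of_add_eq_zero_right h1
      rw [hsw, hJ, hsw v u]; ring
    refine (jDiffAt_pullback (ψ := ψ) (((contDiffAt_coordChange (I := 𝓘(ℝ, E).prod 𝓘(ℝ, E)) hq₁ hqp)).of_le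
      le_top) hdiff (by rw [hψq]; exact hβ _ hqS) (hJ _) (hr _) ?_ u v).congr_of_eventuallyEq ?_
    · filter_upwards [hψ'] with z hz u
      rw [hz.2.2]
      exact tangentCoordChange_modelJ (extChartAt_symm_mem_source hz.1) hz.2.1 u
    · filter_upwards [hψ'] with z hz
      have hs := extChartAt_symm_mem_source hz.1
      rw [Function.comp_apply, coordField_eq_constField hs, coordField_eq_constField hs]
      refine (formRep_chartChange (I := 𝓘(ℝ, E).prod 𝓘(ℝ, E)) (p := p) (chartForm p β) hz.1 hz.2.1
        u v).trans ?_
      rw [formRep_chartForm ((extChartAt (𝓘(ℝ, E).prod 𝓘(ℝ, E)) p).map_source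
        (by rw [extChartAt_source]; exact hz.2.1)), hz.2.2]
      rfl

end ChartForm

/-! ### Local holomorphic extension of the Kähler form. -/

section LocalKahlerExtension

set_option synthInstance.maxHeartbeats 400000
set_option linter.unusedSectionVars false

open Filter Topology

variable {E : Type*} [NormedAddCommGroup E] [NormedSpace ℂ E] [FiniteDimensional ℂ E]
  {N : Type*} [TopologicalSpace N] [ChartedSpace E N] [IsManifold 𝓘(ℂ, E) ω N]

theorem AnalyticKahlerStructure.analyticAt_formRep_form (k : AnalyticKahlerStructure E N) (x : N) :
    AnalyticAt ℝ (formRep 𝓘(ℝ, E) k.form x) (extChartAt 𝓘(ℝ, E) x x) := by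
  have h1 : AnalyticAt ℝ (fun z ↦ (formRep 𝓘(ℝ, E) k.metric.inner x z).comp
      (Complex.I • ContinuousLinearMap.id ℝ E : E →L[ℝ] E)) (extChartAt 𝓘(ℝ, E) x x) :=
    ContDiffAt.analyticAt ((k.contDiffAt_formRep x).clm_comp contDiffAt_const)
  refine h1.congr ?_
  filter_upwards [eventually_mem_extChartAt_target (I := 𝓘(ℝ, E)) (mem_chart_source E x)] with z hz
  ext u v
  exact (k.formRep_form hz u v).symm

theorem AnalyticKahlerStructure.exists_local_extension (k : AnalyticKahlerStructure E N) (x : N)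
    {W : Set (N × N)} (hW : IsOpen W) (hx : (x, x) ∈ W) : ∃ (O : Set N) (Ω : CForm E N),
      IsOpen O ∧ x ∈ O ∧ O ×ˢ O ⊆ W ∧ IsHolomorphicTwoFormOn (O ×ˢ O) Ω ∧
      IsNondegenerateOn (O ×ˢ O) Ω ∧ ∀ y ∈ O, ∀ u v : TangentSpace 𝓘(ℝ, E) y,
        Ω (y, y) (pairT u u) (pairT v v) = (k.form y u v : ℂ) := by
  have : FiniteDimensional ℝ E := FiniteDimensional.complexToReal E
  obtain ⟨β, halt, hJ, hβ, hdiag⟩ := exists_holomorphic_extension (k.analyticAt_formRep_form x)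
    (Eventually.of_forall fun z u v ↦ k.form_neg_swap _ _ _) fun u hu ↦ by
      by_contra hne
      -- A nonzero vector pairs nontrivially with its own multiple by `i`: `ω₀(u, iu) = g₀(iu, iu)`.
      have h1 : k.flatInner x (Complex.I • u) (Complex.I • u) = 0 :=
        (formRep_center k.form x u (Complex.I • u)).symm.trans (hu _)
      rw [(k.isHermitianMetric x).I_I] at h1
      exact ((k.isHermitianMetric x).pos u hne).ne' h1
  obtain ⟨S, hS, hSo, hxS⟩ := eventually_nhds_iff.1 hβ
  obtain ⟨S', hS', hSo', hxS'⟩ := eventually_nhds_iff.1 hdiag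
  have hT : IsOpen (((chartAt (ModelProd E E) (x, x)).source ∩
      extChartAt (𝓘(ℝ, E).prod 𝓘(ℝ, E)) (x, x) ⁻¹' S) ∩ W) := by
    refine IsOpen.inter ?_ hW
    have h := (continuousOn_extChartAt (I := 𝓘(ℝ, E).prod 𝓘(ℝ, E)) (x, x)).isOpen_inter_preimage
      (isOpen_extChartAt_source (x, x)) hSo
    rwa [extChartAt_source] at h
  have hO₁ : IsOpen ((chartAt E x).source ∩ extChartAt 𝓘(ℝ, E) x ⁻¹' S') := by
    have h := (continuousOn_extChartAt (I := 𝓘(ℝ, E)) x).isOpen_inter_preimage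
      (isOpen_extChartAt_source x) hSo'
    rwa [extChartAt_source] at h
  obtain ⟨A, B, hA, hB, hxA, hxB, hAB⟩ := isOpen_prod_iff.1 hT x x
    ⟨⟨mem_chart_source _ (x, x), hxS⟩, hx⟩
  have hsub : ∀ q ∈ ((A ∩ B) ∩ ((chartAt E x).source ∩ extChartAt 𝓘(ℝ, E) x ⁻¹' S')) ×ˢ
      ((A ∩ B) ∩ ((chartAt E x).source ∩ extChartAt 𝓘(ℝ, E) x ⁻¹' S')),
      (q ∈ (chartAt (ModelProd E E) (x, x)).source ∧
        extChartAt (𝓘(ℝ, E).prod 𝓘(ℝ, E)) (x, x) q ∈ S) ∧ q ∈ W := fun q hq ↦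
    hAB ⟨hq.1.1.1, hq.2.1.2⟩
  refine ⟨(A ∩ B) ∩ ((chartAt E x).source ∩ extChartAt 𝓘(ℝ, E) x ⁻¹' S'), chartForm (x, x) β,
    (hA.inter hB).inter hO₁, ⟨⟨hxA, hxB⟩, mem_chart_source E x, hxS'⟩, fun q hq ↦ (hsub q hq).2,
    isHolomorphicTwoFormOn_chartForm hSo (fun q hq ↦ (hsub q hq).1) halt hJ
      fun z hz ↦ (hS z hz).1, fun q hq u hu ↦ ?_, fun y hy u v ↦ ?_⟩
  · obtain ⟨hqs, hqS⟩ := (hsub q hq).1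
    have h1 := (hS _ hqS).2 (chartCoframe (𝓘(ℝ, E).prod 𝓘(ℝ, E)) (x, x) q u) fun w ↦ by
      rw [← chartCoframe_chartFrame (I := 𝓘(ℝ, E).prod 𝓘(ℝ, E)) hqs w]
      exact hu _
    rw [← chartFrame_chartCoframe (I := 𝓘(ℝ, E).prod 𝓘(ℝ, E)) hqs u, h1, map_zero]
  · have hyy := (hsub (y, y) ⟨hy, hy⟩).1.1
    have hc : ∀ u : TangentSpace 𝓘(ℝ, E) y,
        chartCoframe (𝓘(ℝ, E).prod 𝓘(ℝ, E)) (x, x) (y, y) (pairT u u) =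
          (chartCoframe 𝓘(ℝ, E) x y u, chartCoframe 𝓘(ℝ, E) x y u) := fun u ↦ by
      rw [← chartCoframe_chartFrame (I := 𝓘(ℝ, E).prod 𝓘(ℝ, E)) hyy
        (chartCoframe 𝓘(ℝ, E) x y u, chartCoframe 𝓘(ℝ, E) x y u), chartFrame_prod hyy,
        chartFrame_chartCoframe hy.2.1]
    rw [chartForm_apply, hc, hc]
    refine (hS' _ hy.2.2 _ _).trans ?_
    rw [formRep_extChartAt k.form hy.2.1, chartFrame_chartCoframe hy.2.1,
      chartFrame_chartCoframe hy.2.1]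

end LocalKahlerExtension

/-! ### Gluing the local extensions to a connected tube. -/

section KahlerExtension

set_option synthInstance.maxHeartbeats 400000
set_option linter.unusedSectionVars false

open Filter Topology Metric

variable {E : Type*} [NormedAddCommGroup E] [NormedSpace ℂ E]
  {N : Type*} [TopologicalSpace N] [ChartedSpace E N] [IsManifold 𝓘(ℂ, E) ω N]

variable (E) in
/-- The coordinate ball of radius `s` at `x`. -/
def chartBall (x : N) (s : ℝ) : Set N :=
  (chartAt E x).source ∩ extChartAt 𝓘(ℝ, E) x ⁻¹' ball (extChartAt 𝓘(ℝ, E) x x) s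

theorem isOpen_chartBall (x : N) (s : ℝ) : IsOpen (chartBall E x s) := by
  have h := (continuousOn_extChartAt (I := 𝓘(ℝ, E)) x).isOpen_inter_preimage
    (isOpen_extChartAt_source x) (isOpen_ball (x := extChartAt 𝓘(ℝ, E) x x) (ε := s))
  rwa [extChartAt_source] at h

theorem mem_chartBall (x : N) {s : ℝ} (hs : 0 < s) : x ∈ chartBall E x s :=
  ⟨mem_chart_source E x, mem_ball_self hs⟩

theorem chartBall_eq_image {x : N} {s : ℝ}
    (hs : ball (extChartAt 𝓘(ℝ, E) x x) s ⊆ (extChartAt 𝓘(ℝ, E) x).target) :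
    chartBall E x s = (extChartAt 𝓘(ℝ, E) x).symm '' ball (extChartAt 𝓘(ℝ, E) x x) s := by
  ext y
  constructor
  · rintro ⟨h1, h2⟩
    exact ⟨_, h2, (extChartAt 𝓘(ℝ, E) x).left_inv (by rwa [extChartAt_source])⟩
  · rintro ⟨z, hz, rfl⟩
    refine ⟨extChartAt_symm_mem_source (hs hz), ?_⟩
    rwa [mem_preimage, (extChartAt 𝓘(ℝ, E) x).right_inv (hs hz)]

theorem isPreconnected_chartBall {x : N} {s : ℝ}
    (hs : ball (extChartAt 𝓘(ℝ, E) x x) s ⊆ (extChartAt 𝓘(ℝ, E) x).target) :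
    IsPreconnected (chartBall E x s) := by
  rw [chartBall_eq_image hs]
  exact (convex_ball _ _).isPreconnected.image _ ((continuousOn_extChartAt_symm x).mono hs)

/-- In the chart the product of coordinate balls is a product of balls, to which the identity
theorem on the diagonal applies. -/
theorem IsHolomorphicTwoFormOn.eqOn_chartBall {Ω Ω' : CForm E N} {x : N} {s : ℝ}
    (hs : ball (extChartAt 𝓘(ℝ, E) x x) s ⊆ (extChartAt 𝓘(ℝ, E) x).target)
    (h : IsHolomorphicTwoFormOn (chartBall E x s ×ˢ chartBall E x s) Ω)
    (h' : IsHolomorphicTwoFormOn (chartBall E x s ×ˢ chartBall E x s) Ω')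
    (hd : ∀ y ∈ chartBall E x s, ∀ u v : TangentSpace 𝓘(ℝ, E) y,
      Ω (y, y) (pairT u u) (pairT v v) = Ω' (y, y) (pairT u u) (pairT v v)) {p : N × N}
    (hp : p ∈ chartBall E x s ×ˢ chartBall E x s) : Ω p = Ω' p := by
  have hps : p ∈ (chartAt (ModelProd E E) (x, x)).source :=
    mem_chartAt_prod_source.2 ⟨hp.1.1, hp.2.1⟩
  have hmem : ∀ z ∈ ball (extChartAt 𝓘(ℝ, E) x x) s ×ˢ ball (extChartAt 𝓘(ℝ, E) x x) s,
      z ∈ (extChartAt (𝓘(ℝ, E).prod 𝓘(ℝ, E)) (x, x)).target ∧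
      (extChartAt (𝓘(ℝ, E).prod 𝓘(ℝ, E)) (x, x)).symm z ∈
        chartBall E x s ×ˢ chartBall E x s := fun z hz ↦ by
    rw [extChartAt_prod, chartBall_eq_image hs]
    exact ⟨⟨hs hz.1, hs hz.2⟩, mem_image_of_mem _ hz.1, mem_image_of_mem _ hz.2⟩
  rw [form_eq_iff_formRep (I := 𝓘(ℝ, E).prod 𝓘(ℝ, E)) hps]
  intro u v
  rw [← sub_eq_zero]
  refine eq_zero_of_eq_zero_on_diagonal
    (f := fun z ↦ formRep (𝓘(ℝ, E).prod 𝓘(ℝ, E)) Ω (x, x) z u v -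
      formRep (𝓘(ℝ, E).prod 𝓘(ℝ, E)) Ω' (x, x) z u v) isOpen_ball (convex_ball _ _)
    (fun z hz ↦ (h.jDiffAt (hmem z hz).1 (hmem z hz).2 u v).sub
      (h'.jDiffAt (hmem z hz).1 (hmem z hz).2 u v)) (fun w hw ↦ ?_)
    (z := extChartAt (𝓘(ℝ, E).prod 𝓘(ℝ, E)) (x, x) p) ?_
  · have hy : (extChartAt 𝓘(ℝ, E) x).symm w ∈ chartBall E x s := by
      rw [chartBall_eq_image hs]; exact mem_image_of_mem _ hw
    have h1 : Ω ((extChartAt 𝓘(ℝ, E) x).symm w, (extChartAt 𝓘(ℝ, E) x).symm w) =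
        Ω' ((extChartAt 𝓘(ℝ, E) x).symm w, (extChartAt 𝓘(ℝ, E) x).symm w) :=
      eq_of_eq_on_diagonal h h' ⟨hy, hy⟩ (hd _ hy)
    let y := (extChartAt 𝓘(ℝ, E) x).symm w
    exact sub_eq_zero.2 (congrArg (fun T : TC E (y, y) →L[ℝ] TC E (y, y) →L[ℝ] ℂ ↦
      T (chartFrame (𝓘(ℝ, E).prod 𝓘(ℝ, E)) (x, x) (y, y) u)
        (chartFrame (𝓘(ℝ, E).prod 𝓘(ℝ, E)) (x, x) (y, y) v)) h1)
  · exact ⟨hp.1.2, hp.2.2⟩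

variable [FiniteDimensional ℂ E]

theorem IsHolomorphicTwoFormOn.of_locally {Ω : CForm E N} {U : Set (N × N)}
    (h : ∀ p ∈ U, ∃ V Ω', IsOpen V ∧ p ∈ V ∧ IsHolomorphicTwoFormOn V Ω' ∧ ∀ q ∈ V, Ω q = Ω' q) :
    IsHolomorphicTwoFormOn U Ω where
  alternating p hp u := by
    obtain ⟨V, Ω', -, hpV, hΩ', heq⟩ := h p hp
    rw [heq p hpV]; exact hΩ'.alternating p hpV u
  complexLinear p hp u v := by
    obtain ⟨V, Ω', -, hpV, hΩ', heq⟩ := h p hp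
    rw [heq p hpV]; exact hΩ'.complexLinear p hpV u v
  holomorphic p₀ u v p hp := by
    obtain ⟨V, Ω', hV, hpV, hΩ', heq⟩ := h p hp.1
    have hs : p ∈ (chartAt (ModelProd E E) p).source := mem_chart_source _ p
    have h1 := (isComplexDiffAt_iff_jDiffAt hs).1 (hΩ'.holomorphic p₀ u v p ⟨hpV, hp.2⟩)
    refine (isComplexDiffAt_iff_jDiffAt hs).2 (h1.congr_of_eventuallyEq ?_)
    filter_upwards [eventually_mem_chart_preimage (E := E) hV hpV] with z hz
    rw [Function.comp_apply, Function.comp_apply, heq _ hz.2]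

variable [T2Space N] [SecondCountableTopology N]

/-- For an auxiliary metric on `N`, the coordinate balls `D x` are taken so small that when two of
them meet, one lies inside the domain of the other's local extension. The local forms then agree on
overlaps and glue. -/
theorem AnalyticKahlerStructure.exists_extension (k : AnalyticKahlerStructure E N)
    {W : Set (N × N)} (hW : IsOpen W) (hd : diagonal N ⊆ W) :
    ∃ (U : Set (N × N)) (Ω : CForm E N), U ⊆ W ∧ IsKahlerExtensionOn k U Ω := by
  classical
  have : FiniteDimensional ℝ E := FiniteDimensional.complexToReal E
  have : LocallyCompactSpace N := ChartedSpace.locallyCompactSpace E N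
  have : TopologicalSpace.MetrizableSpace N := Manifold.metrizableSpace 𝓘(ℝ, E) N
  let : MetricSpace N := TopologicalSpace.metrizableSpaceMetric N
  choose O Ω hO hxO hOW hhol hnd hext using fun x ↦ k.exists_local_extension x hW (hd rfl)
  choose ρ hρ hρO using fun x ↦ Metric.isOpen_iff.1 (hO x) x (hxO x)
  have hs : ∀ x : N, ∃ s > 0, ball (extChartAt 𝓘(ℝ, E) x x) s ⊆ (extChartAt 𝓘(ℝ, E) x).target ∧
      chartBall E x s ⊆ ball x (ρ x / 3) := fun x ↦ by
    have h1 : (extChartAt 𝓘(ℝ, E) x).target ∩ (extChartAt 𝓘(ℝ, E) x).symm ⁻¹' ball x (ρ x / 3) ∈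
        𝓝 (extChartAt 𝓘(ℝ, E) x x) :=
      inter_mem ((isOpen_extChartAt_target x).mem_nhds (mem_extChartAt_target x))
        ((continuousAt_extChartAt_symm x).preimage_mem_nhds (by
          rw [extChartAt_to_inv]; exact ball_mem_nhds _ (by have := hρ x; positivity)))
    obtain ⟨s, hs, hsub⟩ := Metric.mem_nhds_iff.1 h1
    refine ⟨s, hs, fun z hz ↦ (hsub hz).1, fun y hy ↦ ?_⟩
    have h2 := (hsub hy.2).2
    rwa [mem_preimage, (extChartAt 𝓘(ℝ, E) x).left_inv (by rw [extChartAt_source]; exact hy.1)] at h2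
  choose s hs hst hsρ using hs
  let D : N → Set N := fun x ↦ chartBall E x (s x)
  have hDO : ∀ x, D x ⊆ O x := fun x y hy ↦ hρO x (ball_subset_ball
    (by have := hρ x; linarith) (hsρ x hy))
  -- With `ball x (ρ x) ⊆ O x` and `D x ⊆ ball x (ρ x / 3)`, a common point puts every point of `D
  -- y` within `ρ y / 3 + ρ y / 3 + ρ x / 3 ≤ ρ x` of `x`. Both forms are thus holomorphic on all of
  -- `D y ×ˢ D y`, where the identity theorem compares them.
  have hcompat' : ∀ x y, ρ y ≤ ρ x → ∀ p ∈ D x ×ˢ D x, p ∈ D y ×ˢ D y → Ω x p = Ω y p := by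
    intro x y hxy p hpx hpy
    have hsub : D y ⊆ O x := fun w hw ↦ hρO x <| by
      have h1 := hsρ y hw
      have h2 := hsρ y hpy.1
      have h3 := hsρ x hpx.1
      rw [mem_ball] at h1 h2 h3 ⊢
      have h4 := dist_triangle4 w y p.1 x
      rw [dist_comm y] at h4
      linarith
    refine IsHolomorphicTwoFormOn.eqOn_chartBall (hst y)
      ((hhol x).mono (prod_mono hsub hsub)) ((hhol y).mono (prod_mono (hDO y) (hDO y)))
      (fun w hw u v ↦ ?_) hpy
    rw [hext x w (hsub hw), hext y w (hDO y hw)]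
  have hcompat : ∀ x y, ∀ p ∈ D x ×ˢ D x, p ∈ D y ×ˢ D y → Ω x p = Ω y p := fun x y p hpx hpy ↦
    (le_total (ρ y) (ρ x)).elim (fun h ↦ hcompat' x y h p hpx hpy)
      fun h ↦ (hcompat' y x h p hpy hpx).symm
  let U : Set (N × N) := ⋃ x, D x ×ˢ D x
  -- The choice of `x` is immaterial by compatibility; outside `U` the value `0` is arbitrary.
  let Ω₀ : CForm E N := fun p ↦ if h : ∃ x, p ∈ D x ×ˢ D x then Ω h.choose p else 0
  have hΩ₀ : ∀ x, ∀ p ∈ D x ×ˢ D x, Ω₀ p = Ω x p := fun x p hp ↦ by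
    have h : ∃ x, p ∈ D x ×ˢ D x := ⟨x, hp⟩
    simp only [Ω₀, dif_pos h]
    exact hcompat _ _ p h.choose_spec hp
  have hDo : ∀ x, IsOpen (D x ×ˢ D x) := fun x ↦
    (isOpen_chartBall x (s x)).prod (isOpen_chartBall x (s x))
  have hxD : ∀ x, x ∈ D x := fun x ↦ mem_chartBall x (hs x)
  refine ⟨U, Ω₀, iUnion_subset fun x ↦ (prod_mono (hDO x) (hDO x)).trans (hOW x),
    ⟨isOpen_iUnion hDo, fun x ↦ mem_iUnion.2 ⟨x, hxD x, hxD x⟩, fun x ↦ ?_⟩,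
    .of_locally fun p hp ↦ ?_, fun p hp u hu ↦ ?_, fun x u v ↦ ?_⟩
  -- The slice over `x` is the union of the connected balls `D z` containing `x`.
  · have h : {y | (x, y) ∈ U} = ⋃₀ {A | ∃ z, x ∈ D z ∧ A = D z} := by
      ext y
      simp only [U, mem_ofPred_eq, mem_iUnion, mem_prod, mem_sUnion]
      exact ⟨fun ⟨z, h1, h2⟩ ↦ ⟨_, ⟨z, h1, rfl⟩, h2⟩, fun ⟨_, ⟨z, h1, h⟩, h2⟩ ↦ ⟨z, h1, h ▸ h2⟩⟩
    rw [h]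
    refine isPreconnected_sUnion x _ (fun A ⟨z, hz, hA⟩ ↦ hA ▸ hz) fun A ⟨z, _, hA⟩ ↦ ?_
    rw [hA]
    exact isPreconnected_chartBall (hst z)
  · obtain ⟨x, hx⟩ := mem_iUnion.1 hp
    exact ⟨_, Ω x, hDo x, hx, (hhol x).mono (prod_mono (hDO x) (hDO x)), hΩ₀ x⟩
  · obtain ⟨x, hx⟩ := mem_iUnion.1 hp
    rw [hΩ₀ x p hx] at hu
    exact hnd x p (prod_mono (hDO x) (hDO x) hx) u hu
  · rw [hΩ₀ x (x, x) ⟨hxD x, hxD x⟩]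
    exact hext x x (hxO x) u v

end KahlerExtension

/-! ### Restriction to smaller neighbourhoods, and the whole product as a tube. -/

section Restriction

variable {E : Type*} [NormedAddCommGroup E] [NormedSpace ℂ E]
  {N : Type*} [TopologicalSpace N] [ChartedSpace E N] [IsManifold 𝓘(ℂ, E) ω N]

theorem TensorQuadruple.IsCanonicalOn.mono {k : AnalyticKahlerStructure E N} {U V : Set (N × N)}
    {S : TensorQuadruple E N} (h : S.IsCanonicalOn k U) (hV : V ⊆ U) : S.IsCanonicalOn k V := by
  obtain ⟨Ω, cov, hbl, hk, hcov, hH, had, hpar⟩ := h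
  refine ⟨Ω, cov, ⟨hbl.holomorphic.mono hV, fun p hp ↦ hbl.nondegenerate p (hV hp),
    fun p hp ↦ hbl.closed p (hV hp), fun p hp ↦ hbl.vertical p (hV hp),
    fun p hp ↦ hbl.horizontal p (hV hp)⟩, hk,
    ⟨hcov.isCovariantDerivativeOn.mono hV, fun p hp ↦ hcov.torsionFree p (hV hp),
    fun p hp ↦ hcov.metric p (hV hp)⟩, ?_, ?_, ?_⟩
  · exact
    { smooth_g := hH.smooth_g.mono hV
      smooth_I := hH.smooth_I.mono hV
      smooth_J := hH.smooth_J.mono hV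
      smooth_K := hH.smooth_K.mono hV
      symm := fun p hp ↦ hH.symm p (hV hp)
      pos := fun p hp ↦ hH.pos p (hV hp)
      sq_I := fun p hp ↦ hH.sq_I p (hV hp)
      sq_J := fun p hp ↦ hH.sq_J p (hV hp)
      sq_K := fun p hp ↦ hH.sq_K p (hV hp)
      mul_IJ := fun p hp ↦ hH.mul_IJ p (hV hp)
      mul_JI := fun p hp ↦ hH.mul_JI p (hV hp)
      orth_I := fun p hp ↦ hH.orth_I p (hV hp)
      orth_J := fun p hp ↦ hH.orth_J p (hV hp)
      orth_K := fun p hp ↦ hH.orth_K p (hV hp) }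
  · exact ⟨fun p hp ↦ had.almostComplex p (hV hp), had.extends_g, had.extends_I, had.extends_form,
      fun p hp ↦ had.complexForm p (hV hp)⟩
  · exact ⟨fun p hp ↦ hpar.g p (hV hp), fun p hp ↦ hpar.I p (hV hp),
      fun p hp ↦ hpar.J p (hV hp), fun p hp ↦ hpar.K p (hV hp)⟩

theorem isConnectedTube_univ {N : Type*} [TopologicalSpace N] [PreconnectedSpace N] :
    IsConnectedTube (univ : Set (N × N)) :=
  ⟨isOpen_univ, fun _ ↦ mem_univ _, fun _ ↦ isPreconnected_univ⟩

end Restriction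

end

/-! ### The main theorem. -/

theorem mainTheorem4 {E : Type*} [NormedAddCommGroup E] [NormedSpace ℂ E] [FiniteDimensional ℂ E]
    {N : Type*} [TopologicalSpace N] [T2Space N] [SecondCountableTopology N]
    [ChartedSpace E N] [IsManifold 𝓘(ℂ, E) ω N] (k : AnalyticKahlerStructure E N) :
    (∀ W : Set (N × N), IsOpen W → diagonal N ⊆ W →
      ∃ U : Set (N × N), IsOpen U ∧ diagonal N ⊆ U ∧ U ⊆ W ∧
        ∃ S : TensorQuadruple E N, S.IsCanonicalOn k U ∧
          ∀ S' : TensorQuadruple E N, S'.IsCanonicalOn k U → S'.AgreeOn S U) ∧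
    (∀ (U₁ U₂ : Set (N × N)) (S₁ S₂ : TensorQuadruple E N),
      IsOpen U₁ → diagonal N ⊆ U₁ → IsOpen U₂ → diagonal N ⊆ U₂ →
      S₁.IsCanonicalOn k U₁ → S₂.IsCanonicalOn k U₂ →
      ∃ V : Set (N × N), IsOpen V ∧ diagonal N ⊆ V ∧ V ⊆ U₁ ∩ U₂ ∧ S₁.AgreeOn S₂ V) ∧
    (SimplyConnectedSpace N →
      (∃ Ω : CForm E N, IsHolomorphicTwoFormOn univ Ω ∧ IsNondegenerateOn univ Ω ∧
        ExtendsKahlerForm k Ω) →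
      ∃ S : TensorQuadruple E N, S.IsCanonicalOn k univ ∧
        ∀ S' : TensorQuadruple E N, S'.IsCanonicalOn k univ → S'.AgreeOn S univ) := by
  have hdiag : ∀ {U : Set (N × N)}, IsConnectedTube U → diagonal N ⊆ U := by
    rintro U hU ⟨x, y⟩ (rfl : x = y)
    exact hU.diagonal_mem x
  refine ⟨fun W hW hd ↦ ?_, fun U₁ U₂ S₁ S₂ h₁ hd₁ h₂ hd₂ hS₁ hS₂ ↦ ?_, ?_⟩
  · obtain ⟨U, Ω, hUW, h⟩ := k.exists_extension hW hd
    exact ⟨U, h.tube.isOpen, hdiag h.tube, hUW, canonicalQuadruple k Ω, h.isCanonicalOn,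
      fun S' hS' ↦ hS'.agreeOn h.tube h.isCanonicalOn⟩
  -- The intersection of the two neighbourhoods may have disconnected slices, so the comparison
  -- takes place on a connected tube inside it.
  · obtain ⟨V, Ω, hV, h⟩ := k.exists_extension (h₁.inter h₂) (subset_inter hd₁ hd₂)
    exact ⟨V, h.tube.isOpen, hdiag h.tube, hV, (hS₁.mono (hV.trans inter_subset_left)).agreeOn h.tube
      (hS₂.mono (hV.trans inter_subset_right))⟩
  · rintro hN ⟨Ω, hhol, hnd, hext⟩
    have h : IsKahlerExtensionOn k univ Ω := ⟨isConnectedTube_univ, hhol, hnd, hext⟩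
    exact ⟨canonicalQuadruple k Ω, h.isCanonicalOn, fun S' hS' ↦ hS'.agreeOn h.tube h.isCanonicalOn⟩
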